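/- Let $k$ be a commutative ring and $H$ a Hopf algebra over $k$ with coproduct $\Delta(h)=h_{(1)}\otimes h_{(2)}$, counit $\varepsilon$ and antipode $S$. Let $\varsigma\in H$ be grouplike, i.e. $\Delta(\varsigma)=\varsigma\otimes\varsigma$ and $\varepsilon(\varsigma)=1$, such that $S^2(h)=\varsigma h\varsigma^{-1}$ for all $h\in H$. Let $k_\varsigma$ be the left $H$-module $k$ (with $h\cdot m=\varepsilon(h)m$) with the right contraaction $\gamma:\mathrm{Hom}_k(H,k)\to k$, $\gamma(f)=f(\varsigma)$. (1) $k_\varsigma$ is a stable anti Yetter–Drinfel'd contramodule over $H$: for all $h\in H$, $f\in \mathrm{Hom}_k(H,k)$ and $m\in k$ one has $h\,\gamma(f)=\gamma\big(w\mapsto h_{(2)}f(S(h_{(3)})\,w\,h_{(1)})\big)$ and $\gamma(w\mapsto w m)=m$. (2) Let $C^n(H,k_\varsigma)=\mathrm{Hom}_k(H^{\otimes n},k)$ with the differential $\beta=\sum_{i=0}^{n+1}(-1)^i\delta_i:C^n\to C^{n+1}$, where $(\delta_0f)(u^1,\dots,u^{n+1})=f(u^1,\dots,u^n)\,\varepsilon(u^{n+1})$,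 $(\delta_if)(u^1,\dots,u^{n+1})=f(u^1,\dots,u^{n-i+1}u^{n-i+2},\dots,u^{n+1})$ for $1\le i\le n$, and $(\delta_{n+1}f)(u^1,\dots,u^{n+1})=\varepsilon(u^1)f(u^2,\dots,u^{n+1})$. Then the cohomology $H^\bullet(H,k_\varsigma)$ is a Batalin–Vilkovisky algebra over $k$: a unital associative graded commutative algebra with a bracket $\{\cdot,\cdot\}$ of degree $-1$, which is a graded Lie bracket for the degrees lowered by one and satisfies $\{\gamma,\alpha\smallsmile\beta\}=\{\gamma,\alpha\}\smallsmile\beta+(-1)^{(r-1)q}\alpha\smallsmile\{\gamma,\beta\}$ for $\gamma$ of degree $r$ and $\alpha$ of degree $q$, and with a $k$-linear differential $B$ of degree $-1$ such that $\{\alpha,\beta\}=(-1)^p\big(B(\alpha\smallsmile\beta)-B(\alpha)\smallsmile\beta-(-1)^p\alpha\smallsmile B(\beta)\big)$ for $\alpha$ of degree $p$. The structure is induced by the following operations on cochains. For $\varphi\in C^p$, $\psi\in C^q$ and $1\le i\le p$ put $$(\varphi\circ_i\psi)(u^1,\dots,u^{p+q-1})=\varphi\big(u^1,\dots,u^{p-i},\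 \psi(u^{p-i+1}_{(1)},\dots,u^{p-i+q}_{(1)})\,u^{p-i+1}_{(2)}\cdots u^{p-i+q}_{(2)},\ u^{p-i+q+1},\dots,u^{p+q-1}\big),$$ and $\mu(u,v)=\varepsilon(uv)$. The unit is $1\in k=C^0$; the product is $\varphi\smallsmile\psi=(\mu\circ_2\varphi)\circ_1\psi$; the bracket is $\{\varphi,\psi\}=\varphi\{\psi\}-(-1)^{(p-1)(q-1)}\psi\{\varphi\}$ with $\varphi\{\psi\}=\sum_{i=1}^p(-1)^{(i-1)(q-1)}\varphi\circ_i\psi$; and $B$ vanishes in degree $0$ and is given by Connes' coboundary $(-1)^{n}N\sigma(1-\lambda):C^{n+1}\to C^{n}$ of the cyclic operator $$(\tau f)(u^1,\dots,u^m)=\gamma\big(w\mapsto u^1_+f(u^2_+,\dots,u^m_+,u^m_-\cdots u^1_-w)\big)=f\big(u^2_{(1)},\dots,u^m_{(1)},S(u^m_{(2)})\cdots S(u^2_{(2)})S(u^1)\varsigma\big)$$ on $C^m$, where $h_+\otimes h_-=h_{(1)}\otimes S(h_{(2)})$ and $\tau=\mathrm{id}$ on $C^0$, $\lambda=(-1)^m\tau$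 on $C^m$, $N=\sum_{i=0}^{n}\lambda^i$ on $C^n$, and $(\sigma f)(u^1,\dots,u^n)=(\tau f)(1,u^1,\dots,u^n)$. (3) If $H$ is projective as a $k$-module, then $H^\bullet(H,k_\varsigma)\cong\mathrm{Ext}^\bullet_H(k,k_\varsigma)$: the graded $k$-module $\mathrm{Ext}^\bullet_H(k,k_\varsigma)$ with the Yoneda product $x\cdot y = y\circ x$ underlies a Batalin–Vilkovisky algebra, and there are $k$-linear isomorphisms $H^n(H,k_\varsigma)\cong\mathrm{Ext}^n_H(k,k_\varsigma)$, $n\ge 0$, compatible with the products, the brackets and the operators $B$. -/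

import Mathlib

open scoped TensorProduct DirectSum ModuleCat.Algebra

universe u

noncomputable section

/-! ## Gerstenhaber and Batalin–Vilkovisky algebras -/

/-- A Gerstenhaber algebra structure over `k` on a graded `k`-module `V = ⨁ₙ Vⁿ`, `n ∈ ℕ`:
a unital associative graded commutative product of degree `0` and a graded Lie bracket of
degree `-1` (so that an element of `Vᵖ` has degree `p - 1` for the bracket) satisfying the graded
Leibniz rule. In signs, `p + 1` is written for `p - 1`, which has the same parity. -/
structure GerstenhaberAlgebra (k : Type*) [CommRing k] (V : ℕ → Type*)
    [∀ n, AddCommGroup (V n)] [∀ n, Module k (V n)] where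
  /-- the product -/
  mul : (⨁ n, V n) →ₗ[k] (⨁ n, V n) →ₗ[k] (⨁ n, V n)
  /-- the unit -/
  one : V 0
  /-- the bracket -/
  bracket : (⨁ n, V n) →ₗ[k] (⨁ n, V n) →ₗ[k] (⨁ n, V n)
  mul_degree : ∀ (p q : ℕ) (a : V p) (b : V q), ∃ c : V (p + q),
    mul (DirectSum.lof k ℕ V p a) (DirectSum.lof k ℕ V q b) = DirectSum.lof k ℕ V (p + q) c
  mul_assoc : ∀ x y z : ⨁ n, V n, mul (mul x y) z = mul x (mul y z)
  one_mul : ∀ x : ⨁ n, V n, mul (DirectSum.lof k ℕ V 0 one) x = x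
  mul_one : ∀ x : ⨁ n, V n, mul x (DirectSum.lof k ℕ V 0 one) = x
  mul_comm : ∀ (p q : ℕ) (a : V p) (b : V q),
    mul (DirectSum.lof k ℕ V p a) (DirectSum.lof k ℕ V q b)
      = (-1 : k) ^ (p * q) • mul (DirectSum.lof k ℕ V q b) (DirectSum.lof k ℕ V p a)
  bracket_degree : ∀ (p q n : ℕ), n + 1 = p + q → ∀ (a : V p) (b : V q), ∃ c : V n,
    bracket (DirectSum.lof k ℕ V p a) (DirectSum.lof k ℕ V q b) = DirectSum.lof k ℕ V n c
  bracket_degree_zero : ∀ a b : V 0,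
    bracket (DirectSum.lof k ℕ V 0 a) (DirectSum.lof k ℕ V 0 b) = 0
  bracket_skew : ∀ (p q : ℕ) (a : V p) (b : V q),
    bracket (DirectSum.lof k ℕ V p a) (DirectSum.lof k ℕ V q b)
      = -((-1 : k) ^ ((p + 1) * (q + 1)) •
          bracket (DirectSum.lof k ℕ V q b) (DirectSum.lof k ℕ V p a))
  jacobi : ∀ (p q : ℕ) (a : V p) (b : V q) (z : ⨁ n, V n),
    bracket (DirectSum.lof k ℕ V p a) (bracket (DirectSum.lof k ℕ V q b) z)
      = bracket (bracket (DirectSum.lof k ℕ V p a) (DirectSum.lof k ℕ V q b)) z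
        + (-1 : k) ^ ((p + 1) * (q + 1)) •
          bracket (DirectSum.lof k ℕ V q b) (bracket (DirectSum.lof k ℕ V p a) z)
  leibniz : ∀ (r q : ℕ) (c : V r) (a : V q) (y : ⨁ n, V n),
    bracket (DirectSum.lof k ℕ V r c) (mul (DirectSum.lof k ℕ V q a) y)
      = mul (bracket (DirectSum.lof k ℕ V r c) (DirectSum.lof k ℕ V q a)) y
        + (-1 : k) ^ ((r + 1) * q) •
          mul (DirectSum.lof k ℕ V q a) (bracket (DirectSum.lof k ℕ V r c) y)

/-- A Batalin–Vilkovisky algebra: a Gerstenhaber algebra with a `k`-linear differential `B` of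
degree `-1` that generates the bracket. -/
structure BVAlgebra (k : Type*) [CommRing k] (V : ℕ → Type*)
    [∀ n, AddCommGroup (V n)] [∀ n, Module k (V n)] extends GerstenhaberAlgebra k V where
  /-- the differential -/
  B : (⨁ n, V n) →ₗ[k] (⨁ n, V n)
  B_degree : ∀ (n : ℕ) (a : V (n + 1)), ∃ c : V n,
    B (DirectSum.lof k ℕ V (n + 1) a) = DirectSum.lof k ℕ V n c
  B_degree_zero : ∀ a : V 0, B (DirectSum.lof k ℕ V 0 a) = 0
  B_B : ∀ x : ⨁ n, V n, B (B x) = 0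
  bracket_eq : ∀ (p : ℕ) (a : V p) (y : ⨁ n, V n),
    bracket (DirectSum.lof k ℕ V p a) y
      = (-1 : k) ^ p • (B (mul (DirectSum.lof k ℕ V p a) y)
          - mul (B (DirectSum.lof k ℕ V p a)) y
          - (-1 : k) ^ p • mul (DirectSum.lof k ℕ V p a) (B y))

/-! ## Contramodules and anti Yetter–Drinfel'd contramodules -/

/-- A right contramodule structure on the `k`-module `M` over the `k`-coalgebra `H`: a contraaction
`γ : Hom_k(H, M) → M` with `γ(h ↦ γ(h' ↦ g(h ⊗ h'))) = γ(h ↦ g(h₍₁₎ ⊗ h₍₂₎))` and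
`γ(h ↦ ε(h) m) = m`. -/
structure Contramodule (k H M : Type*) [CommRing k] [AddCommGroup H] [Module k H] [Coalgebra k H]
    [AddCommGroup M] [Module k M] where
  /-- the contraaction -/
  contraaction : (H →ₗ[k] M) →ₗ[k] M
  contraassociative : ∀ g : H →ₗ[k] H →ₗ[k] M,
    contraaction (contraaction ∘ₗ g)
      = contraaction (TensorProduct.lift g ∘ₗ Coalgebra.comul (R := k) (A := H))
  contraunital : ∀ m : M,
    contraaction ((Coalgebra.counit (R := k) (A := H)).smulRight m) = m

section Hopf

variable (k : Type*) {H : Type*} [CommRing k] [Ring H] [HopfAlgebra k H]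

/-- The translation map `h ↦ h₊ ⊗ h₋ = h₍₁₎ ⊗ S(h₍₂₎)` of a Hopf algebra. -/
def translation : H →ₗ[k] H ⊗[k] H :=
  (HopfAlgebra.antipode k (A := H)).lTensor H ∘ₗ Coalgebra.comul

/-- For a grouplike element `ς`, every `k`-module carries the `H`-contraaction `γ(f) = f(ς)`. -/
def evalContramodule (ς : GroupLike k H) (M : Type*) [AddCommGroup M] [Module k M] :
    Contramodule k H M where
  contraaction := LinearMap.applyₗ (ς : H)
  contraassociative g := by
    simp [ς.isGroupLikeElem_val.comul_eq_tmul_self]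
  contraunital m := by
    simp [ς.isGroupLikeElem_val.counit_eq_one]

variable {k}
variable {M : Type*} [AddCommGroup M] [Module k M] [Module H M] [IsScalarTower k H M]

/-- For `f ∈ Hom_k(H, M)`, the `k`-linear map `(a ⊗ b) ⊗ c ↦ (w ↦ b f(c w a))`. -/
def adjointTerm (f : H →ₗ[k] M) : (H ⊗[k] H) ⊗[k] H →ₗ[k] (H →ₗ[k] M) :=
  TensorProduct.lift (TensorProduct.lift (LinearMap.mk₂ k
    (fun a b : H =>
      { toFun := fun c : H =>
          Algebra.lsmul k k M b ∘ₗ f ∘ₗ LinearMap.mulLeft k c ∘ₗ LinearMap.mulRight k a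
        map_add' := fun c c' => by ext w; simp [add_mul]
        map_smul' := fun r c => by ext w; simp [smul_comm b r] })
    (fun a a' b => by ext c w; simp [mul_add])
    (fun r a b => by ext c w; simp [smul_comm b r])
    (fun a b b' => by ext c w; simp)
    (fun r a b => by ext c w; simp)))

/-- The anti Yetter–Drinfel'd condition for a left `H`-module right `H`-contramodule:
`u γ(f) = γ(u₊₍₂₎ f(u₋ (-) u₊₍₁₎))`. The compatibility of the underlying `k`-module
structures is automatic here. -/
def Contramodule.IsAntiYetterDrinfeld (C : Contramodule k H M) : Prop :=
  ∀ (h : H) (f : H →ₗ[k] M),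
    h • C.contraaction f
      = C.contraaction (adjointTerm f
          ((Coalgebra.comul (R := k) (A := H)).rTensor H (translation k h)))

/-- Stability: `γ((-) m) = m`. -/
def Contramodule.IsStable (C : Contramodule k H M) : Prop :=
  ∀ m : M, C.contraaction ((LinearMap.toSpanSingleton H M m).restrictScalars k) = m

end Hopf

/-! ## The cochain modules and the cocyclic operators -/

/-- `Cⁿ(H, M) = Hom_k(H^{⊗n}, M)`, as multilinear maps. -/
abbrev Cochain (k H M : Type*) [CommRing k] [AddCommGroup H] [Module k H] [AddCommGroup M]
    [Module k M] (n : ℕ) : Type _ :=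
  MultilinearMap k (fun _ : Fin n => H) M

section Insert

variable {k H M : Type*} [CommRing k] [AddCommGroup H] [Module k H] [AddCommGroup M] [Module k M]

/-- The arguments `(u_0, …, u_{s-1}, G(u_s, …, u_{s+q-1}), u_{s+q}, …, u_{n-1})`, where
`n = p + q - 1` (positions are numbered from `0`). -/
def insertArgs {p q n : ℕ} (hn : n + 1 = p + q) (s : Fin p) (G : (Fin q → H) → H)
    (u : Fin n → H) : Fin p → H := fun j =>
  if h : j.val < s.val then u ⟨j.val, by have := s.isLt; omega⟩
  else if h' : j.val = s.val then
    G fun l : Fin q => u ⟨s.val + l.val, by have := s.isLt; have := l.isLt; omega⟩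
  else u ⟨j.val + q - 1, by have := j.isLt; omega⟩

theorem insertArgs_update {p q n : ℕ} (hn : n + 1 = p + q) (s : Fin p)
    (G : MultilinearMap k (fun _ : Fin q => H) H) (u : Fin n → H) (m : Fin n) :
    ∃ (t : Fin p) (L : H →ₗ[k] H), ∀ x : H,
      insertArgs hn s G (Function.update u m x)
        = Function.update (insertArgs hn s G u) t (L x) := by
  have hs := s.isLt
  have hm := m.isLt
  by_cases h1 : m.val < s.val
  · refine ⟨⟨m.val, by omega⟩, LinearMap.id, fun x => ?_⟩
    funext j
    have hj := j.isLt
    by_cases hjm : j = ⟨m.val, by omega⟩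
    · rw [hjm]
      simp [insertArgs, h1]
    · rw [Function.update_of_ne hjm]
      have hjm' : j.val ≠ m.val := fun h => hjm (Fin.ext h)
      unfold insertArgs
      split_ifs with h2 h3
      · rw [Function.update_of_ne (by simpa [Fin.ext_iff] using hjm')]
      · congr 1
        funext l
        rw [Function.update_of_ne (by simp only [ne_eq, Fin.ext_iff]; omega)]
      · rw [Function.update_of_ne (by simp only [ne_eq, Fin.ext_iff]; omega)]
  · by_cases h2 : m.val < s.val + q
    · refine ⟨s, G.toLinearMap (fun l : Fin q => u ⟨s.val + l.val, by omega⟩)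
        ⟨m.val - s.val, by omega⟩, fun x => ?_⟩
      funext j
      have hj := j.isLt
      by_cases hjs : j = s
      · subst hjs
        simp only [insertArgs, lt_irrefl, dite_false, dite_true, Function.update_self,
          MultilinearMap.toLinearMap_apply]
        congr 1
        funext l
        by_cases hl : l = ⟨m.val - j.val, by omega⟩
        · subst hl
          have e : (⟨j.val + (m.val - j.val), by omega⟩ : Fin n) = m := Fin.ext (by simp; omega)
          simp only [e, Function.update_self]
        · have hl' : l.val ≠ m.val - j.val := fun h => hl (Fin.ext h)
          rw [Function.update_of_ne hl,
            Function.update_of_ne (by simp only [ne_eq, Fin.ext_iff]; omega)]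
      · rw [Function.update_of_ne hjs]
        have hjs' : j.val ≠ s.val := fun h => hjs (Fin.ext h)
        unfold insertArgs
        split_ifs with h3
        · rw [Function.update_of_ne (by simp only [ne_eq, Fin.ext_iff]; omega)]
        · rw [Function.update_of_ne (by simp only [ne_eq, Fin.ext_iff]; omega)]
    · refine ⟨⟨m.val + 1 - q, by omega⟩, LinearMap.id, fun x => ?_⟩
      funext j
      have hj := j.isLt
      by_cases hjm : j = ⟨m.val + 1 - q, by omega⟩
      · have hjm' : j.val = m.val + 1 - q := congrArg Fin.val hjm
        rw [← hjm, Function.update_self]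
        unfold insertArgs
        rw [dif_neg (by omega), dif_neg (by omega)]
        have e : (⟨j.val + q - 1, by omega⟩ : Fin n) = m := Fin.ext (by simp; omega)
        simp only [e, Function.update_self, LinearMap.id_apply]
      · rw [Function.update_of_ne hjm]
        have hjm' : j.val ≠ m.val + 1 - q := fun h => hjm (Fin.ext h)
        unfold insertArgs
        split_ifs with h3 h4
        · rw [Function.update_of_ne (by simp only [ne_eq, Fin.ext_iff]; omega)]
        · congr 1
          funext l
          have := l.isLt
          rw [Function.update_of_ne (by simp only [ne_eq, Fin.ext_iff]; omega)]
        · rw [Function.update_of_ne (by simp only [ne_eq, Fin.ext_iff]; omega)]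

/-- The multilinear map
`u ↦ f(u_0, …, u_{s-1}, G(u_s, …, u_{s+q-1}), u_{s+q}, …, u_{n-1})`, `n = p + q - 1`. -/
def insertAt {p q n : ℕ} (hn : n + 1 = p + q) (s : Fin p)
    (G : MultilinearMap k (fun _ : Fin q => H) H) : Cochain k H M p →ₗ[k] Cochain k H M n where
  toFun f := MultilinearMap.mk' (fun u => f (insertArgs hn s G u))
    (fun u m x y => by
      obtain ⟨t, L, h⟩ := insertArgs_update hn s G u m
      simp only [h, map_add, MultilinearMap.map_update_add])
    (fun u m r x => by
      obtain ⟨t, L, h⟩ := insertArgs_update hn s G u m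
      simp only [h, map_smul, MultilinearMap.map_update_smul])
  map_add' f g := by ext u; rfl
  map_smul' r f := by ext u; rfl

/-- Auxiliary bilinear map for `sweedlerSplit`: `(F, b) ↦ (id ⊗ μ(b, -)) ∘ F`. -/
def actSnd {N : Type*} [AddCommGroup N] [Module k N] (μ : H →ₗ[k] H →ₗ[k] H) (n : ℕ) :
    Cochain k H (N ⊗[k] H) n →ₗ[k] H →ₗ[k] Cochain k H (N ⊗[k] H) n :=
  LinearMap.mk₂ k (fun F b => ((μ b).lTensor N).compMultilinearMap F)
    (fun F F' b => by ext u; simp) (fun r F b => by ext u; simp)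
    (fun F b b' => by ext u; simp [LinearMap.lTensor_add])
    (fun r F b => by ext u; simp [LinearMap.lTensor_smul])

/-- Let `δ : H → H ⊗ H`, written `δ(u) = u' ⊗ u''`, and let `μ` be a product on `H` with the
element `1`. An `n`-linear map `F` with values in `N` is sent to the `n`-linear map
`(u_1, …, u_n) ↦ F(u_1', …, u_n') ⊗ μ(u_1'', μ(u_2'', … μ(u_n'', 1)))` with values in `N ⊗ H`;
by recursion on `n`. -/
def sweedlerSplit {N : Type*} [AddCommGroup N] [Module k N] [One H] (δ : H →ₗ[k] H ⊗[k] H)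
    (μ : H →ₗ[k] H →ₗ[k] H) : (n : ℕ) → Cochain k H N n →ₗ[k] Cochain k H (N ⊗[k] H) n
  | 0 => LinearMap.compMultilinearMapₗ k ((TensorProduct.mk k N H).flip 1)
  | n + 1 =>
    (multilinearCurryLeftEquiv k (fun _ : Fin (n + 1) => H) (N ⊗[k] H)).symm.toLinearMap
      ∘ₗ LinearMap.lcomp k _ δ
      ∘ₗ (TensorProduct.lift.equiv (RingHom.id k) H H (Cochain k H (N ⊗[k] H) n)).toLinearMap
      ∘ₗ LinearMap.compRight k (actSnd μ n ∘ₗ sweedlerSplit δ μ n)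
      ∘ₗ (multilinearCurryLeftEquiv k (fun _ : Fin (n + 1) => H) N).toLinearMap

end Insert

section Cocyclic

variable {k H M : Type*} [CommRing k] [Ring H] [HopfAlgebra k H]
  [AddCommGroup M] [Module k M] [Module H M] [IsScalarTower k H M]

variable (k H M) in
/-- `(u¹, …, uⁿ⁺¹) ↦ ε(uⁿ⁺¹) f(u¹, …, uⁿ)`. -/
def cofaceZero (n : ℕ) : Cochain k H M n →ₗ[k] Cochain k H M (n + 1) where
  toFun f := MultilinearMap.uncurryRight
    (LinearMap.compMultilinearMap
      (LinearMap.smulRightₗ (Coalgebra.counit (R := k) (A := H))) f)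
  map_add' f g := by ext u; simp
  map_smul' r f := by ext u; simp

variable (k H M) in
/-- `(u¹, …, uⁿ⁺¹) ↦ u¹ f(u², …, uⁿ⁺¹)`. -/
def cofaceLast (n : ℕ) : Cochain k H M n →ₗ[k] Cochain k H M (n + 1) where
  toFun f := LinearMap.uncurryLeft
    { toFun := fun h => LinearMap.compMultilinearMap (Algebra.lsmul k k M h) f
      map_add' := fun h h' => by ext u; simp
      map_smul' := fun r h => by ext u; simp }
  map_add' f g := by ext u; simp
  map_smul' r f := by ext u; simp

variable (k H M) in
/-- The cofaces `δ_i : Cⁿ(H, M) → Cⁿ⁺¹(H, M)`, `0 ≤ i ≤ n + 1`; for `1 ≤ i ≤ n` this is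
`(u¹, …, uⁿ⁺¹) ↦ f(u¹, …, uⁿ⁻ⁱ⁺¹ uⁿ⁻ⁱ⁺², …, uⁿ⁺¹)`. -/
def coface (n : ℕ) (i : Fin (n + 2)) : Cochain k H M n →ₗ[k] Cochain k H M (n + 1) :=
  if h₀ : i.val = 0 then cofaceZero k H M n
  else if h₁ : i.val = n + 1 then cofaceLast k H M n
  else insertAt rfl ⟨n - i.val, by have := i.isLt; omega⟩ (MultilinearMap.mkPiAlgebraFin k 2 H)

variable (k H M) in
/-- The codegeneracies `σ_j : Cⁿ⁺¹(H, M) → Cⁿ(H, M)`, `0 ≤ j ≤ n`: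
`(u¹, …, uⁿ) ↦ f(u¹, …, uⁿ⁻ʲ, 1, uⁿ⁻ʲ⁺¹, …, uⁿ)`. -/
def codegeneracy (n : ℕ) (j : Fin (n + 1)) : Cochain k H M (n + 1) →ₗ[k] Cochain k H M n :=
  insertAt rfl j.rev (MultilinearMap.mkPiAlgebraFin k 0 H)

variable (k H M) in
/-- The differential `β = ∑ᵢ (-1)ⁱ δ_i`. -/
def differential (n : ℕ) : Cochain k H M n →ₗ[k] Cochain k H M (n + 1) :=
  ∑ i : Fin (n + 2), (-1 : k) ^ i.val • coface k H M n i

/-- The cocyclic operator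
`(τf)(u¹, …, uⁿ) = γ(u¹₊ f(u²₊, …, uⁿ₊, uⁿ₋ ⋯ u¹₋ (-)))`.
Here `u¹ f(u², …, uⁿ, y) = (cofaceLast f)(u¹, …, uⁿ, y)`, to which the translation map is applied
in the first `n` arguments; for `n = 0` this reads `τ m = γ((-) m)`. -/
def cyclicOp (C : Contramodule k H M) (n : ℕ) (f : Cochain k H M n) : Cochain k H M n :=
  (C.contraaction ∘ₗ TensorProduct.lift
      (LinearMap.mk₂ k (fun (g : H →ₗ[k] M) (b : H) => g ∘ₗ LinearMap.mulLeft k b)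
        (fun g g' b => rfl) (fun r g b => rfl)
        (fun g b b' => by ext y; simp [add_mul])
        (fun r g b => by ext y; simp))).compMultilinearMap
    (sweedlerSplit (translation k) (LinearMap.mul k H).flip n (cofaceLast k H M n f).curryRight)

/-- Connes' coboundary `Cⁿ⁺¹ → Cⁿ` attached to the cocyclic structure: up to the sign `(-1)ⁿ` (the
one for which it generates the bracket below) it is `N σ (1 - λ)`, where
`λ = (-1)ⁿ τ` on `Cⁿ`, `N = ∑_{i=0}^{n} λⁱ` on `Cⁿ`, and `σ = σ_n τ : Cⁿ⁺¹ → Cⁿ` is the extra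
codegeneracy. -/
def connesOp (C : Contramodule k H M) (n : ℕ) (f : Cochain k H M (n + 1)) : Cochain k H M n :=
  (-1 : k) ^ n • ∑ i ∈ Finset.range (n + 1),
    (-1 : k) ^ (n * i) • (cyclicOp C n)^[i]
      (codegeneracy k H M n (Fin.last n)
        (cyclicOp C (n + 1) (f - (-1 : k) ^ (n + 1) • cyclicOp C (n + 1) f)))

variable (k H M) in
/-- The `n`-cocycles. -/
abbrev cocycles (n : ℕ) : Submodule k (Cochain k H M n) :=
  LinearMap.ker (differential k H M n)

variable (k H M) in
/-- The `n`-coboundaries. -/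
def coboundaries : (n : ℕ) → Submodule k (Cochain k H M n)
  | 0 => ⊥
  | n + 1 => LinearMap.range (differential k H M n)

variable (k H M) in
/-- The cohomology `Hⁿ(H, M)` of the complex `(C^•(H, M), β)`. -/
abbrev HopfCohomology (n : ℕ) : Type _ :=
  cocycles k H M n ⧸ (coboundaries k H M n).submoduleOf (cocycles k H M n)

/-- The class of the cocycle `f` in the direct sum of all `Hⁿ(H, M)`. -/
def cohomologyClass {n : ℕ} (f : Cochain k H M n) (hf : f ∈ cocycles k H M n) :
    ⨁ n, HopfCohomology k H M n :=
  DirectSum.lof k ℕ (HopfCohomology k H M) n (Submodule.Quotient.mk ⟨f, hf⟩)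

end Cocyclic

/-! ## Coefficients in the base ring -/

/-- The ground ring `k`, viewed as a left `H`-module via the counit. -/
def CounitModule (k H : Type*) [CommRing k] [Ring H] [HopfAlgebra k H] : Type _ := k

section Base

variable (k H : Type*) [CommRing k] [Ring H] [HopfAlgebra k H]

instance : CommRing (CounitModule k H) := inferInstanceAs (CommRing k)

instance : Module k (CounitModule k H) := inferInstanceAs (Module k k)

instance : Module H (CounitModule k H) :=
  Module.compHom k (Bialgebra.counitAlgHom k H).toRingHom

theorem CounitModule.smul_def (h : H) (m : CounitModule k H) :
    h • m = Coalgebra.counit (R := k) h • m := rfl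

instance : IsScalarTower k H (CounitModule k H) where
  smul_assoc r h m := by simp [CounitModule.smul_def, mul_smul]

/-- The identity, from the module `CounitModule k H` to the ring `k`. -/
def CounitModule.toBase : CounitModule k H ≃ₗ[k] k := LinearEquiv.refl k k

/-- The contramodule `k_ς`: the `H`-module `k` with contraaction the evaluation at `ς`. -/
abbrev baseContramodule (ς : GroupLike k H) : Contramodule k H (CounitModule k H) :=
  evalContramodule k ς (CounitModule k H)

variable {k H}

/-- `(u¹, …, u^q) ↦ ψ(u¹₍₁₎, …, u^q₍₁₎) u¹₍₂₎ ⋯ u^q₍₂₎` for a cochain `ψ` with values in `k`. -/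
def coactionMap {q : ℕ} (ψ : Cochain k H (CounitModule k H) q) :
    MultilinearMap k (fun _ : Fin q => H) H :=
  ((TensorProduct.lid k H).toLinearMap ∘ₗ
      (CounitModule.toBase k H).toLinearMap.rTensor H).compMultilinearMap
    (sweedlerSplit Coalgebra.comul (LinearMap.mul k H) q ψ)

/-- The operadic composition `φ ∘_{i+1} ψ` (with `i` numbered from `0`) on `C^•(H, k)`:
`(φ ∘_i ψ)(u¹, …, u^{p+q-1}) = φ(u¹, …, u^{p-i}, ψ(u^{p-i+1}₍₁₎, …, u^{p-i+q}₍₁₎)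
u^{p-i+1}₍₂₎ ⋯ u^{p-i+q}₍₂₎, u^{p-i+q+1}, …, u^{p+q-1})` for `1 ≤ i ≤ p`. -/
def operadComp {p q n : ℕ} (hn : n + 1 = p + q) (i : Fin p)
    (φ : Cochain k H (CounitModule k H) p) (ψ : Cochain k H (CounitModule k H) q) :
    Cochain k H (CounitModule k H) n :=
  insertAt hn i.rev (coactionMap ψ) φ

variable (k H) in
/-- The operad multiplication `μ(u, v) = ε(uv)`. -/
def operadMul : Cochain k H (CounitModule k H) 2 :=
  ((CounitModule.toBase k H).symm.toLinearMap ∘ₗ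
    Coalgebra.counit (R := k) (A := H)).compMultilinearMap (MultilinearMap.mkPiAlgebraFin k 2 H)

variable (k H) in
/-- The unit `1 ∈ k = C⁰(H, k)`. -/
def operadUnit : Cochain k H (CounitModule k H) 0 :=
  MultilinearMap.constOfIsEmpty k (fun _ : Fin 0 => H) (1 : CounitModule k H)

/-- The cup product `φ ⌣ ψ = (μ ∘_2 φ) ∘_1 ψ`. -/
def cupProduct {p q : ℕ} (φ : Cochain k H (CounitModule k H) p)
    (ψ : Cochain k H (CounitModule k H) q) : Cochain k H (CounitModule k H) (p + q) :=
  operadComp (n := p + q) (by omega) 0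
    (operadComp (n := p + 1) (by omega) 1 (operadMul k H) φ) ψ

/-- The brace `φ{ψ} = ∑_{i=1}^{p} (-1)^{(i-1)(q-1)} φ ∘_i ψ`. -/
def brace {p q n : ℕ} (hn : n + 1 = p + q) (φ : Cochain k H (CounitModule k H) p)
    (ψ : Cochain k H (CounitModule k H) q) : Cochain k H (CounitModule k H) n :=
  ∑ i : Fin p, (-1 : k) ^ (i.val * (q + 1)) • operadComp hn i φ ψ

/-- The Gerstenhaber bracket `{φ, ψ} = φ{ψ} - (-1)^{(p-1)(q-1)} ψ{φ}`. -/
def gerstenhaberBracket {p q n : ℕ} (hn : n + 1 = p + q) (φ : Cochain k H (CounitModule k H) p)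
    (ψ : Cochain k H (CounitModule k H) q) : Cochain k H (CounitModule k H) n :=
  brace hn φ ψ - (-1 : k) ^ ((p + 1) * (q + 1)) • brace (hn.trans (add_comm p q)) ψ φ

end Base

/-- `Extⁿ_H(k, k)`, in the category of left `H`-modules. -/
abbrev ExtBase (k H : Type u) [CommRing k] [Ring H] [HopfAlgebra k H] (n : ℕ) : Type u :=
  CategoryTheory.Abelian.Ext.{u} (ModuleCat.of H (CounitModule k H))
    (ModuleCat.of H (CounitModule k H)) n

end

noncomputable section

/-! The structure comes from a cyclic operad with multiplication: an operad with `μ` and unit `e`,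
together with operators `τ` satisfying `τⁿ⁺¹ = 1` in arity `n`, `τ μ = μ` and the two rules for `τ`
of a partial composition. The proof has three independent pieces: the cohomology of such an operad
is a Batalin–Vilkovisky algebra, the cochains of `H` form such an operad, and the bar resolution
compares the result with `Ext`.

For the operad, everything starts from the differential of one partial composition, `d_comp`. Its
error terms have the same shape for neighbouring slots, so signed sums over slots telescope and only
cup products survive at the ends. One insertion gives `d_brace`, hence graded commutativity and the
descent of the bracket; two insertions give the Leibniz rule, `brace_cup_mem_cob`. For the operator
`B`, let `normB` denote `N σ` up to sign. Inserting `e` at the rotated root of `f` and then `g`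
below it is a homotopy showing that `B f ⌣ g` is, up to sign, the brace `f{g}` minus a rotated brace
(`brace_sub_rotBrace_mem_cob`). On the other hand `B (f ⌣ g)` is exactly a signed sum of the two
rotated braces (`normB_cup`). Adding these relations gives `gbracket_bv_mem_cob`. Connes' coboundary
`N σ (1 - λ)` agrees with `N σ` on cocycles killed by one codegeneracy, and every class of positive
degree has such a representative. The Jacobi identity is formal once the other identities hold
(`jacobi_of_bv`), so no pre-Lie identity for braces is needed.

For the Hopf algebra, cochains are regarded as functionals on the tensor algebra `T(H)`, which is an
`H`-comodule algebra for the codiagonal coaction `x ↦ x₀ ⊗ x₁`. Composition with `g` replaces a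
factor `y` by `g(y₀) y₁`, and the operad axioms hold because this substitution is colinear
(`comul_coev`). The cyclic operator is `(τ f)(u x) = f(x₀ S(u x₁) ς)`. It is a retract of the plain
rotation of cochains with one more argument (`cyclicOp_pull`), which gives its order; the assumption
on `S²` is what brings an argument back after two passages through `S(-) ς`. Compatibility with
composition rests on the coaction formula `coaction_turn` and on coassociativity.

For `Ext`, the bar resolution is written with induced modules `H ⊗ Bar n`, so that a cochain is a
functional on `Bar n` and a cocycle is one whose restriction to the `n`-th syzygy is `H`-linear.
Dimension shifting identifies classes of cocycles with `Ext`, and lifting a cocycle to a chain map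
computes Yoneda products. These come out in the order opposite to the cup product, which a sign
`(-1)^{n(n-1)/2}` in degree `n` repairs. -/

/-- A non-symmetric cyclic operad with multiplication `mu` and unit `e`, in `k`-modules. The partial
composition `comp n i` from `O p` and `O q` is meaningful for `n + 1 = p + q` and `i < p` only. -/
structure CyclicOperad (k : Type*) [CommRing k] (O : ℕ → Type*)
    [∀ n, AddCommGroup (O n)] [∀ n, Module k (O n)] where
  /-- partial composition -/
  comp : ∀ {p q : ℕ} (n _i : ℕ), O p →ₗ[k] O q →ₗ[k] O n
  /-- the multiplication -/
  mu : O 2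
  /-- the unit of the multiplication -/
  e : O 0
  /-- the operadic identity -/
  one : O 1
  /-- the cyclic operator -/
  tau : ∀ n, O n →ₗ[k] O n
  seq : ∀ {p q r m l n i j : ℕ} (f : O p) (g : O q) (h : O r), i < p → j < q → m + 1 = q + r →
    l + 1 = p + q → n + 1 = p + m → comp n i f (comp m j g h) = comp n (i + j) (comp l i f g) h
  par : ∀ {p q r l l' n i j j' : ℕ} (f : O p) (g : O q) (h : O r), i < j → j < p → l + 1 = p + r →
    l' + 1 = p + q → n + 1 = l + q → j' + 1 = j + q →
    comp n i (comp l j f h) g = comp n j' (comp l' i f g) h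
  mu_mu : comp 3 0 mu mu = comp 3 1 mu mu
  mu_zero_e : comp 1 0 mu e = one
  mu_one_e : comp 1 1 mu e = one
  comp_one : ∀ {p i : ℕ} (f : O p), i < p → comp p i f one = f
  one_comp : ∀ {p : ℕ} (f : O p), comp p 0 one f = f
  exists_smul_e : ∀ f : O 0, ∃ r : k, f = r • e
  tau_pow : ∀ (n : ℕ) (f : O n), ((tau n)^[n + 1]) f = f
  tau_comp_succ : ∀ {p q n i : ℕ} (f : O p) (g : O q), i + 1 < p → n + 1 = p + q →
    tau n (comp n (i + 1) f g) = comp n i (tau p f) g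
  tau_comp_zero : ∀ {p q n j : ℕ} (f : O p) (g : O q), 0 < p → q = j + 1 → n + 1 = p + q →
    tau n (comp n 0 f g) = comp n j (tau q g) (tau p f)
  tau_mu : tau 2 mu = mu

/-! ### Cofaces and the differential of a partial composition -/

namespace CyclicOperad

variable {k : Type*} [CommRing k] {O : ℕ → Type*} [∀ n, AddCommGroup (O n)] [∀ n, Module k (O n)]
  (P : CyclicOperad k O)

/-- The cofaces of the cosimplicial module of an operad with multiplication. -/
def δ {n : ℕ} (j : ℕ) : O n →ₗ[k] O (n + 1) :=
  if j = 0 then P.comp (n + 1) 1 P.mu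
  else if j = n + 1 then P.comp (n + 1) 0 P.mu
  else (P.comp (n + 1) (j - 1)).flip P.mu

theorem δ_zero {n : ℕ} (f : O n) : P.δ 0 f = P.comp (n + 1) 1 P.mu f := by simp [δ]

theorem δ_last {n j : ℕ} (h : j = n + 1) (f : O n) : P.δ j f = P.comp (n + 1) 0 P.mu f := by
  simp [δ, h]

theorem δ_mid {n i : ℕ} (h : i < n) (f : O n) :
    P.δ (i + 1) f = P.comp (n + 1) i f P.mu := by
  simp [δ, show i ≠ n by omega]

/-- The differential `∑ⱼ (-1)ʲ δⱼ`. -/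
def d {n : ℕ} : O n →ₗ[k] O (n + 1) := ∑ j ∈ Finset.range (n + 2), (-1 : k) ^ j • P.δ j

theorem d_apply {n : ℕ} (f : O n) :
    P.d f = ∑ j ∈ Finset.range (n + 2), (-1 : k) ^ j • P.δ j f := by
  simp [d]

/-- The cup product. -/
def cup {p q : ℕ} (n : ℕ) : O p →ₗ[k] O q →ₗ[k] O n := P.comp n 0 ∘ₗ P.comp (p + 1) 1 P.mu

theorem cup_apply {p q n : ℕ} (f : O p) (g : O q) :
    P.cup n f g = P.comp n 0 (P.comp (p + 1) 1 P.mu f) g := rfl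

theorem seq_zero {p q r m l n i : ℕ} (f : O p) (g : O q) (h : O r) (hi : i < p) (hq : 0 < q)
    (hm : m + 1 = q + r) (hl : l + 1 = p + q) (hn : n + 1 = p + m) :
    P.comp n i f (P.comp m 0 g h) = P.comp n i (P.comp l i f g) h :=
  P.seq f g h hi hq hm hl hn

/-- The cofaces of `x ∘ᵢ a` fall into three ranges: those up to `i` lie below the inserted element
and push its slot up by one, the next `p` act inside `a`, and the remaining ones lie above it. This
lemma and the two after it treat one range each. -/
theorem δ_comp_of_le {r p n i j : ℕ} (x : O r) (a : O p) (hi : i < r) (hj : j ≤ i)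
    (hn : n + 1 = r + p) :
    P.δ j (P.comp n i x a) = P.comp (n + 1) (i + 1) (P.δ j x) a := by
  rcases j with _ | j
  · rw [δ_zero, δ_zero, P.seq (l := r + 1) _ _ _ (by omega) hi hn (by omega) (by omega),
      add_comm 1 i]
  · rw [P.δ_mid (by omega), P.δ_mid (by omega),
      P.par (l' := r + 1) (j' := i + 1) _ _ _ (by omega) hi hn (by omega) (by omega) (by omega)]

theorem δ_comp_mid {r p n i l : ℕ} (x : O r) (a : O p) (hi : i < r) (hl : l < p)
    (hn : n + 1 = r + p) :
    P.δ (i + l + 1) (P.comp n i x a) = P.comp (n + 1) i x (P.δ (l + 1) a) := by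
  rw [P.δ_mid (by omega), P.δ_mid hl, P.seq (l := n) _ _ _ hi hl (by omega) hn (by omega)]

theorem δ_comp_of_ge {r p n i j j' : ℕ} (x : O r) (a : O p) (hi : i < r) (hj : i + 2 ≤ j)
    (hjr : j ≤ r + 1) (hj' : j' + 1 = j + p) (hn : n + 1 = r + p) :
    P.δ j' (P.comp n i x a) = P.comp (n + 1) i (P.δ j x) a := by
  rcases eq_or_lt_of_le hjr with rfl | hlt
  · rw [P.δ_last (by omega), P.δ_last rfl,
      P.seq (l := r + 1) _ _ _ (by omega) hi hn (by omega) (by omega), zero_add]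
  · obtain ⟨j, rfl⟩ : ∃ m, j = m + 1 := ⟨j - 1, by omega⟩
    obtain ⟨j', rfl⟩ : ∃ m, j' = m + 1 := ⟨j' - 1, by omega⟩
    rw [P.δ_mid (by omega), P.δ_mid (by omega),
      P.par (l' := n) (j' := j') _ _ _ (by omega) (by omega) (by omega) hn (by omega) (by omega)]

/-- An outer coface of `a`, once `a` sits inside `x`, multiplies it by a neighbour. It is therefore
the coface `i + 1` of `x`, with `a` in one of the two slots which that coface creates. -/
theorem comp_δ_zero {r p i : ℕ} (x : O r) (a : O p) (hi : i < r) (n : ℕ) (hn : n = r + p) :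
    P.comp n i x (P.δ 0 a) = P.comp n (i + 1) (P.δ (i + 1) x) a := by
  rw [δ_zero, P.δ_mid hi, P.seq (l := r + 1) _ _ _ hi (by omega) (by omega) (by omega) (by omega)]

theorem comp_δ_last {r p i : ℕ} (x : O r) (a : O p) (hi : i < r) (n : ℕ) (hn : n = r + p) :
    P.comp n i x (P.δ (p + 1) a) = P.comp n i (P.δ (i + 1) x) a := by
  rw [P.δ_last rfl, P.δ_mid hi,
    P.seq (l := r + 1) _ _ _ hi (by omega) (by omega) (by omega) (by omega), add_zero]

/-- The sum of the first `m` terms of `(d x) ∘ᵢ a`. -/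
def partialD {r p : ℕ} (n m i : ℕ) (x : O r) (a : O p) : O n :=
  ∑ j ∈ Finset.range m, (-1 : k) ^ j • P.comp n i (P.δ j x) a

theorem partialD_top {r p n i : ℕ} (x : O r) (a : O p) :
    P.partialD n (r + 2) i x a = P.comp n i (P.d x) a := by
  simp [partialD, d_apply]

theorem partialD_succ {r p n m i : ℕ} (x : O r) (a : O p) :
    P.partialD n (m + 1) i x a
      = P.partialD n m i x a + (-1 : k) ^ m • P.comp n i (P.δ m x) a := by
  simp [partialD, Finset.sum_range_succ]

/-- The inner cofaces of `a` account for `x ∘ᵢ da` except for its two outer terms, which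
`comp_δ_zero` and `comp_δ_last` turn into cofaces of `x`. The two `partialD` corrections are the
values at `i + 1` and at `i` of one expression, so signed sums over `i` telescope. -/
theorem d_comp {r p n i : ℕ} (x : O r) (a : O p) (hi : i < r) (hn : n + 1 = r + p) :
    P.d (P.comp n i x a) = (-1 : k) ^ i • P.comp (n + 1) i x (P.d a)
      + P.partialD (n + 1) (i + 2) (i + 1) x a
      + (-1 : k) ^ (p + 1) • (P.comp (n + 1) i (P.d x) a - P.partialD (n + 1) (i + 1) i x a) := by
  obtain ⟨t, rfl⟩ : ∃ t, r = i + 1 + t := ⟨r - i - 1, by omega⟩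
  obtain rfl : n = i + p + t := by omega
  have e₁ : P.d (P.comp (i + p + t) i x a)
      = ∑ j ∈ Finset.range (i + 1),
          (-1 : k) ^ j • P.comp (i + p + t + 1) (i + 1) (P.δ j x) a
        + (-1 : k) ^ i • ∑ l ∈ Finset.range p,
          (-1 : k) ^ (l + 1) • P.comp (i + p + t + 1) i x (P.δ (l + 1) a)
        + (-1 : k) ^ (p + 1) • ∑ j ∈ Finset.range (t + 1),
          (-1 : k) ^ (i + 2 + j) • P.comp (i + p + t + 1) i (P.δ (i + 2 + j) x) a := by
    rw [d_apply, show i + p + t + 2 = (i + 1) + p + (t + 1) by omega, Finset.sum_range_add,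
      Finset.sum_range_add]
    congr 1
    · congr 1
      · refine Finset.sum_congr rfl fun j hj => ?_
        rw [P.δ_comp_of_le x a hi (by simp at hj; omega) hn]
      · rw [Finset.smul_sum]
        refine Finset.sum_congr rfl fun l hl => ?_
        rw [show i + 1 + l = i + l + 1 by omega,
          P.δ_comp_mid x a hi (by simpa using hl) hn, smul_smul]
        congr 1; ring
    · rw [Finset.smul_sum]
      refine Finset.sum_congr rfl fun j hj => ?_
      simp only [Finset.mem_range] at hj
      rw [P.δ_comp_of_ge (j := i + 2 + j) x a hi (by omega) (by omega) (by omega) hn, smul_smul]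
      congr 1; ring
  have e₂ : P.comp (i + p + t + 1) i (P.d x) a - P.partialD (i + p + t + 1) (i + 1) i x a
      = (-1 : k) ^ (i + 1) • P.comp (i + p + t + 1) i (P.δ (i + 1) x) a
        + ∑ j ∈ Finset.range (t + 1),
          (-1 : k) ^ (i + 2 + j) • P.comp (i + p + t + 1) i (P.δ (i + 2 + j) x) a := by
    rw [← partialD_top, sub_eq_iff_eq_add]
    unfold partialD
    rw [show i + 1 + t + 2 = (i + 2) + (t + 1) by omega, Finset.sum_range_add,
      Finset.sum_range_succ _ (i + 1)]
    abel
  have e₃ : P.comp (i + p + t + 1) i x (P.d a)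
      = P.comp (i + p + t + 1) (i + 1) (P.δ (i + 1) x) a
        + ∑ l ∈ Finset.range p, (-1 : k) ^ (l + 1) • P.comp (i + p + t + 1) i x (P.δ (l + 1) a)
        + (-1 : k) ^ (p + 1) • P.comp (i + p + t + 1) i (P.δ (i + 1) x) a := by
    rw [d_apply, map_sum, Finset.sum_range_succ, Finset.sum_range_succ', ← P.comp_δ_last x a hi,
      ← P.comp_δ_zero x a hi]
    · simp only [map_smul, pow_zero, one_smul]
      abel
    all_goals omega
  rw [e₁, e₂, e₃, partialD_succ, partialD]
  have hs : (-1 : k) ^ (i + 1) = - (-1 : k) ^ i := by ring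
  rw [hs]
  module

end CyclicOperad

/-! ### Cosimplicial identities, the cup product and the differential of a brace -/

namespace CyclicOperad

variable {k : Type*} [CommRing k] {O : ℕ → Type*} [∀ n, AddCommGroup (O n)] [∀ n, Module k (O n)]
  (P : CyclicOperad k O)

theorem δ_zero_δ_zero {n : ℕ} (x : O n) : P.δ 1 (P.δ 0 x) = P.δ 0 (P.δ 0 x) := by
  rw [δ_zero, δ_zero, P.δ_mid (i := 0) (by omega),
    P.par (l' := 3) (j' := 2) _ _ _ (by omega) (by omega) (by omega) (by omega) (by omega)
      (by omega),
    P.seq (l := 3) _ _ _ (by omega) (by omega) (by omega) (by omega) (by omega), P.mu_mu]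

theorem δ_succ_δ_zero {n j : ℕ} (hj : j ≤ n + 1) (x : O n) :
    P.δ (j + 1) (P.δ 0 x) = P.δ 0 (P.δ j x) := by
  rcases j with _ | j
  · exact P.δ_zero_δ_zero x
  rcases eq_or_lt_of_le hj with h | h
  · obtain rfl : j = n := by omega
    rw [P.δ_last (by omega), P.δ_last rfl, δ_zero, δ_zero,
      P.seq (l := 3) _ _ _ (by omega) (by omega) (by omega) (by omega) (by omega),
      P.seq (l := 3) _ _ _ (by omega) (by omega) (by omega) (by omega) (by omega), P.mu_mu]
  · rw [δ_zero, δ_zero, show j + 1 + 1 = 1 + j + 1 by omega,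
      P.δ_comp_mid _ _ (by omega) (by omega) (by omega)]

theorem δ_δ {n i j : ℕ} (hij : i ≤ j) (hj : j ≤ n + 1) (x : O n) :
    P.δ (j + 1) (P.δ i x) = P.δ i (P.δ j x) := by
  rcases i with _ | i
  · exact P.δ_succ_δ_zero hj x
  rcases eq_or_lt_of_le (hij.trans hj) with h | h
  · obtain rfl : i = n := by omega
    obtain rfl : j = i + 1 := by omega
    rw [P.δ_last rfl, P.δ_last rfl, P.δ_mid (by omega),
      ← P.par (l := 3) (j := 1) _ _ _ (by omega) (by omega) (by omega) (by omega) (by omega)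
        (by omega),
      P.seq (l := 3) _ _ _ (by omega) (by omega) (by omega) (by omega) (by omega), P.mu_mu]
  · rw [P.δ_mid (show i < n by omega)]
    rcases eq_or_lt_of_le hij with rfl | hlt
    · rw [P.δ_mid (show i < n by omega), P.δ_comp_mid (l := 1) _ _ (by omega) (by omega) (by omega),
        show i + 1 = i + 0 + 1 by omega,
        P.δ_comp_mid (l := 0) _ _ (by omega) (by omega) (by omega), P.δ_mid (by omega),
        P.δ_mid (by omega), P.mu_mu]
    · rw [P.δ_comp_of_ge (j := j) _ _ (by omega) (by omega) (by omega) (by omega) (by omega),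
        P.δ_mid (by omega)]

/-- For `i ≤ j` the index pairs `(j + 1, i)` and `(i, j)` carry equal values with opposite signs,
and together they exhaust the rectangle. -/
theorem sum_simplicial {M : Type*} [AddCommGroup M] [Module k M] (N : ℕ) (F : ℕ → ℕ → M)
    (hF : ∀ i j, i ≤ j → j < N → F (j + 1) i = F i j) :
    ∑ j ∈ Finset.range (N + 1), ∑ i ∈ Finset.range N, (-1 : k) ^ (i + j) • F j i = 0 := by
  have h₁ : ∀ j ∈ Finset.range (N + 1), ∑ i ∈ Finset.range N, (-1 : k) ^ (i + j) • F j i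
      = ∑ i ∈ Finset.range N, (if i < j then (-1 : k) ^ (i + j) • F j i else 0)
        + ∑ i ∈ Finset.range N, (if j ≤ i then (-1 : k) ^ (i + j) • F j i else 0) := by
    intro j _
    rw [← Finset.sum_add_distrib]
    refine Finset.sum_congr rfl fun i _ => ?_
    by_cases h : i < j
    · simp [h]
    · simp [h, not_lt.1 h]
  rw [Finset.sum_congr rfl h₁, Finset.sum_add_distrib, Finset.sum_range_succ']
  have h₂ : ∑ i ∈ Finset.range N, (if N ≤ i then (-1 : k) ^ (i + N) • F N i else 0) = 0 :=
    Finset.sum_eq_zero fun i hi => if_neg (by simpa using hi)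
  rw [Finset.sum_range_succ (fun j => ∑ i ∈ Finset.range N,
    (if j ≤ i then (-1 : k) ^ (i + j) • F j i else 0)), h₂, Finset.sum_comm (s := Finset.range N)
    (t := Finset.range N) (f := fun j i => if j ≤ i then (-1 : k) ^ (i + j) • F j i else 0)]
  simp only [not_lt_zero, if_false, Finset.sum_const_zero, add_zero]
  rw [← Finset.sum_add_distrib]
  refine Finset.sum_eq_zero fun j hj => ?_
  rw [← Finset.sum_add_distrib]
  refine Finset.sum_eq_zero fun i hi => ?_
  by_cases h : i ≤ j
  · rw [if_pos (by omega), if_pos h, hF i j h (by simpa using hj), ← add_smul,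
      show (-1 : k) ^ (i + (j + 1)) + (-1) ^ (j + i) = 0 by ring, zero_smul]
  · rw [if_neg (by omega), if_neg h, add_zero]

theorem d_d {n : ℕ} (x : O n) : P.d (P.d x) = 0 := by
  rw [d_apply, ← sum_simplicial (k := k) (n + 2) (fun j i => P.δ j (P.δ i x))
    fun i j hij hj => P.δ_δ hij (by omega) x]
  refine Finset.sum_congr rfl fun j _ => ?_
  rw [d_apply, map_sum, Finset.smul_sum]
  refine Finset.sum_congr rfl fun i _ => ?_
  rw [map_smul, smul_smul, ← pow_add, add_comm j i]

/-- `O 0` is spanned by `e`, and both cofaces of `e` are the operadic identity. -/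
theorem d_of_zero (x : O 0) : P.d x = 0 := by
  obtain ⟨r, rfl⟩ := P.exists_smul_e x
  have h₀ : P.comp (0 + 1) 0 P.mu P.e = P.one := P.mu_zero_e
  have h₁ : P.comp (0 + 1) 1 P.mu P.e = P.one := P.mu_one_e
  rw [map_smul, d_apply]
  simp [Finset.sum_range_succ, δ_zero, P.δ_last (n := 0) (j := 1) rfl, h₀, h₁]

/-- The coboundaries. -/
def cob : (n : ℕ) → Submodule k (O n)
  | 0 => ⊥
  | _ + 1 => LinearMap.range P.d

theorem d_mem_cob {n : ℕ} (x : O n) : P.d x ∈ P.cob (n + 1) := ⟨x, rfl⟩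

theorem cup_assoc {p q r m l n : ℕ} (x : O p) (y : O q) (z : O r) (hm : m = p + q)
    (hl : l = q + r) (hn : n = p + q + r) :
    P.cup n (P.cup m x y) z = P.cup n x (P.cup l y z) := by
  have h₁ : P.comp (m + 1) 1 P.mu (P.comp m 0 (P.comp (p + 1) 1 P.mu x) y)
      = P.comp (m + 1) 0 (P.comp (p + 1) 1 P.mu x) (P.comp (q + 1) 1 P.mu y) := by
    rw [P.seq (l := p + 2) _ _ _ (by omega) (by omega) (by omega) (by omega) (by omega),
      P.seq (l := 3) P.mu P.mu _ (by omega) (by omega) (by omega) (by omega) (by omega),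
      P.seq (l := p + 2) (P.comp (p + 1) 1 P.mu x) P.mu y (by omega) (by omega) (by omega)
        (by omega) (by omega)]
    have := P.δ_zero_δ_zero x
    rw [δ_zero, P.δ_mid (by omega), δ_zero] at this
    rw [this, P.seq (l := 3) _ _ _ (by omega) (by omega) (by omega) (by omega) (by omega)]
  simp only [cup_apply]
  rw [h₁, P.seq (l := m + 1) (P.comp (p + 1) 1 P.mu x) _ z (by omega) (by omega) (by omega)
    (by omega) (by omega)]

theorem cup_e {p : ℕ} (x : O p) : P.cup p x P.e = x := by
  simp only [cup_apply]
  rw [P.par (l' := 1) (j' := 0) _ _ _ (by omega) (by omega) (by omega) (by omega) (by omega)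
      (by omega), P.mu_zero_e, one_comp]

theorem e_cup {p : ℕ} (x : O p) : P.cup p P.e x = x := by
  exact (congrArg (fun t => P.comp p 0 t x) P.mu_one_e).trans (P.one_comp x)

/-- In `x ⌣ y` the factor `y` fills the lower slots, so the cofaces `0, …, q` act on `y` and the
others on `x`; this is why the sign depends on `q`. On the right-hand side `δ_{q+1} y` and `δ₀ x`
are left over; they give the same element with opposite signs. -/
theorem d_cup {p q n : ℕ} (x : O p) (y : O q) (hn : n = p + q) :
    P.d (P.cup n x y) = P.cup (n + 1) x (P.d y) + (-1 : k) ^ q • P.cup (n + 1) (P.d x) y := by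
  simp only [cup_apply]
  have h₀ : ∀ j ≤ q, P.δ j (P.comp n 0 (P.comp (p + 1) 1 P.mu x) y)
      = P.comp (n + 1) 0 (P.comp (p + 1) 1 P.mu x) (P.δ j y) := by
    rintro (_ | j) hj
    · rw [P.δ_comp_of_le _ _ (by omega) le_rfl (by omega),
        P.comp_δ_zero _ _ (by omega) _ (by omega), ← δ_zero, ← δ_zero_δ_zero]
    · rw [show j + 1 = 0 + j + 1 by omega, P.δ_comp_mid _ _ (by omega) (by omega) (by omega),
        zero_add]
  have h₁ : ∀ j ≤ p, P.δ (q + 1 + j) (P.comp n 0 (P.comp (p + 1) 1 P.mu x) y)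
      = P.comp (n + 1) 0 (P.comp (p + 2) 1 P.mu (P.δ (j + 1) x)) y := by
    intro j hj
    rw [P.δ_comp_of_ge (j := j + 2) _ _ (by omega) (by omega) (by omega) (by omega) (by omega),
      ← δ_zero, ← δ_zero, P.δ_succ_δ_zero (by omega)]
  rw [d_apply, show n + 2 = (q + 1) + (p + 1) by omega, Finset.sum_range_add, P.d_apply y,
    P.d_apply x, Finset.sum_range_succ (n := q + 1), Finset.sum_range_succ' (n := p + 1)]
  rw [Finset.sum_congr rfl fun j hj => by rw [h₀ j (by simp at hj; omega)],
    Finset.sum_congr (s₁ := Finset.range (p + 1)) rfl fun j hj => by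
      rw [h₁ j (by simp at hj; omega),
        show (-1 : k) ^ (q + 1 + j) = (-1) ^ q * (-1) ^ (j + 1) by ring, mul_smul]]
  simp only [map_add, map_sum, map_smul, LinearMap.add_apply, LinearMap.smul_apply,
    LinearMap.sum_apply]
  rw [P.comp_δ_last (p := q) _ _ (by omega) _ (by omega), ← δ_zero, zero_add, δ_zero_δ_zero,
    δ_zero (f := P.δ 0 x), smul_add, Finset.smul_sum]
  simp only [δ_zero, pow_zero, pow_succ]
  module

/-- The brace `x{a} = ∑ᵢ (-1)^{i(q-1)} x ∘ᵢ a`. -/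
def brace {p q : ℕ} (n : ℕ) : O p →ₗ[k] O q →ₗ[k] O n :=
  ∑ i ∈ Finset.range p, (-1 : k) ^ (i * (q + 1)) • P.comp n i

theorem brace_apply {p q n : ℕ} (x : O p) (a : O q) :
    P.brace n x a = ∑ i ∈ Finset.range p, (-1 : k) ^ (i * (q + 1)) • P.comp n i x a := by
  simp [brace]

theorem brace_of_zero {q n : ℕ} (x : O 0) (a : O q) : P.brace n x a = 0 := by
  simp [brace]

theorem mu_comp_comm {p q n : ℕ} (x : O p) (a : O q) (hn : n = p + q) :
    P.comp n p (P.comp (p + 1) 0 P.mu x) a = P.cup n a x := by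
  exact (P.par P.mu x a (by omega) (by omega) (by omega) (by omega) (by omega) (by omega)).symm

theorem sum_telescope {M : Type*} [AddCommGroup M] [Module k M] (s : k) (hs : s * s = 1) (r : ℕ)
    (L : ℕ → M) : ∑ i ∈ Finset.range r, s ^ i • (L (i + 1) - s • L i)
      = s • (s ^ r • L r - L 0) := by
  induction r with
  | zero => simp
  | succ r ih =>
    rw [Finset.sum_range_succ, ih]
    linear_combination (norm := module) (-s ^ r) • hs • L (r + 1)

theorem neg_one_pow_mul_self (n : ℕ) : (-1 : k) ^ n * (-1) ^ n = 1 := by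
  rw [← mul_pow]; simp

/-- Summing `d_comp` over the slots makes the partial sums telescope. The lower end consists of the
single coface `δ₀ x` and is `x ⌣ a`. The upper end combines with the last insertion into `dx` and
leaves the last coface of `x`, which contributes `a ⌣ x`. -/
theorem d_brace {r p n : ℕ} (x : O r) (a : O p) (hn : n + 1 = r + p) :
    P.d (P.brace n x a) = P.brace (n + 1) x (P.d a)
      + (-1 : k) ^ (p + 1) • P.brace (n + 1) (P.d x) a - (-1 : k) ^ (p + 1) • P.cup (n + 1) x a
      - (-1 : k) ^ (p * (r + 1)) • P.cup (n + 1) a x := by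
  have hs := neg_one_pow_mul_self (k := k) (p + 1)
  set s := (-1 : k) ^ (p + 1) with hs'
  have hterm : ∀ i ∈ Finset.range r, (-1 : k) ^ (i * (p + 1)) • P.d (P.comp n i x a)
      = (-1 : k) ^ (i * (p + 1 + 1)) • P.comp (n + 1) i x (P.d a)
        + s ^ i • (P.partialD (n + 1) (i + 1 + 1) (i + 1) x a
          - s • P.partialD (n + 1) (i + 1) i x a)
        + s • (s ^ i • P.comp (n + 1) i (P.d x) a) := by
    intro i hi
    rw [P.d_comp x a (by simpa using hi) hn, ← hs', mul_comm i, pow_mul, ← hs',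
      show (-1 : k) ^ (i * (p + 1 + 1)) = s ^ i * (-1) ^ i by rw [hs']; ring]
    module
  rw [brace_apply, map_sum]
  simp only [map_smul]
  rw [Finset.sum_congr rfl hterm, Finset.sum_add_distrib, Finset.sum_add_distrib,
    sum_telescope s hs r fun i => P.partialD (n + 1) (i + 1) i x a, ← brace_apply,
    ← Finset.smul_sum]
  -- `dx` has one slot more than `x`, so the sum over the slots of `x` misses the last term of the
  -- brace of `dx`.
  have e₁ : P.brace (n + 1) (P.d x) a
      = ∑ i ∈ Finset.range r, s ^ i • P.comp (n + 1) i (P.d x) a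
        + s ^ r • P.comp (n + 1) r (P.d x) a := by
    rw [brace_apply, Finset.sum_range_succ]
    simp only [mul_comm _ (p + 1), pow_mul, ← hs']
  have e₂ : P.partialD (n + 1) (0 + 1) 0 x a = P.cup (n + 1) x a := by
    simp [partialD, cup_apply, δ_zero]
  have e₃ : P.comp (n + 1) r (P.d x) a = P.partialD (n + 1) (r + 1) r x a
      + (-1 : k) ^ (r + 1) • P.cup (n + 1) a x := by
    rw [← partialD_top, partialD_succ, P.δ_last rfl, P.mu_comp_comm x a (by omega)]
  rw [e₁, e₂, e₃, show (-1 : k) ^ (p * (r + 1)) = s * s ^ r * (-1) ^ (r + 1) by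
    rw [hs', show (-1 : k) ^ (p + 1) * ((-1) ^ (p + 1)) ^ r * (-1) ^ (r + 1)
      = (-1) ^ (p * (r + 1)) * ((-1) ^ (r + 1) * (-1) ^ (r + 1)) by ring, neg_one_pow_mul_self,
      mul_one]]
  module

end CyclicOperad

/-! ### The Gerstenhaber bracket up to coboundaries -/

namespace CyclicOperad

variable {k : Type*} [CommRing k] {O : ℕ → Type*} [∀ n, AddCommGroup (O n)] [∀ n, Module k (O n)]
  (P : CyclicOperad k O)

theorem cup_comp_left {p q r m n i : ℕ} (x : O p) (y : O q) (z : O r) (hi : i < q)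
    (hm : m + 1 = q + r) (hn : n = p + m) :
    P.comp n i (P.cup (p + q) x y) z = P.cup n x (P.comp m i y z) := by
  simp only [cup_apply]
  rw [P.seq (l := p + q) _ _ _ (by omega) hi hm (by omega) (by omega), zero_add]

theorem cup_comp_right {p q r m n i : ℕ} (x : O p) (y : O q) (z : O r) (hi : i < p)
    (hm : m + 1 = p + r) (hn : n = m + q) :
    P.comp n (q + i) (P.cup (p + q) x y) z = P.cup n (P.comp m i x z) y := by
  simp only [cup_apply]
  rw [P.seq (l := p + 1) P.mu x z (by omega) hi hm (by omega) (by omega),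
    P.par (l' := p + q) (j' := q + i) (P.comp (p + 1) 1 P.mu x) y z (show 0 < 1 + i by omega)
      (by omega) (by omega) (by omega) (by omega) (by omega)]

/-- This half of the Leibniz rule holds on the nose, since an insertion into a product hits exactly
one factor. The degree conditions matter only when the corresponding sum is nonempty. -/
theorem cup_brace {p q r m m' n : ℕ} (x : O p) (y : O q) (z : O r)
    (hm : 0 < p → m + 1 = p + r) (hm' : 0 < q → m' + 1 = q + r) (hn : n + 1 = p + q + r) :
    P.brace n (P.cup (p + q) x y) z
      = P.cup n x (P.brace m' y z) + (-1 : k) ^ (q * (r + 1)) • P.cup n (P.brace m x z) y := by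
  rw [brace_apply, add_comm p q, Finset.sum_range_add, brace_apply, brace_apply, add_comm q p]
  simp only [map_sum, map_smul, LinearMap.sum_apply, LinearMap.smul_apply]
  rw [Finset.smul_sum]
  congr 1
  · refine Finset.sum_congr rfl fun i hi => ?_
    simp only [Finset.mem_range] at hi
    rw [P.cup_comp_left (m := m') x y z hi (hm' (by omega)) (by omega)]
  · refine Finset.sum_congr rfl fun i hi => ?_
    simp only [Finset.mem_range] at hi
    rw [P.cup_comp_right (m := m) x y z hi (hm (by omega)) (by omega), smul_smul]
    congr 1
    ring

/-- Over the triangle `i < j` the differences of `a` telescope in `i` and those of `w` in `j`. What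
survives is the diagonal, the edge `i = 0` and the edge `j = r`. -/
theorem sum_double_telescope {M : Type*} [AddCommGroup M] [Module k M] (s t : k) (hs : s * s = 1)
    (ht : t * t = 1) (r : ℕ) (a w : ℕ → ℕ → M) :
    ∑ j ∈ Finset.range r, ∑ i ∈ Finset.range j, (t ^ i * s ^ j) •
      (a (i + 1) (j + 1) - t • a i (j + 1) + t • (w i (j + 1) - s • w i j))
    = t • ∑ j ∈ Finset.range r, (t ^ j * s ^ j) • (a j (j + 1) - w j (j + 1))
      - t • ∑ j ∈ Finset.range r, s ^ j • a 0 (j + 1)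
      + (t * s * s ^ r) • ∑ i ∈ Finset.range r, t ^ i • w i r := by
  induction r with
  | zero => simp
  | succ r ih =>
    have h₁ : ∑ i ∈ Finset.range r, (t ^ i * s ^ r) •
        (a (i + 1) (r + 1) - t • a i (r + 1) + t • (w i (r + 1) - s • w i r))
        = s ^ r • (t • (t ^ r • a r (r + 1) - a 0 (r + 1)))
          + (s ^ r * t) • ∑ i ∈ Finset.range r, t ^ i • w i (r + 1)
          - (s ^ r * t * s) • ∑ i ∈ Finset.range r, t ^ i • w i r := by
      rw [← sum_telescope t ht r fun i => a i (r + 1), Finset.smul_sum, Finset.smul_sum,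
        Finset.smul_sum, ← Finset.sum_add_distrib, ← Finset.sum_sub_distrib]
      refine Finset.sum_congr rfl fun i _ => ?_
      module
    simp only [Finset.sum_range_succ _ r]
    rw [ih, h₁]
    linear_combination (norm := module) -(t * s ^ r) • hs •
        (∑ i ∈ Finset.range r, t ^ i • w i (r + 1) + t ^ r • w r (r + 1))

/-- The homotopy is the double insertion `∑_{i<j} ± (c ∘ⱼ a) ∘ᵢ b`. On cocycles two applications of
`d_comp` bring its differential to the form of `sum_double_telescope`. The diagonal leaves the
coface `c ∘ⱼ μ` with both new slots filled, that is `c{a ⌣ b}`, and the two edges are the two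
products. -/
theorem brace_cup_mem_cob {r q t m m' N : ℕ} {c : O r} {a : O q} {b : O t} (hc : P.d c = 0)
    (ha : P.d a = 0) (hb : P.d b = 0) (hm : 0 < r → m + 1 = r + q) (hm' : 0 < r → m' + 1 = r + t)
    (hN : N + 1 = r + q + t) :
    P.brace N c (P.cup (q + t) a b) - P.cup N (P.brace m c a) b
      - (-1 : k) ^ (q * (r + 1)) • P.cup N a (P.brace m' c b) ∈ P.cob N := by
  rcases Nat.eq_zero_or_pos r with rfl | hr
  · simp [brace_of_zero]
  replace hm := hm hr
  replace hm' := hm' hr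
  have hs := neg_one_pow_mul_self (k := k) (q + 1)
  have ht := neg_one_pow_mul_self (k := k) (t + 1)
  set s := (-1 : k) ^ (q + 1) with hs'
  set τ := (-1 : k) ^ (t + 1) with ht'
  let Y : ℕ → ℕ → O (m + 1) := fun l j => P.partialD (m + 1) l j c a
  have key := sum_double_telescope s τ hs ht r (fun i j => P.comp N i (Y (i + 1) j) b)
    (fun i j => P.comp N i (Y (j + 1) j) b)
  have h₁ : ∑ j ∈ Finset.range r, (τ ^ j * s ^ j) • (P.comp N j (Y (j + 1) (j + 1)) b
      - P.comp N j (Y (j + 1 + 1) (j + 1)) b) = P.brace N c (P.cup (q + t) a b) := by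
    rw [brace_apply]
    refine Finset.sum_congr rfl fun j hj => ?_
    simp only [Finset.mem_range] at hj
    simp only [Y]
    rw [P.partialD_succ (m := j + 1), P.δ_mid hj, map_add, LinearMap.add_apply,
      sub_add_cancel_left, map_smul, LinearMap.smul_apply,
      ← P.seq (m := q + 1) c P.mu a hj (by omega) (by omega) (by omega) (by omega),
      ← P.seq_zero (m := q + t) c _ b hj (by omega) (by omega) (by omega) (by omega), ← cup_apply,
      ← neg_smul, smul_smul]
    congr 1
    rw [hs', ht', show ((-1 : k) ^ (t + 1)) ^ j * ((-1) ^ (q + 1)) ^ j * -(-1) ^ (j + 1)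
      = (-1) ^ (j * (q + t + 1)) * ((-1) ^ j * (-1) ^ j) by ring, neg_one_pow_mul_self, mul_one]
  have h₂ : ∑ j ∈ Finset.range r, s ^ j • P.comp N 0 (Y (0 + 1) (j + 1)) b
      = P.cup N (P.brace m c a) b := by
    rw [brace_apply, map_sum, LinearMap.sum_apply]
    refine Finset.sum_congr rfl fun j hj => ?_
    simp only [Finset.mem_range] at hj
    simp only [Y, zero_add, partialD, Finset.sum_range_one, pow_zero, one_smul, cup_apply,
      map_smul, LinearMap.smul_apply]
    rw [P.seq (l := r + 1) P.mu c a (by omega) hj hm (by omega) (by omega), δ_zero, add_comm j,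
      hs', ← pow_mul, mul_comm j]
  have h₃ : ∑ i ∈ Finset.range r, τ ^ i • P.comp N i (Y (r + 1) r) b
      = (-1 : k) ^ r • P.cup N a (P.brace m' c b) := by
    -- Because `dc = 0`, the sum of all cofaces but the last is minus the last one, and the last
    -- coface with `a` in its top slot is `a ⌣ c`.
    have h₀ : Y (r + 1) r = (-1 : k) ^ r • P.cup (m + 1) a c := by
      have h := P.partialD_succ (n := m + 1) (m := r + 1) (i := r) c a
      rw [P.partialD_top, hc, P.δ_last rfl, P.mu_comp_comm c a hm] at h
      simp only [Y]
      simp only [map_zero, LinearMap.zero_apply] at h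
      linear_combination (norm := module) -h
    rw [brace_apply, map_sum, Finset.smul_sum, h₀]
    refine Finset.sum_congr rfl fun i hi => ?_
    simp only [Finset.mem_range] at hi
    obtain hm'' : m + 1 = q + r := by omega
    rw [hm'', map_smul, map_smul, LinearMap.smul_apply,
      P.cup_comp_left (m := m') a c b hi hm' (by omega), ht', smul_comm, ← pow_mul, mul_comm i]
  have h₄ : ∀ j ∈ Finset.range r, ∀ i ∈ Finset.range j,
      (τ ^ i * s ^ j) • (P.comp N (i + 1) (Y (i + 1 + 1) (j + 1)) b
        - τ • P.comp N i (Y (i + 1) (j + 1)) b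
        + τ • (P.comp N i (Y (j + 1 + 1) (j + 1)) b - s • P.comp N i (Y (j + 1) j) b)) ∈
        P.cob N := by
    intro j hj i hi
    simp only [Finset.mem_range] at hi hj
    refine Submodule.smul_mem _ _ ?_
    obtain ⟨n, rfl⟩ : ∃ n, N = n + 1 := ⟨N - 1, by omega⟩
    have hY : ∀ l i', l ≤ j + 1 → P.partialD (n + 1) l i' (P.comp m j c a) b
        = P.comp (n + 1) i' (Y l (j + 1)) b := by
      intro l i' hl
      simp only [Y, partialD, map_sum, LinearMap.sum_apply, map_smul, LinearMap.smul_apply]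
      refine Finset.sum_congr rfl fun x hx => ?_
      rw [P.δ_comp_of_le c a hj (by simp at hx; omega) hm]
    have hd : P.d (P.comp m j c a) = Y (j + 1 + 1) (j + 1) - s • Y (j + 1) j := by
      rw [P.d_comp c a hj hm, ha, hc]
      simp only [Y, map_zero, LinearMap.zero_apply, ← hs']
      module
    have := P.d_comp (n := n) (i := i) (P.comp m j c a) b (by omega) (by omega)
    rw [hb, hY _ _ (by omega), hY _ _ (by omega), hd, ← ht'] at this
    convert P.d_mem_cob (P.comp n i (P.comp m j c a) b) using 1
    rw [this]
    simp only [map_zero, map_sub, map_smul, LinearMap.sub_apply, LinearMap.smul_apply]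
    module
  have h₅ := Submodule.sum_mem _ fun j hj => Submodule.sum_mem _ (h₄ j hj)
  rw [key, h₁, h₂, h₃] at h₅
  have h₆ := Submodule.smul_mem _ τ h₅
  convert h₆ using 1
  have hsr : s * s ^ r * (-1) ^ r = - (-1 : k) ^ (q * (r + 1)) := by
    rw [hs', show (-1 : k) ^ (q + 1) * ((-1) ^ (q + 1)) ^ r * (-1) ^ r
      = - ((-1) ^ (q * (r + 1)) * ((-1) ^ r * (-1) ^ r)) by ring, neg_one_pow_mul_self, mul_one]
  linear_combination (norm := module) -ht • (P.brace N c (P.cup (q + t) a b)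
    - P.cup N (P.brace m c a) b - (-1 : k) ^ (q * (r + 1)) • P.cup N a (P.brace m' c b))
    - (τ * τ) • hsr • P.cup N a (P.brace m' c b)

/-- The Gerstenhaber bracket. -/
def gbracket {p q : ℕ} (n : ℕ) : O p →ₗ[k] O q →ₗ[k] O n :=
  P.brace n - (-1 : k) ^ ((p + 1) * (q + 1)) • (P.brace n).flip

theorem gbracket_apply {p q n : ℕ} (x : O p) (y : O q) :
    P.gbracket n x y = P.brace n x y - (-1 : k) ^ ((p + 1) * (q + 1)) • P.brace n y x := by
  simp [gbracket]

theorem gbracket_skew {p q n : ℕ} (x : O p) (y : O q) :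
    P.gbracket n x y = -((-1 : k) ^ ((p + 1) * (q + 1)) • P.gbracket n y x) := by
  rw [gbracket_apply, gbracket_apply, mul_comm (q + 1)]
  have := neg_one_pow_mul_self (k := k) ((p + 1) * (q + 1))
  linear_combination (norm := module) -this • P.brace n x y

/-- The bracket with a fixed element is a derivation of the cup product, up to coboundaries. -/
theorem gbracket_cup_mem_cob {r q t m m' N : ℕ} {c : O r} {a : O q} {b : O t} (hc : P.d c = 0)
    (ha : P.d a = 0) (hb : P.d b = 0) (hm : 0 < r + q → m + 1 = r + q)
    (hm' : 0 < r + t → m' + 1 = r + t) (hN : N + 1 = r + q + t)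
    {x : O m} (hx : 0 < r + q → x = P.gbracket m c a) (hx' : r + q = 0 → x = 0)
    {y : O m'} (hy : 0 < r + t → y = P.gbracket m' c b) (hy' : r + t = 0 → y = 0) :
    P.gbracket N c (P.cup (q + t) a b) - P.cup N x b
      - (-1 : k) ^ ((r + 1) * q) • P.cup N a y ∈ P.cob N := by
  have h₁ := P.brace_cup_mem_cob hc ha hb (m := m) (m' := m') (fun h => hm (by omega))
    (fun h => hm' (by omega)) hN
  have h₂ := P.cup_brace (m := m) (m' := m') a b c (fun h => by have := hm (by omega); omega)
    (fun h => by have := hm' (by omega); omega) (show N + 1 = q + t + r by omega)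
  -- For `r = q = 0` the bracket would have degree `-1` and `x` stands for zero; the formula
  -- persists because an element of arity zero has no slots and both braces vanish.
  have hx₁ : x = P.brace m c a - (-1 : k) ^ ((r + 1) * (q + 1)) • P.brace m a c := by
    rcases Nat.eq_zero_or_pos (r + q) with h | h
    · obtain ⟨rfl, rfl⟩ : r = 0 ∧ q = 0 := by omega
      rw [hx' h]; simp [brace_of_zero]
    · rw [hx h, gbracket_apply]
  have hy₁ : y = P.brace m' c b - (-1 : k) ^ ((r + 1) * (t + 1)) • P.brace m' b c := by
    rcases Nat.eq_zero_or_pos (r + t) with h | h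
    · obtain ⟨rfl, rfl⟩ : r = 0 ∧ t = 0 := by omega
      rw [hy' h]; simp [brace_of_zero]
    · rw [hy h, gbracket_apply]
  convert h₁ using 1
  rw [gbracket_apply, h₂, hx₁, hy₁]
  simp only [map_sub, map_smul, LinearMap.sub_apply, LinearMap.smul_apply]
  have e₁ : (-1 : k) ^ ((r + 1) * (q + t + 1)) * (-1) ^ (t * (r + 1))
      = (-1) ^ ((r + 1) * (q + 1)) := by
    rw [show (-1 : k) ^ ((r + 1) * (q + t + 1)) * (-1) ^ (t * (r + 1))
      = (-1) ^ ((r + 1) * (q + 1)) * ((-1) ^ (t * (r + 1)) * (-1) ^ (t * (r + 1))) by ring,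
      neg_one_pow_mul_self, mul_one]
  linear_combination (norm := (simp only [smul_sub, smul_add, smul_smul]; ring_nf; abel))
    -e₁ • P.cup N (P.brace m a c) b

theorem d_brace_cocycle {r p n : ℕ} {x : O r} {a : O p} (hx : P.d x = 0) (ha : P.d a = 0)
    (hn : n + 1 = r + p) :
    P.d (P.brace n x a) = (-1 : k) ^ p • P.cup (n + 1) x a
      - (-1 : k) ^ (p * (r + 1)) • P.cup (n + 1) a x := by
  rw [P.d_brace x a hn, ha, hx]
  simp only [map_zero, LinearMap.zero_apply]
  rw [pow_succ]
  module

/-- The brace `x{y}` is the homotopy: on cocycles its differential consists of the two products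
only. In total degree zero no brace is available, but there everything is a multiple of `e`. -/
theorem cup_comm_mem_cob {p q n : ℕ} {x : O p} {y : O q} (hx : P.d x = 0) (hy : P.d y = 0)
    (hn : n = p + q) :
    P.cup n x y - (-1 : k) ^ (p * q) • P.cup n y x ∈ P.cob n := by
  rcases n with _ | n
  · obtain ⟨rfl, rfl⟩ : p = 0 ∧ q = 0 := by omega
    obtain ⟨r, rfl⟩ := P.exists_smul_e x
    simp [cup_e, e_cup]
  have h := P.d_mem_cob (P.brace n x y)
  rw [P.d_brace_cocycle hx hy hn] at h
  convert Submodule.smul_mem _ ((-1 : k) ^ q) h using 1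
  have e₁ := neg_one_pow_mul_self (k := k) q
  have e₂ : (-1 : k) ^ q * (-1) ^ (q * (p + 1)) = (-1) ^ (p * q) := by
    rw [show (-1 : k) ^ q * (-1) ^ (q * (p + 1)) = (-1) ^ q * (-1) ^ q * (-1) ^ (p * q) by ring,
      e₁, one_mul]
  linear_combination (norm := module) -e₁ • P.cup (n + 1) x y + e₂ • P.cup (n + 1) y x

theorem d_gbracket {p q n : ℕ} {x : O p} {y : O q} (hx : P.d x = 0) (hy : P.d y = 0)
    (hn : n + 1 = p + q) : P.d (P.gbracket n x y) = 0 := by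
  rw [gbracket_apply, map_sub, map_smul, P.d_brace_cocycle hx hy hn,
    P.d_brace_cocycle hy hx (by omega)]
  have e₁ : (-1 : k) ^ ((p + 1) * (q + 1)) * (-1) ^ p = - (-1) ^ (q * (p + 1)) := by
    rw [show (-1 : k) ^ ((p + 1) * (q + 1)) * (-1) ^ p
      = - ((-1) ^ (q * (p + 1)) * ((-1) ^ p * (-1) ^ p)) by ring, neg_one_pow_mul_self, mul_one]
  have e₂ : (-1 : k) ^ ((p + 1) * (q + 1)) * (-1) ^ (p * (q + 1)) = - (-1) ^ q := by
    rw [show (-1 : k) ^ ((p + 1) * (q + 1)) * (-1) ^ (p * (q + 1))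
      = - ((-1) ^ q * ((-1) ^ (p * (q + 1)) * (-1) ^ (p * (q + 1)))) by ring,
      neg_one_pow_mul_self, mul_one]
  linear_combination (norm := module) -e₁ • P.cup (n + 1) y x + e₂ • P.cup (n + 1) x y

/-- With `dx = 0`, the differentials of `x{y}` and `y{x}` contain the two braces making up the
bracket, besides the products `x ⌣ y` and `y ⌣ x`. In the right signed combination these products
cancel. -/
theorem gbracket_d_mem_cob {p q n : ℕ} {x : O p} (y : O q) (hx : P.d x = 0)
    (hn : n = p + q) : P.gbracket n x (P.d y) ∈ P.cob n := by
  rcases n with _ | n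
  · obtain ⟨rfl, rfl⟩ : p = 0 ∧ q = 0 := by omega
    simp [P.d_of_zero]
  have h₁ := P.d_brace x y hn
  have h₂ := P.d_brace y x (n := n) (by omega)
  rw [hx] at h₁ h₂
  simp only [map_zero, LinearMap.zero_apply] at h₁ h₂
  have h := Submodule.add_mem _ (P.d_mem_cob (P.brace n x y))
    (Submodule.smul_mem _ ((-1 : k) ^ (p * q + p + q)) (P.d_mem_cob (P.brace n y x)))
  convert h using 1
  rw [h₁, h₂, gbracket_apply]
  have e₁ : (-1 : k) ^ (p * q + p + q) * (-1) ^ (p + 1) = - (-1) ^ (q * (p + 1)) := by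
    rw [show (-1 : k) ^ (p * q + p + q) * (-1) ^ (p + 1)
      = - ((-1) ^ (q * (p + 1)) * ((-1) ^ p * (-1) ^ p)) by ring, neg_one_pow_mul_self, mul_one]
  have e₂ : (-1 : k) ^ (p * q + p + q) * (-1) ^ (p * (q + 1)) = (-1) ^ q := by
    rw [show (-1 : k) ^ (p * q + p + q) * (-1) ^ (p * (q + 1))
      = (-1) ^ q * ((-1) ^ (p * (q + 1)) * (-1) ^ (p * (q + 1))) by ring, neg_one_pow_mul_self,
      mul_one]
  have e₃ : (-1 : k) ^ ((p + 1) * (q + 1 + 1)) = (-1) ^ (q * (p + 1)) := by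
    rw [show (-1 : k) ^ ((p + 1) * (q + 1 + 1))
      = (-1) ^ (q * (p + 1)) * ((-1) ^ (p + 1) * (-1) ^ (p + 1)) by ring, neg_one_pow_mul_self,
      mul_one]
  rw [e₃]
  linear_combination (norm := module) -e₁ • P.brace (n + 1) (P.d y) x + e₁ • P.cup (n + 1) y x
    + e₂ • P.cup (n + 1) x y

end CyclicOperad

/-! ### Rotation of cofaces and codegeneracies -/

namespace CyclicOperad

variable {k : Type*} [CommRing k] {O : ℕ → Type*} [∀ n, AddCommGroup (O n)] [∀ n, Module k (O n)]
  (P : CyclicOperad k O)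

/-- The cyclic operator with sign. -/
def lam {n : ℕ} : Module.End k (O n) := (-1 : k) ^ n • P.tau n

theorem lam_apply {n : ℕ} (f : O n) : P.lam f = (-1 : k) ^ n • P.tau n f := rfl

theorem tau_eq {n : ℕ} (f : O n) : P.tau n f = (-1 : k) ^ n • P.lam f := by
  rw [lam_apply, smul_smul, neg_one_pow_mul_self, one_smul]

theorem lam_pow_apply {n : ℕ} (j : ℕ) (f : O n) :
    (P.lam ^ j) f = (-1 : k) ^ (n * j) • (P.tau n)^[j] f := by
  induction j with
  | zero => simp
  | succ j ih =>
    rw [pow_succ', Module.End.mul_apply, ih, lam_apply, map_smul, smul_smul,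
      Function.iterate_succ_apply', ← pow_add]
    congr 2
    ring

theorem lam_succ_apply {n : ℕ} (j : ℕ) (f : O n) : (P.lam ^ (j + 1)) f = P.lam ((P.lam ^ j) f) := by
  rw [pow_succ', Module.End.mul_apply]

theorem lam_pow_succ_self {n : ℕ} (f : O n) : (P.lam ^ (n + 1)) f = f := by
  rw [lam_pow_apply, tau_pow, (Nat.even_mul_succ_self n).neg_one_pow, one_smul]

/-- Each rotation lowers the occupied slot by one; the bound on `c + i` guarantees that the inserted
element never reaches the root. -/
theorem lam_pow_comp {p q N : ℕ} (w : O p) (g : O q) (i c : ℕ) (hc : c + i < p)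
    (hN : N + 1 = p + q) :
    (P.lam ^ i) (P.comp N (c + i) w g)
      = (-1 : k) ^ ((q + 1) * i) • P.comp N c ((P.lam ^ i) w) g := by
  induction i generalizing c with
  | zero => simp
  | succ i ih =>
    rw [lam_succ_apply, show c + (i + 1) = (c + 1) + i by omega, ih _ (by omega), map_smul,
      lam_apply, P.tau_comp_succ _ _ (by omega) hN, tau_eq, lam_succ_apply, map_smul,
      LinearMap.smul_apply, smul_smul, smul_smul]
    congr 1
    -- The accumulated exponent `N + p` equals `2p + q - 1`, which has the parity of `q + 1`; the
    -- truncated subtraction is harmless because `p > 0`.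
    rw [show (-1 : k) ^ ((q + 1) * (i + 1)) = (-1) ^ ((q + 1) * i) * (-1) ^ (q + 1) by ring,
      mul_assoc, ← pow_add, show N + p = p + p + q - 1 by omega]
    congr 1
    rw [show q + 1 = (p + p + q - 1) + 2 - (p + p) by omega]
    rcases Nat.eq_zero_or_pos p with rfl | hp
    · omega
    · rw [show p + p + q - 1 + 2 - (p + p) = q + 1 by omega,
        show p + p + q - 1 = (p - 1) + (p - 1) + (q + 1) by omega, pow_add _ _ (q + 1), pow_add,
        neg_one_pow_mul_self, one_mul]

/-- The last coface composes `μ` with `f` in slot `0`, and the rotation rule for that slot needs `f`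
to have positive arity; hence `0 < n`. -/
theorem tau_δ_succ {n j : ℕ} (hj : j ≤ n) (hn : 0 < n) (f : O n) :
    P.tau (n + 1) (P.δ (j + 1) f) = P.δ j (P.tau n f) := by
  rcases eq_or_lt_of_le hj with rfl | hlt
  · obtain ⟨m, rfl⟩ : ∃ m, j = m + 1 := ⟨j - 1, by omega⟩
    rw [P.δ_last rfl, P.δ_mid (by omega),
      P.tau_comp_zero (j := m) _ _ (by omega) (by omega) (by omega), tau_mu]
  · rw [P.δ_mid hlt]
    rcases j with _ | j
    · rw [P.tau_comp_zero (j := 1) _ _ (by omega) (by omega) (by omega), tau_mu, δ_zero]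
    · rw [P.tau_comp_succ _ _ hlt (by omega), P.δ_mid (by omega)]

theorem tau_δ_zero {n : ℕ} (f : O n) : P.tau (n + 1) (P.δ 0 f) = P.δ (n + 1) f := by
  rw [P.δ_last rfl, δ_zero, P.tau_comp_succ (i := 0) _ _ (by omega) (by omega), tau_mu]

/-- The sum of the first `m` terms of the differential. -/
def dlt {n : ℕ} (m : ℕ) : O n →ₗ[k] O (n + 1) := ∑ j ∈ Finset.range m, (-1 : k) ^ j • P.δ j

theorem dlt_apply {n m : ℕ} (f : O n) :
    P.dlt m f = ∑ j ∈ Finset.range m, (-1 : k) ^ j • P.δ j f := by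
  simp [dlt]

theorem dlt_top {n : ℕ} : P.dlt (n + 2) = (P.d : O n →ₗ[k] O (n + 1)) := rfl

theorem dlt_zero {n : ℕ} : (P.dlt 0 : O n →ₗ[k] O (n + 1)) = 0 := rfl

theorem dlt_succ {n m : ℕ} (f : O n) : P.dlt (m + 1) f = P.dlt m f + (-1 : k) ^ m • P.δ m f := by
  simp [dlt_apply, Finset.sum_range_succ]

theorem dlt_add {n m l : ℕ} (f : O n) :
    P.dlt (m + l) f
      = P.dlt m f + ∑ j ∈ Finset.range l, (-1 : k) ^ (m + j) • P.δ (m + j) f := by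
  simp [dlt_apply, Finset.sum_range_add]

theorem partialD_eq {r p n m i : ℕ} (x : O r) (a : O p) :
    P.partialD n m i x a = P.comp n i (P.dlt m x) a := by
  simp [partialD, dlt_apply]

/-- With the sign included in `λ`, rotation carries the signed coface `j + 1` to the signed coface
`j`, while `δ₀` becomes the top term of the differential. -/
theorem lam_dlt_succ {n m : ℕ} (hn : 0 < n) (hm : m ≤ n + 1) (f : O n) :
    P.lam (P.dlt (m + 1) f) = P.dlt m (P.lam f) + (-1 : k) ^ (n + 1) • P.δ (n + 1) f := by
  rw [dlt_apply, Finset.sum_range_succ', dlt_apply]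
  simp only [map_add, map_sum, map_smul, pow_zero, one_smul]
  congr 1
  · refine Finset.sum_congr rfl fun j hj => ?_
    rw [lam_apply, P.tau_δ_succ (by simp at hj; omega) hn, lam_apply, map_smul]
    simp only [smul_smul]
    congr 1
    ring
  · rw [lam_apply, tau_δ_zero]

/-- After `j + 1` rotations the cofaces of index below `m` are those of `λ^{j+1} f`. The remaining
ones come from cofaces that have passed through the root, and are those of `λ^j f`. -/
theorem lam_pow_d {n j m : ℕ} (hn : 0 < n) (hj : m + j = n + 1) (f : O n) :
    (P.lam ^ (j + 1)) (P.d f)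
      = P.d ((P.lam ^ j) f) + P.dlt m ((P.lam ^ (j + 1)) f - (P.lam ^ j) f) := by
  induction j generalizing m with
  | zero =>
    obtain rfl : m = n + 1 := by omega
    simp only [zero_add, pow_one, pow_zero, Module.End.one_apply]
    rw [← dlt_top, P.lam_dlt_succ hn le_rfl, map_sub, P.dlt_succ (m := n + 1) f]
    module
  | succ j ih =>
    rw [lam_succ_apply, ih (m := m + 1) (by omega), map_add, P.lam_dlt_succ hn (by omega),
      ← dlt_top, P.lam_dlt_succ hn le_rfl, P.dlt_succ (m := n + 1), ← lam_succ_apply,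
      map_sub P.lam, ← lam_succ_apply, ← lam_succ_apply, map_sub (P.δ (n + 1))]
    module

theorem δ_comp_e {n c : ℕ} (hc : c ≤ n) (x : O n) : P.comp n c (P.δ c x) P.e = x := by
  rcases c with _ | c
  · rw [δ_zero, ← cup_apply, cup_e]
  · rw [P.δ_mid hc, ← P.seq (m := 1) _ _ _ hc (by omega) (by omega) (by omega) (by omega),
      P.mu_one_e, P.comp_one _ hc]

theorem δ_succ_comp_e {n c : ℕ} (hc : c ≤ n) (x : O n) : P.comp n c (P.δ (c + 1) x) P.e = x := by
  rcases eq_or_lt_of_le hc with rfl | hlt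
  · rw [P.δ_last rfl]
    exact (P.mu_comp_comm x P.e rfl).trans (P.e_cup x)
  · rw [P.δ_mid hlt, ← P.seq_zero (m := 1) _ _ _ hlt (by omega) (by omega) (by omega) (by omega),
      P.mu_zero_e, P.comp_one _ hlt]

theorem dlt_comp_e {n c m : ℕ} (hm : m ≤ c + 1) (hc : c ≤ n) (x : O (n + 1)) :
    P.comp (n + 1) (c + 1) (P.dlt m x) P.e = P.dlt m (P.comp n c x P.e) := by
  rw [dlt_apply, dlt_apply, map_sum, LinearMap.sum_apply]
  refine Finset.sum_congr rfl fun j hj => ?_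
  simp only [Finset.mem_range] at hj
  rw [map_smul, LinearMap.smul_apply,
    P.δ_comp_of_le x P.e (i := c) (by omega) (by omega) (by omega)]

theorem dlt_succ_comp_e {n c : ℕ} (hc : c ≤ n) (x : O n) :
    P.comp n c (P.dlt (c + 1) x) P.e = P.comp n c (P.dlt c x) P.e + (-1 : k) ^ c • x := by
  rw [dlt_succ, map_add, LinearMap.add_apply, map_smul, LinearMap.smul_apply, P.δ_comp_e hc]

/-- The cofaces `c` and `c + 1` are both undone by the unit in slot `c`, and they cancel. Those
above are shifted down by one index, which produces the minus sign. -/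
theorem d_comp_e {n c : ℕ} (hc : c ≤ n + 1) (x : O (n + 1)) :
    P.comp (n + 1) c (P.d x) P.e = P.comp (n + 1) c (P.dlt c x) P.e
      - (P.d (P.comp n c x P.e) - P.dlt (c + 1) (P.comp n c x P.e)) := by
  obtain ⟨t, rfl⟩ | rfl : (∃ t, n = c + t) ∨ c = n + 1 := by
    rcases eq_or_lt_of_le hc with h | h
    · exact Or.inr h
    · exact Or.inl ⟨n - c, by omega⟩
  · rw [show P.d x = P.dlt (c + 1 + 1 + (t + 1)) x by rw [← dlt_top]; congr 2; omega,
      show P.d (P.comp (c + t) c x P.e) = P.dlt (c + 1 + (t + 1)) (P.comp (c + t) c x P.e) by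
        rw [← dlt_top]; congr 2; omega, P.dlt_add (m := c + 1 + 1) (l := t + 1),
      P.dlt_add (m := c + 1) (l := t + 1) (P.comp (c + t) c x P.e),
      P.dlt_succ (m := c + 1), map_add, map_add, LinearMap.add_apply, LinearMap.add_apply,
      P.dlt_succ_comp_e hc, map_smul, LinearMap.smul_apply, P.δ_succ_comp_e hc, map_sum,
      LinearMap.sum_apply, Finset.sum_congr rfl fun l hl => by
        rw [map_smul, LinearMap.smul_apply,
          ← P.δ_comp_of_ge (j := c + 2 + l) (j' := c + 1 + l) (n := c + t) x P.e (by omega)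
            (by omega) (by simp at hl; omega) (by omega) (by omega),
          show (-1 : k) ^ (c + 1 + 1 + l) = - (-1) ^ (c + 1 + l) by ring, neg_smul],
      Finset.sum_neg_distrib]
    module
  -- For `c = n + 1` the composite of `x` with `e` is out of range, but it enters only through `d -
  -- dlt (n + 2)`, which is zero.
  · rw [P.dlt_top (n := n), sub_self, sub_zero, ← dlt_top, P.dlt_succ (m := n + 2),
      map_add, LinearMap.add_apply, P.dlt_succ_comp_e le_rfl, map_smul, LinearMap.smul_apply,
      P.δ_succ_comp_e le_rfl]
    module

end CyclicOperad

/-! ### Connes' operator and the Batalin–Vilkovisky identity -/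

namespace CyclicOperad

variable {k : Type*} [CommRing k] {O : ℕ → Type*} [∀ n, AddCommGroup (O n)] [∀ n, Module k (O n)]
  (P : CyclicOperad k O)

/-- The element `f`, rotated `j` times, with the unit inserted at the original root. -/
def rootIns {n : ℕ} (j : ℕ) (f : O (n + 1)) : O n := P.comp n (n + 1 - j) ((P.lam ^ j) f) P.e

/-- The operator `∑ⱼ (-1)ʲ⁺¹ (λʲ⁺¹f) ∘ₙ₋ⱼ e`; it is `(-1)ⁿ N σ`. -/
def normB {n : ℕ} : O (n + 1) →ₗ[k] O n :=
  ∑ i ∈ Finset.range (n + 1), (-1 : k) ^ (i + 1) •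
    ((P.comp n (n - i)).flip P.e ∘ₗ (P.lam ^ (i + 1)))

theorem normB_apply {n : ℕ} (f : O (n + 1)) :
    P.normB f = ∑ i ∈ Finset.range (n + 1), (-1 : k) ^ (i + 1) • P.rootIns (i + 1) f := by
  simp [normB, rootIns]

/-- A reindexing of the `Y`-part. In the applications the two vanishing ends contain the
out-of-range insertions `rootIns (n + 2)` and `rootIns 0`, each acted on by an empty sum of cofaces.
-/
theorem sum_shift {M : Type*} [AddCommGroup M] [Module k M] (N : ℕ) (X Y : ℕ → M) (hX : X N = 0)
    (hY : Y 0 = 0) : ∑ i ∈ Finset.range (N + 1), (-1 : k) ^ (i + 1) • (X i - Y i)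
      = ∑ i ∈ Finset.range N, (-1 : k) ^ (i + 1) • (X i + Y (i + 1)) := by
  simp only [smul_sub, smul_add, Finset.sum_sub_distrib, Finset.sum_add_distrib]
  rw [Finset.sum_range_succ, hX, Finset.sum_range_succ' (fun i => (-1 : k) ^ (i + 1) • Y i), hY,
    smul_zero, smul_zero, add_zero, add_zero, sub_eq_add_neg, ← Finset.sum_neg_distrib]
  congr 1
  refine Finset.sum_congr rfl fun i _ => ?_
  rw [← neg_smul]
  congr 1
  ring

/-- By `lam_pow_d` and `d_comp_e`, the cofaces below the slot of the unit belong to one more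
rotation than those above it. The coface at the slot itself is undone by `e` and leaves the
difference of two consecutive rotations. -/
theorem rootIns_d {n j : ℕ} (f : O (n + 1)) (hj : j ≤ n + 1) :
    P.rootIns (j + 1) (P.d f) = P.dlt (n + 1 - j) (P.rootIns (j + 1) f)
      - (P.d (P.rootIns j f) - P.dlt (n + 2 - j) (P.rootIns j f))
      + (-1 : k) ^ (n + 1 - j) • ((P.lam ^ (j + 1)) f - (P.lam ^ j) f) := by
  obtain ⟨c, hc⟩ : ∃ c, n + 1 - j = c := ⟨_, rfl⟩
  have e₁ : P.comp (n + 1) c (P.dlt c ((P.lam ^ (j + 1)) f)) P.e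
      = P.dlt c (P.rootIns (j + 1) f) := by
    rcases c with _ | c
    · simp [dlt_zero]
    · rw [P.dlt_comp_e le_rfl (by omega), rootIns, show n + 1 - (j + 1) = c by omega]
  have e₂ : P.rootIns j f = P.comp n c ((P.lam ^ j) f) P.e := by rw [rootIns, hc]
  rw [e₂, rootIns, P.lam_pow_d (m := c + 1) (by omega) (by omega),
    show n + 1 + 1 - (j + 1) = c by omega, map_add, LinearMap.add_apply, P.d_comp_e (by omega),
    P.dlt_succ_comp_e (by omega), map_sub, map_sub, LinearMap.sub_apply, e₁, hc,
    show n + 2 - j = c + 1 by omega]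
  module

/-- The differences of consecutive rotations in `rootIns_d` all receive the same sign, and over a
full turn they sum to zero. The commutation is therefore exact and needs no normalisation. -/
theorem d_normB {n : ℕ} (f : O (n + 1)) : P.normB (P.d f) = P.d (P.normB f) := by
  have key := sum_shift (k := k) (n + 1) (fun j => P.dlt (n + 1 - j) (P.rootIns (j + 1) f))
    (fun j => P.d (P.rootIns j f) - P.dlt (n + 2 - j) (P.rootIns j f))
    (by simp [dlt_zero]) (by simp [dlt_top])
  have tele : ∑ i ∈ Finset.range (n + 1 + 1), (-1 : k) ^ (i + 1) • ((-1 : k) ^ (n + 1 - i) •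
      ((P.lam ^ (i + 1)) f - (P.lam ^ i) f)) = 0 := by
    rw [Finset.sum_congr rfl fun i hi => by
      simp only [Finset.mem_range] at hi
      rw [smul_smul, ← pow_add, show i + 1 + (n + 1 - i) = n + 2 by omega], ← Finset.smul_sum,
      Finset.sum_range_sub (fun i => (P.lam ^ i) f), P.lam_pow_succ_self]
    simp
  rw [normB_apply, normB_apply, map_sum, Finset.sum_congr rfl fun i hi => by
    rw [P.rootIns_d f (by simp at hi; omega), smul_add], Finset.sum_add_distrib, tele, add_zero,
    key]
  refine Finset.sum_congr rfl fun i _ => ?_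
  rw [map_smul, show n + 2 - (i + 1) = n + 1 - i by omega]
  congr 1
  abel

/-- The rotated brace: `∑ₐ ± (λᵖ⁻ᵃ f) ∘ₐ g`. -/
def rotBrace {p q : ℕ} (n : ℕ) (f : O p) (g : O q) : O n :=
  ∑ a ∈ Finset.range p, (-1 : k) ^ (a * (q + 1)) • P.comp n a ((P.lam ^ (p - a)) f) g

theorem sum_triangle_sub {M : Type*} [AddCommGroup M] (N : ℕ) (G : ℕ → ℕ → M) :
    ∑ i ∈ Finset.range N, ∑ a ∈ Finset.range (N - i), (G a (i + 1) - G a i)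
      = ∑ a ∈ Finset.range N, (G a (N - a) - G a 0) := by
  rw [Finset.sum_comm' (t' := Finset.range N) (s' := fun a => Finset.range (N - a))
    (by intro x y; simp only [Finset.mem_range]; omega)]
  refine Finset.sum_congr rfl fun a _ => ?_
  rw [Finset.sum_range_sub (G a)]

/-- The homotopy is a signed sum of `(rootIns (i + 1) f) ∘ₐ g` over the triangle `a < n - i`. For
fixed `i`, telescoping `d_comp` in `a` yields `X i + Y (i + 1)` together with the boundary term
`rootIns (i + 1) f ⌣ g`. For fixed `a`, `rootIns_d` with `df = 0` telescopes in `i` from `f` to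
`λ^{n+1-a} f`, which is the passage from the brace to the rotated brace. -/
theorem brace_sub_rotBrace_mem_cob {n q N : ℕ} {f : O (n + 1)} {g : O q} (hf : P.d f = 0)
    (hg : P.d g = 0) (hN : N = n + q) :
    P.cup N (P.normB f) g
      + (-1 : k) ^ (n + 1) • (P.brace N f g - P.rotBrace N f g) ∈ P.cob N := by
  have hs := neg_one_pow_mul_self (k := k) (q + 1)
  set s := (-1 : k) ^ (q + 1) with hs'
  let X : ℕ → O N := fun i => ∑ a ∈ Finset.range (n + 1 - i),
    s ^ a • P.comp N a (P.dlt (n + 1 - i) (P.rootIns (i + 1) f)) g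
  let Y : ℕ → O N := fun i => ∑ a ∈ Finset.range (n + 1 - i),
    s ^ a • P.comp N a (P.d (P.rootIns i f) - P.dlt (n + 2 - i) (P.rootIns i f)) g
  have key := sum_shift (k := k) (n + 1) X Y (by simp [X]) (by simp [Y, dlt_top])
  have hterm : ∀ i ∈ Finset.range (n + 1), X i + Y (i + 1) - P.cup N (P.rootIns (i + 1) f) g
      ∈ P.cob N := by
    intro i hi
    simp only [Finset.mem_range] at hi
    set h := P.rootIns (i + 1) f with hh
    have tele := sum_telescope s hs (n - i) fun a => P.comp N a (P.dlt (a + 1) h) g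
    have h₁ : ∀ a ∈ Finset.range (n - i), s ^ a • (P.comp N (a + 1) (P.dlt (a + 1 + 1) h) g
        - s • P.comp N a (P.dlt (a + 1) h) g) + s • (s ^ a • P.comp N a (P.d h) g) ∈ P.cob N := by
      intro a ha
      simp only [Finset.mem_range] at ha
      obtain ⟨m, rfl⟩ : ∃ m, N = m + 1 := ⟨N - 1, by omega⟩
      convert Submodule.smul_mem _ (s ^ a) (P.d_mem_cob (P.comp m a h g)) using 1
      rw [P.d_comp h g (by omega) (by omega), hg, partialD_eq, partialD_eq, map_zero, ← hs']
      module
    have h₂ := Submodule.sum_mem _ h₁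
    rw [Finset.sum_add_distrib, tele, ← Finset.smul_sum] at h₂
    convert Submodule.smul_mem _ s h₂ using 1
    simp only [X, Y, ← hh]
    rw [show n + 1 - i = n - i + 1 by omega, Finset.sum_range_succ,
      show n + 1 - (i + 1) = n - i by omega, show n + 2 - (i + 1) = n - i + 1 by omega]
    have h₃ : P.comp N 0 (P.dlt (0 + 1) h) g = P.cup N h g := by
      simp [dlt_apply, cup_apply, δ_zero]
    have h₄ : ∑ a ∈ Finset.range (n - i), s ^ a • P.comp N a (P.d h) g
        = ∑ a ∈ Finset.range (n - i), s ^ a • P.comp N a (P.dlt (n - i + 1) h) g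
          + ∑ a ∈ Finset.range (n - i), s ^ a • P.comp N a (P.d h - P.dlt (n - i + 1) h) g := by
      rw [← Finset.sum_add_distrib]
      refine Finset.sum_congr rfl fun a _ => ?_
      rw [← smul_add, ← LinearMap.add_apply, ← map_add, add_sub_cancel]
    rw [h₃, h₄]
    linear_combination (norm := module) -hs • (s ^ (n - i) • P.comp N (n - i) (P.dlt (n - i + 1) h) g
      - P.cup N h g + ∑ a ∈ Finset.range (n - i), s ^ a • P.comp N a (P.dlt (n - i + 1) h) g
      + ∑ a ∈ Finset.range (n - i), s ^ a • P.comp N a (P.d h - P.dlt (n - i + 1) h) g)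
  have hXY : ∑ i ∈ Finset.range (n + 1 + 1), (-1 : k) ^ (i + 1) • (X i - Y i)
      = (-1 : k) ^ (n + 1) • (P.rotBrace N f g - P.brace N f g) := by
    have h₁ : ∀ i ∈ Finset.range (n + 1), (-1 : k) ^ (i + 1) • (X i - Y i)
        = (-1 : k) ^ (n + 1) • ∑ a ∈ Finset.range (n + 1 - i),
          (s ^ a • P.comp N a ((P.lam ^ (i + 1)) f) g - s ^ a • P.comp N a ((P.lam ^ i) f) g) := by
      intro i hi
      simp only [Finset.mem_range] at hi
      simp only [X, Y]
      rw [← Finset.sum_sub_distrib, Finset.smul_sum, Finset.smul_sum]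
      refine Finset.sum_congr rfl fun a _ => ?_
      have h := P.rootIns_d (j := i) f (by omega)
      rw [hf] at h
      have h' : P.dlt (n + 1 - i) (P.rootIns (i + 1) f)
          - (P.d (P.rootIns i f) - P.dlt (n + 2 - i) (P.rootIns i f))
          = -((-1 : k) ^ (n + 1 - i) • ((P.lam ^ (i + 1)) f - (P.lam ^ i) f)) := by
        rw [eq_neg_iff_add_eq_zero, ← h, rootIns]
        simp
      rw [← smul_sub, ← LinearMap.sub_apply, ← map_sub, h']
      simp only [map_neg, map_smul, map_sub, LinearMap.neg_apply, LinearMap.smul_apply,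
        LinearMap.sub_apply]
      have e : (-1 : k) ^ (i + 1) * (-1) ^ (n + 1 - i) = - (-1) ^ (n + 1) := by
        rw [← pow_add, show i + 1 + (n + 1 - i) = n + 1 + 1 by omega, pow_succ]
        ring
      linear_combination (norm := module) (-s ^ a) • e • (P.comp N a ((P.lam ^ (i + 1)) f) g
        - P.comp N a ((P.lam ^ i) f) g)
    have hlast : X (n + 1) - Y (n + 1) = 0 := by simp [X, Y]
    rw [Finset.sum_range_succ, hlast, smul_zero, add_zero, Finset.sum_congr rfl h₁,
      ← Finset.smul_sum, sum_triangle_sub (n + 1) fun a i => s ^ a • P.comp N a ((P.lam ^ i) f) g,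
      Finset.sum_sub_distrib, brace_apply, rotBrace]
    simp only [pow_zero, Module.End.one_apply, hs', ← pow_mul, mul_comm (q + 1)]
  have h₁ := Submodule.sum_mem _ fun i hi =>
    Submodule.smul_mem _ ((-1 : k) ^ (i + 1)) (hterm i hi)
  have h₂ : P.cup N (P.normB f) g
      = ∑ i ∈ Finset.range (n + 1), (-1 : k) ^ (i + 1) • P.cup N (P.rootIns (i + 1) f) g := by
    simp only [normB_apply, map_sum, map_smul, LinearMap.sum_apply, LinearMap.smul_apply]
  rw [Finset.sum_congr rfl fun i _ => smul_sub ((-1 : k) ^ (i + 1)) (X i + Y (i + 1)) _,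
    Finset.sum_sub_distrib, ← key, hXY, ← h₂] at h₁
  convert Submodule.neg_mem _ h₁ using 1
  module

theorem neg_one_pow_congr {a b : ℕ} (c : ℕ) (h : a + b = 2 * c) : (-1 : k) ^ a = (-1) ^ b := by
  have h₁ : (-1 : k) ^ a * (-1) ^ b = 1 := by rw [← pow_add, h, pow_mul]; simp
  linear_combination (-1 : k) ^ b * h₁ - (-1) ^ a * neg_one_pow_mul_self (k := k) b

/-- Rotating `f ⌣ g` once and closing the old root with `e` leaves `τ g ∘_q f`. The powers `λ⁰, …,
λ^q` move the inserted `f` down through the slots of the rotating `g` and give the rotated brace of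
`g` with `f`. At the next step `f` reaches the root, the roles are exchanged, and the remaining `p +
1` powers give the rotated brace of `f` with `g`. -/
theorem normB_cup {p q N : ℕ} (f : O (p + 1)) (g : O (q + 1)) (hN : N = p + q + 1) :
    P.normB (P.cup (N + 1) f g) = (-1 : k) ^ (p + 1) • P.rotBrace N f g
      + (-1 : k) ^ (p * (q + 1)) • P.rotBrace N g f := by
  have h₁ : P.comp N N (P.tau (N + 1) (P.cup (N + 1) f g)) P.e = P.comp N q (P.tau _ g) f := by
    rw [cup_apply, P.tau_comp_zero (j := q) _ _ (by omega) rfl (by omega),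
      P.tau_comp_succ (i := 0) _ _ (by omega) (by omega), tau_mu]
    have := P.seq (m := p + 1) (l := N + 1) (n := N) (j := p + 1) (P.tau (q + 1) g)
      (P.comp (p + 1 + 1) 0 P.mu f) P.e (i := q) (by omega) (by omega) (by omega) (by omega)
      (by omega)
    rw [show q + (p + 1) = N by omega] at this
    rw [← this]
    congr 1
    exact (P.mu_comp_comm f P.e rfl).trans (P.e_cup f)
  have h₂ : P.normB (P.cup (N + 1) f g)
      = (-1 : k) ^ N • ∑ i ∈ Finset.range (q + 1 + (p + 1)),
        (P.lam ^ i) (P.comp N q (P.tau _ g) f) := by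
    rw [normB_apply, ← h₁, Finset.smul_sum, show q + 1 + (p + 1) = N + 1 by omega]
    refine Finset.sum_congr rfl fun i hi => ?_
    simp only [Finset.mem_range] at hi
    have := P.lam_pow_comp (N := N) (P.tau (N + 1) (P.cup (N + 1) f g)) P.e i (N - i) (by omega)
      (by omega)
    rw [show N - i + i = N by omega] at this
    rw [this, tau_eq, rootIns, map_smul, ← Module.End.mul_apply, ← pow_succ, map_smul,
      LinearMap.smul_apply, smul_smul, smul_smul, show N + 1 - (i + 1) = N - i by omega]
    congr 1
    rw [← pow_add, ← pow_add]
    exact neg_one_pow_congr (i + N + 1) (by ring)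
  have h₃ : P.lam (P.comp N 0 ((P.lam ^ q) (P.tau _ g)) f)
      = (-1 : k) ^ N • P.comp N p (P.tau _ f) g := by
    have hg : P.tau (q + 1) ((P.lam ^ q) (P.tau (q + 1) g)) = g := by
      rw [tau_eq, tau_eq, map_smul, map_smul, smul_smul, neg_one_pow_mul_self, one_smul,
        ← lam_succ_apply, ← Module.End.mul_apply, ← pow_succ, lam_pow_succ_self]
    rw [lam_apply, P.tau_comp_zero (j := p) _ _ (by omega) rfl (by omega), hg]
  rw [h₂, Finset.sum_range_add, smul_add, add_comm]
  congr 1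
  · rw [rotBrace, ← Finset.sum_range_reflect (fun a => (-1 : k) ^ (a * (q + 1 + 1)) •
      P.comp N a ((P.lam ^ (p + 1 - a)) f) g), Finset.smul_sum, Finset.smul_sum]
    refine Finset.sum_congr rfl fun i hi => ?_
    simp only [Finset.mem_range] at hi
    have h₄ := P.lam_pow_comp (N := N) (P.tau (q + 1) g) f q 0 (by omega) (by omega)
    have h₅ := P.lam_pow_comp (N := N) (P.tau (p + 1) f) g i (p - i) (by omega) (by omega)
    rw [zero_add] at h₄
    rw [show p - i + i = p by omega] at h₅
    rw [show q + 1 + i = i + 1 + q by omega, pow_add, Module.End.mul_apply, h₄, map_smul, pow_succ,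
      Module.End.mul_apply, h₃, map_smul, h₅, tau_eq, map_smul, ← Module.End.mul_apply,
      ← pow_succ, map_smul, LinearMap.smul_apply, show p + 1 - 1 - i = p - i by omega,
      show p + 1 - (p - i) = i + 1 by omega]
    simp only [smul_smul, ← pow_add]
    obtain ⟨t, rfl⟩ : ∃ t, p = i + t := ⟨p - i, by omega⟩
    congr 1
    rw [show i + t - i = t by omega]
    exact neg_one_pow_congr (N + q * t + i * q + t * 2 + i * 2 + q + 1) (by ring)
  · rw [rotBrace, ← Finset.sum_range_reflect (fun a => (-1 : k) ^ (a * (p + 1 + 1)) •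
      P.comp N a ((P.lam ^ (q + 1 - a)) g) f), Finset.smul_sum, Finset.smul_sum]
    refine Finset.sum_congr rfl fun i hi => ?_
    simp only [Finset.mem_range] at hi
    have h₅ := P.lam_pow_comp (N := N) (P.tau (q + 1) g) f i (q - i) (by omega) (by omega)
    rw [show q - i + i = q by omega] at h₅
    rw [h₅, tau_eq, map_smul, ← Module.End.mul_apply, ← pow_succ, map_smul, LinearMap.smul_apply,
      show q + 1 - 1 - i = q - i by omega, show q + 1 - (q - i) = i + 1 by omega]
    simp only [smul_smul, ← pow_add]
    obtain ⟨t, rfl⟩ : ∃ t, q = i + t := ⟨q - i, by omega⟩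
    congr 1
    rw [show i + t - i = t by omega]
    exact neg_one_pow_congr (p + p * i + p * t + i * 2 + t * 2 + 1) (by subst hN; ring)

/-- The difference of `normB` and Connes' coboundary. -/
def degB {n : ℕ} : O (n + 1) →ₗ[k] O n := normB P ∘ₗ P.lam

/-- Connes' coboundary `(-1)ⁿ N σ (1 - λ)`. -/
def connesB {n : ℕ} : O (n + 1) →ₗ[k] O n := P.normB - P.degB

theorem connesB_apply {n : ℕ} (f : O (n + 1)) :
    P.connesB f = (-1 : k) ^ n • ∑ i ∈ Finset.range (n + 1), (P.lam ^ i)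
      (P.comp n n (P.tau (n + 1) (f - P.lam f)) P.e) := by
  rw [connesB, degB, LinearMap.sub_apply, LinearMap.comp_apply, ← map_sub, normB_apply,
    Finset.smul_sum]
  refine Finset.sum_congr rfl fun i hi => ?_
  simp only [Finset.mem_range] at hi
  set g := f - P.lam f
  have h₅ := P.lam_pow_comp (N := n) (P.tau (n + 1) g) P.e i (n - i) (by omega) (by omega)
  rw [show n - i + i = n by omega] at h₅
  rw [h₅, tau_eq, map_smul, ← Module.End.mul_apply, ← pow_succ, map_smul, LinearMap.smul_apply,
    rootIns, show n + 1 - (i + 1) = n - i by omega]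
  simp only [smul_smul, ← pow_add]
  congr 1
  exact neg_one_pow_congr (n + i + 1) (by ring)

theorem lam_sum_lam {n : ℕ} (y : O n) :
    P.lam (∑ i ∈ Finset.range (n + 1), (P.lam ^ i) y)
      = ∑ i ∈ Finset.range (n + 1), (P.lam ^ i) y := by
  rw [map_sum, Finset.sum_congr rfl fun i _ => (P.lam_succ_apply i y).symm, Finset.sum_range_succ,
    lam_pow_succ_self, Finset.sum_range_succ']
  simp

/-- The image of the norm `N` consists of `λ`-invariants, so `(1 - λ) N = 0`. -/
theorem connesB_connesB {n : ℕ} (f : O (n + 2)) : P.connesB (P.connesB f) = 0 := by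
  rw [P.connesB_apply f, P.connesB_apply, map_smul, lam_sum_lam, sub_self]
  simp

/-- After one rotation more than in `rootIns_d`, the correction of `lam_pow_d` stops just below the
slot of the unit, and no difference of rotations is left. -/
theorem rootIns_lam_d {n j : ℕ} (f : O (n + 1)) (hj : j ≤ n + 1) :
    P.rootIns (j + 1) (P.lam (P.d f)) = P.dlt (n + 1 - j) (P.rootIns (j + 1) (P.lam f))
      - (P.d (P.rootIns j (P.lam f)) - P.dlt (n + 2 - j) (P.rootIns j (P.lam f))) := by
  obtain ⟨c, hc⟩ : ∃ c, n + 1 - j = c := ⟨_, rfl⟩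
  have e₁ : P.comp (n + 1) c (P.dlt c ((P.lam ^ (j + 2)) f)) P.e
      = P.dlt c (P.rootIns (j + 1) (P.lam f)) := by
    rcases c with _ | c
    · simp [dlt_zero]
    · rw [P.dlt_comp_e le_rfl (by omega), rootIns, ← Module.End.mul_apply, ← pow_succ,
        show n + 1 - (j + 1) = c by omega]
  have e₂ : P.rootIns j (P.lam f) = P.comp n c ((P.lam ^ (j + 1)) f) P.e := by
    rw [rootIns, hc, ← Module.End.mul_apply, ← pow_succ]
  rw [e₂, rootIns, ← Module.End.mul_apply, ← pow_succ,
    P.lam_pow_d (m := c) (j := j + 1) (by omega) (by omega),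
    show n + 1 + 1 - (j + 1) = c by omega, map_add, LinearMap.add_apply, P.d_comp_e (by omega),
    map_sub, map_sub, LinearMap.sub_apply, e₁, hc, show n + 2 - j = c + 1 by omega]
  abel

theorem degB_d {n : ℕ} (f : O (n + 1)) : P.degB (P.d f) = P.d (P.degB f) := by
  have key := sum_shift (k := k) (n + 1)
    (fun j => P.dlt (n + 1 - j) (P.rootIns (j + 1) (P.lam f)))
    (fun j => P.d (P.rootIns j (P.lam f)) - P.dlt (n + 2 - j) (P.rootIns j (P.lam f)))
    (by simp [dlt_zero]) (by simp [dlt_top])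
  rw [degB, degB, LinearMap.comp_apply, LinearMap.comp_apply, normB_apply, normB_apply, map_sum,
    Finset.sum_congr rfl fun i hi => by
      rw [P.rootIns_lam_d f (by simp at hi; omega)], key]
  refine Finset.sum_congr rfl fun i _ => ?_
  rw [map_smul, show n + 2 - (i + 1) = n + 1 - i by omega]
  congr 1
  abel

theorem connesB_d {n : ℕ} (f : O (n + 1)) : P.connesB (P.d f) = P.d (P.connesB f) := by
  rw [connesB, connesB, LinearMap.sub_apply, LinearMap.sub_apply, map_sub, degB_d, d_normB]

/-- Every term of `degB f` is, up to sign, a rotation of `f ∘₀ e`. -/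
theorem degB_eq_zero {n : ℕ} {f : O (n + 1)} (hf : P.comp n 0 f P.e = 0) : P.degB f = 0 := by
  rw [degB, LinearMap.comp_apply, normB_apply]
  refine Finset.sum_eq_zero fun i hi => ?_
  simp only [Finset.mem_range] at hi
  have h₁ := P.lam_pow_comp (N := n) ((P.lam ^ (i + 2)) f) P.e (n - i) 0 (by omega) (by omega)
  rw [← Module.End.mul_apply, ← pow_add, show n - i + (i + 2) = n + 1 + 1 by omega,
    lam_pow_succ_self, hf, smul_zero, zero_add] at h₁
  have h₂ : P.rootIns (i + 1) (P.lam f) = P.comp n (n - i) ((P.lam ^ (i + 2)) f) P.e := by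
    rw [rootIns, ← Module.End.mul_apply, ← pow_succ, show n + 1 - (i + 1) = n - i by omega]
  have h₃ := congrArg (P.lam ^ (i + 1)) h₁
  rw [← Module.End.mul_apply, ← pow_add, show i + 1 + (n - i) = n + 1 by omega,
    lam_pow_succ_self, map_zero] at h₃
  rw [h₂, h₃, smul_zero]

theorem connesB_eq_normB {n : ℕ} {f : O (n + 1)} (hf : P.comp n 0 f P.e = 0) :
    P.connesB f = P.normB f := by
  rw [connesB, LinearMap.sub_apply, P.degB_eq_zero hf, sub_zero]

/-- For a cocycle, `d_comp_e` in slot `0` says that `d (f ∘₀ e)` is the single coface `δ₀ (f ∘₀ e)`,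
and `e` in slot `0` undoes it. Killing this one codegeneracy is all the normalisation that
`degB_eq_zero` requires. -/
theorem sub_d_comp_e {n : ℕ} {f : O (n + 1)} (hf : P.d f = 0) :
    P.comp n 0 (f - P.d (P.comp n 0 f P.e)) P.e = 0 := by
  have h := P.d_comp_e (c := 0) (by omega) f
  rw [hf, dlt_zero, dlt_apply] at h
  simp only [map_zero, LinearMap.zero_apply, zero_sub, zero_add, Finset.sum_range_one, pow_zero,
    one_smul, neg_sub] at h
  rw [map_sub, LinearMap.sub_apply, ← sub_eq_zero.1 h.symm, P.δ_comp_e (Nat.zero_le n), sub_self]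

/-- The Batalin–Vilkovisky identity, up to coboundaries. -/
theorem gbracket_bv_mem_cob {p q N : ℕ} {f : O (p + 1)} {g : O (q + 1)} (hf : P.d f = 0)
    (hg : P.d g = 0) (hN : N = p + q + 1) :
    P.gbracket N f g - (-1 : k) ^ (p + 1) • (P.normB (P.cup (N + 1) f g) - P.cup N (P.normB f) g
      - (-1 : k) ^ (p + 1) • P.cup N f (P.normB g)) ∈ P.cob N := by
  have h₁ := P.brace_sub_rotBrace_mem_cob (N := N) hf hg (by omega)
  have h₂ := P.brace_sub_rotBrace_mem_cob (N := N) hg hf (by omega)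
  have h₃ := P.cup_comm_mem_cob (n := N) hf (show P.d (P.normB g) = 0 by
    rw [← d_normB, hg, map_zero]) (by omega)
  have e₁ : (-1 : k) ^ ((p + 1 + 1) * (q + 1 + 1)) = (-1) ^ (p * q) :=
    neg_one_pow_congr (p * q + p + q + 2) (by ring)
  have e₂ : (-1 : k) ^ (p * (q + 1)) = (-1) ^ (p * q) * (-1) ^ p := by rw [← pow_add]; ring_nf
  have e₃ : (-1 : k) ^ ((p + 1) * q) = (-1) ^ (p * q) * (-1) ^ q := by rw [← pow_add]; ring_nf
  have hp := neg_one_pow_mul_self (k := k) p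
  have hq := neg_one_pow_mul_self (k := k) q
  rw [e₃] at h₃
  rw [gbracket_apply, P.normB_cup f g hN, e₁, e₂]
  -- The rotated braces in `h₁` and `h₂` are the ones supplied by `normB_cup`; `h₃` moves `B g` to
  -- the right of `f`.
  convert Submodule.add_mem _ (Submodule.add_mem _ (Submodule.smul_mem _ ((-1 : k) ^ (p + 1)) h₁)
    (Submodule.smul_mem _ ((-1 : k) ^ (p * q) * (-1) ^ q) h₂)) h₃ using 1
  rw [pow_succ, pow_succ]
  generalize (-1 : k) ^ p = a at hp ⊢
  generalize (-1 : k) ^ q = b at hq ⊢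
  generalize (-1 : k) ^ (p * q) = c
  match_scalars <;> grind

end CyclicOperad

/-- From the generating identity and `B² = 0` it follows that `B` is a graded derivation of the
bracket. Expressing `{b, y}` through `B` and products then reduces the Jacobi identity to the
Leibniz rule. Here `s` and `t` are the signs of the degrees of `a` and `b`, and `u` is the sign for
moving `{a, -}` past `b`; the identities for `B a`, `B b` and `{a, b}` are hypotheses because no
grading is present. -/
theorem jacobi_of_bv {k A : Type*} [CommRing k] [AddCommGroup A] [Module k A]
    {mul br : A →ₗ[k] A →ₗ[k] A} {B : A →ₗ[k] A} (hB : ∀ x, B (B x) = 0) {a b : A} {s t u : k}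
    (hs : s * s = 1) (_ht : t * t = 1) (y : A)
    (ha : ∀ y, br a y = s • (B (mul a y) - mul (B a) y - s • mul a (B y)))
    (ha' : ∀ y, br (B a) y = (-s) • (B (mul (B a) y) - mul (B (B a)) y
      - (-s) • mul (B a) (B y)))
    (hb : ∀ y, br b y = t • (B (mul b y) - mul (B b) y - t • mul b (B y)))
    (hab : ∀ y, br (br a b) y = (-(s * t)) • (B (mul (br a b) y) - mul (B (br a b)) y
      - (-(s * t)) • mul (br a b) (B y)))
    (lb : ∀ y, br a (mul b y) = mul (br a b) y + u • mul b (br a y))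
    (lb' : ∀ y, br a (mul (B b) y) = mul (br a (B b)) y + (-(s * u)) • mul (B b) (br a y))
    (lc : ∀ y, br (B a) (mul b y) = mul (br (B a) b) y + (t * u) • mul b (br (B a) y)) :
    br a (br b y) = br (br a b) y + (-(s * u)) • br b (br a y) := by
  have hD : ∀ x, br a (B x) = s • (br (B a) x - B (br a x)) := by
    intro x
    rw [ha, ha, ha', hB, hB]
    simp only [map_sub, map_smul, hB, map_zero, LinearMap.zero_apply]
    match_scalars <;> grind
  have e : br a (br b y) = t • (br a (B (mul b y)) - br a (mul (B b) y) - t • br a (mul b (B y))) := by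
    rw [hb y, map_smul, map_sub, map_sub, map_smul]
  have hBD : B (br a b) = br (B a) b - s • br a (B b) := by
    rw [hD b]
    match_scalars <;> grind
  rw [e, hD, lb, lb', lb, lc, hab, hBD, hb (br a y), hD y]
  simp only [map_add, map_sub, map_smul, LinearMap.sub_apply, LinearMap.smul_apply]
  match_scalars <;> grind

/-! ### Passage to cohomology -/

section Bilinear

variable {k : Type*} [CommRing k] {A A' W : Type*} [AddCommGroup A] [AddCommGroup A']
  [AddCommGroup W] [Module k A] [Module k A'] [Module k W]

/-- The bilinear map induced on quotients by a bilinear map. -/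
def liftQ₂ (S : Submodule k A) (S' : Submodule k A') (L : A →ₗ[k] A' →ₗ[k] W)
    (h : ∀ x ∈ S, ∀ y, L x y = 0) (h' : ∀ x, ∀ y ∈ S', L x y = 0) :
    A ⧸ S →ₗ[k] A' ⧸ S' →ₗ[k] W :=
  (S'.liftQ (S.liftQ L fun x hx => LinearMap.ext (h x hx)).flip fun y hy => by
    ext x
    exact h' x y hy).flip

variable {V : ℕ → Type*} [∀ n, AddCommGroup (V n)] [∀ n, Module k (V n)]

/-- The bilinear map on a direct sum with given homogeneous components. -/
def sumBilinear (m : ∀ p q, V p →ₗ[k] V q →ₗ[k] W) :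
    (⨁ n, V n) →ₗ[k] (⨁ n, V n) →ₗ[k] W :=
  DirectSum.toModule k ℕ _ fun p => (DirectSum.toModule k ℕ _ fun q => (m p q).flip).flip

theorem sumBilinear_lof (m : ∀ p q, V p →ₗ[k] V q →ₗ[k] W) {p q : ℕ} (a : V p) (b : V q) :
    sumBilinear m (DirectSum.lof k ℕ V p a) (DirectSum.lof k ℕ V q b) = m p q a b := by
  simp [sumBilinear, DirectSum.toModule_lof]

end Bilinear

namespace CyclicOperad

variable {k : Type*} [CommRing k] {O : ℕ → Type*} [∀ n, AddCommGroup (O n)] [∀ n, Module k (O n)]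
  (P : CyclicOperad k O)

/-- The cocycles. -/
abbrev cocyc (n : ℕ) : Submodule k (O n) := LinearMap.ker (P.d (n := n))

/-- The cohomology. -/
def Coh (n : ℕ) : Type _ := P.cocyc n ⧸ (P.cob n).submoduleOf (P.cocyc n)

instance (n : ℕ) : AddCommGroup (P.Coh n) := Submodule.Quotient.addCommGroup _

instance (n : ℕ) : Module k (P.Coh n) := Submodule.Quotient.module _

/-- The class of a cocycle in its degree. -/
def toCoh (n : ℕ) : P.cocyc n →ₗ[k] P.Coh n := Submodule.mkQ _

theorem toCoh_eq_zero {n : ℕ} {x : P.cocyc n} : P.toCoh n x = 0 ↔ (x : O n) ∈ P.cob n :=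
  Submodule.Quotient.mk_eq_zero _

theorem toCoh_surjective (n : ℕ) : Function.Surjective (P.toCoh n) := Submodule.mkQ_surjective _

/-- The class of a cocycle. -/
def cls {n : ℕ} : P.cocyc n →ₗ[k] ⨁ n, P.Coh n :=
  DirectSum.lof k ℕ P.Coh n ∘ₗ P.toCoh n

theorem cls_eq_zero {n : ℕ} {x : P.cocyc n} (h : (x : O n) ∈ P.cob n) : P.cls x = 0 := by
  rw [cls, LinearMap.comp_apply, P.toCoh_eq_zero.2 h, map_zero]

/-- A cocycle, from a cochain with vanishing differential. -/
def mkC {n : ℕ} (f : O n) (h : P.d f = 0) : P.cocyc n := ⟨f, h⟩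

@[simp]
theorem coe_mkC {n : ℕ} (f : O n) (h : P.d f = 0) : (P.mkC f h : O n) = f := rfl

theorem d_coe {n : ℕ} (x : P.cocyc n) : P.d (x : O n) = 0 := x.2

theorem cls_mkC_eq_zero {n : ℕ} {f : O n} (h : P.d f = 0) (hf : f ∈ P.cob n) :
    P.cls (P.mkC f h) = 0 := P.cls_eq_zero hf

theorem cls_eq {n : ℕ} {x y : P.cocyc n} (h : (x : O n) - y ∈ P.cob n) : P.cls x = P.cls y := by
  rw [← sub_eq_zero, ← map_sub]
  exact P.cls_eq_zero h

theorem exists_cls {n : ℕ} (a : P.Coh n) :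
    ∃ x : P.cocyc n, DirectSum.lof k ℕ P.Coh n a = P.cls x := by
  obtain ⟨x, rfl⟩ := P.toCoh_surjective n a
  exact ⟨x, rfl⟩

theorem cls_induction {motive : (⨁ n, P.Coh n) → Prop} (zero : motive 0)
    (cls : ∀ (n : ℕ) (x : P.cocyc n), motive (P.cls x))
    (add : ∀ x y, motive x → motive y → motive (x + y)) (x : ⨁ n, P.Coh n) : motive x := by
  induction x using DirectSum.induction_on with
  | zero => exact zero
  | of n a =>
    obtain ⟨x, hx⟩ := P.exists_cls a
    rw [DirectSum.lof_eq_of] at hx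
    rw [hx]
    exact cls n x
  | add x y hx hy => exact add x y hx hy

section Descent

variable {p q n : ℕ} (L : O p →ₗ[k] O q →ₗ[k] O n)
  (h : ∀ x y, P.d x = 0 → P.d y = 0 → P.d (L x y) = 0)
  (h₁ : ∀ x y, x ∈ P.cob p → P.d y = 0 → L x y ∈ P.cob n)
  (h₂ : ∀ x y, P.d x = 0 → y ∈ P.cob q → L x y ∈ P.cob n)

/-- The bilinear operation on cohomology induced by one on cochains. -/
def cohLift : P.Coh p →ₗ[k] P.Coh q →ₗ[k] ⨁ n, P.Coh n :=
  liftQ₂ ((P.cob p).submoduleOf _) ((P.cob q).submoduleOf _)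
    (LinearMap.mk₂ k (fun (x : P.cocyc p) (y : P.cocyc q) =>
        P.cls (P.mkC (L x y) (h x y (P.d_coe x) (P.d_coe y))))
      (fun x x' y => by rw [← map_add]; congr 1; ext; simp)
      (fun r x y => by rw [← map_smul]; congr 1; ext; simp)
      (fun x y y' => by rw [← map_add]; congr 1; ext; simp)
      (fun r x y => by rw [← map_smul]; congr 1; ext; simp))
    (fun x hx y => P.cls_eq_zero (h₁ x y hx (P.d_coe y)))
    (fun x y hy => P.cls_eq_zero (h₂ x y (P.d_coe x) hy))

theorem sumBilinear_cls {W : Type*} [AddCommGroup W] [Module k W]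
    (m : ∀ p q, P.Coh p →ₗ[k] P.Coh q →ₗ[k] W) (x : P.cocyc p) (y : P.cocyc q) :
    sumBilinear m (P.cls x) (P.cls y) = m p q (P.toCoh p x) (P.toCoh q y) :=
  sumBilinear_lof _ _ _

end Descent

theorem d_cup_cocycle {p q n : ℕ} {x : O p} {y : O q} (hx : P.d x = 0) (hy : P.d y = 0)
    (hn : n = p + q) : P.d (P.cup n x y) = 0 := by
  rw [P.d_cup x y hn, hx, hy]
  simp

theorem cup_mem_cob_left {p q n : ℕ} {x : O p} {y : O q} (hx : x ∈ P.cob p) (hy : P.d y = 0)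
    (hn : n = p + q) : P.cup n x y ∈ P.cob n := by
  rcases p with _ | p
  · obtain rfl : x = 0 := hx
    simp
  · obtain ⟨x, rfl⟩ := hx
    obtain ⟨n, rfl⟩ : ∃ m, n = m + 1 := ⟨n - 1, by omega⟩
    have h := P.d_mem_cob (P.cup n x y)
    rw [P.d_cup x y (by omega), hy, map_zero, zero_add] at h
    convert Submodule.smul_mem _ ((-1 : k) ^ q) h using 1
    rw [smul_smul, neg_one_pow_mul_self, one_smul]

theorem cup_mem_cob_right {p q n : ℕ} {x : O p} {y : O q} (hx : P.d x = 0) (hy : y ∈ P.cob q)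
    (hn : n = p + q) : P.cup n x y ∈ P.cob n := by
  rcases q with _ | q
  · obtain rfl : y = 0 := hy
    simp
  · obtain ⟨y, rfl⟩ := hy
    obtain ⟨n, rfl⟩ : ∃ m, n = m + 1 := ⟨n - 1, by omega⟩
    have h := P.d_mem_cob (P.cup n x y)
    rwa [P.d_cup x y (by omega), hx, map_zero, LinearMap.zero_apply, smul_zero, add_zero] at h

theorem gbracket_of_zero {n : ℕ} (x y : O 0) : P.gbracket n x y = 0 := by
  simp [gbracket_apply, brace_of_zero]

theorem gbracket_mem_cob_right {p q n : ℕ} {x : O p} {y : O q} (hx : P.d x = 0)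
    (hy : y ∈ P.cob q) (hn : n + 1 = p + q) : P.gbracket n x y ∈ P.cob n := by
  rcases q with _ | q
  · obtain rfl : y = 0 := hy
    simp
  · obtain ⟨y, rfl⟩ := hy
    exact P.gbracket_d_mem_cob y hx (by omega)

theorem gbracket_mem_cob_left {p q n : ℕ} {x : O p} {y : O q} (hx : x ∈ P.cob p)
    (hy : P.d y = 0) (hn : n + 1 = p + q) : P.gbracket n x y ∈ P.cob n := by
  rw [gbracket_skew]
  exact Submodule.neg_mem _ (Submodule.smul_mem _ _ (P.gbracket_mem_cob_right hy hx (by omega)))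

/-- The cup product on cohomology. -/
def cohMul : (⨁ n, P.Coh n) →ₗ[k] (⨁ n, P.Coh n) →ₗ[k] ⨁ n, P.Coh n :=
  sumBilinear fun p q => P.cohLift (P.cup (p + q))
    (fun _ _ hx hy => P.d_cup_cocycle hx hy rfl)
    (fun _ _ hx hy => P.cup_mem_cob_left hx hy rfl)
    (fun _ _ hx hy => P.cup_mem_cob_right hx hy rfl)

theorem cohMul_cls {p q n : ℕ} (x : P.cocyc p) (y : P.cocyc q) (hn : n = p + q) :
    P.cohMul (P.cls x) (P.cls y) = P.cls (P.mkC (P.cup n (x : O p) (y : O q))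
      (P.d_cup_cocycle (P.d_coe x) (P.d_coe y) hn)) := by
  subst hn
  exact P.sumBilinear_cls _ x y

/-- The bracket on cohomology. -/
def cohBracket : (⨁ n, P.Coh n) →ₗ[k] (⨁ n, P.Coh n) →ₗ[k] ⨁ n, P.Coh n :=
  -- The subtraction is truncated only for `p = q = 0`, where the bracket is zero for lack of slots.
  sumBilinear fun p q => P.cohLift (P.gbracket (p + q - 1))
    (fun x y hx hy => by
      rcases Nat.eq_zero_or_pos (p + q) with h | h
      · obtain ⟨rfl, rfl⟩ : p = 0 ∧ q = 0 := by omega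
        rw [gbracket_of_zero, map_zero]
      · exact P.d_gbracket hx hy (by omega))
    (fun x y hx hy => by
      rcases Nat.eq_zero_or_pos (p + q) with h | h
      · obtain ⟨rfl, rfl⟩ : p = 0 ∧ q = 0 := by omega
        rw [gbracket_of_zero]
        exact Submodule.zero_mem _
      · exact P.gbracket_mem_cob_left hx hy (by omega))
    (fun x y hx hy => by
      rcases Nat.eq_zero_or_pos (p + q) with h | h
      · obtain ⟨rfl, rfl⟩ : p = 0 ∧ q = 0 := by omega
        rw [gbracket_of_zero]
        exact Submodule.zero_mem _
      · exact P.gbracket_mem_cob_right hx hy (by omega))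

theorem cohBracket_cls {p q n : ℕ} (x : P.cocyc p) (y : P.cocyc q) (hn : n + 1 = p + q) :
    P.cohBracket (P.cls x) (P.cls y) = P.cls (P.mkC (P.gbracket n (x : O p) (y : O q))
      (P.d_gbracket (P.d_coe x) (P.d_coe y) hn)) := by
  obtain rfl : n = p + q - 1 := by omega
  exact P.sumBilinear_cls _ x y

theorem cohBracket_cls_zero (x y : P.cocyc 0) : P.cohBracket (P.cls x) (P.cls y) = 0 := by
  refine (P.sumBilinear_cls _ x y).trans (P.cls_mkC_eq_zero _ ?_)
  rw [gbracket_of_zero]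
  exact Submodule.zero_mem _

theorem d_connesB_cocycle {n : ℕ} {x : O (n + 1)} (hx : P.d x = 0) : P.d (P.connesB x) = 0 := by
  rw [← connesB_d, hx, map_zero]

theorem connesB_mem_cob {n : ℕ} {x : O (n + 1)} (hx : x ∈ P.cob (n + 1)) :
    P.connesB x ∈ P.cob n := by
  obtain ⟨x, rfl⟩ := hx
  -- `connesB_d` starts in degree one; below it there is nothing to check, since `d` vanishes on `O
  -- 0`.
  rcases n with _ | n
  · rw [d_of_zero, map_zero]
    exact Submodule.zero_mem _
  · rw [connesB_d]
    exact P.d_mem_cob _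

/-- Connes' operator on cohomology. -/
def cohB : (⨁ n, P.Coh n) →ₗ[k] ⨁ n, P.Coh n :=
  DirectSum.toModule k ℕ _ fun n => match n with
    | 0 => 0
    | n + 1 => Submodule.liftQ ((P.cob (n + 1)).submoduleOf _)
      { toFun := fun x : P.cocyc (n + 1) => P.cls (P.mkC (P.connesB (x : O (n + 1)))
          (P.d_connesB_cocycle (P.d_coe x)))
        map_add' := fun x y => by rw [← map_add]; congr 1; ext; simp
        map_smul' := fun r x => by rw [RingHom.id_apply, ← map_smul]; congr 1; ext; simp }
      (fun _ hx => P.cls_eq_zero (P.connesB_mem_cob hx))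

theorem cohB_cls {n : ℕ} (x : P.cocyc (n + 1)) :
    P.cohB (P.cls x) = P.cls (P.mkC (P.connesB (x : O (n + 1)))
      (P.d_connesB_cocycle (P.d_coe x))) := by
  rw [cohB, cls, LinearMap.comp_apply, DirectSum.toModule_lof]
  rfl

theorem cohB_cls_zero (x : P.cocyc 0) : P.cohB (P.cls x) = 0 := by
  rw [cohB, cls, LinearMap.comp_apply, DirectSum.toModule_lof]
  rfl

theorem cohB_cohB (x : ⨁ n, P.Coh n) : P.cohB (P.cohB x) = 0 := by
  induction x using P.cls_induction with
  | zero => simp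
  | cls n x =>
    rcases n with _ | _ | n
    · rw [cohB_cls_zero, map_zero]
    · rw [cohB_cls, cohB_cls_zero]
    · rw [cohB_cls, cohB_cls]
      refine P.cls_mkC_eq_zero _ ?_
      rw [coe_mkC, connesB_connesB]
      exact Submodule.zero_mem _
  | add x y hx hy => rw [map_add, map_add, hx, hy, add_zero]

/-- The class of the unit. -/
def unitCls : P.cocyc 0 := P.mkC P.e (P.d_of_zero _)

theorem cohMul_unit_left (x : ⨁ n, P.Coh n) : P.cohMul (P.cls P.unitCls) x = x := by
  induction x using P.cls_induction with
  | zero => simp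
  | cls n x =>
    rw [P.cohMul_cls _ _ (zero_add n).symm]
    congr 1
    ext
    exact P.e_cup _
  | add x y hx hy => rw [map_add, hx, hy]

theorem cohMul_unit_right (x : ⨁ n, P.Coh n) : P.cohMul x (P.cls P.unitCls) = x := by
  induction x using P.cls_induction with
  | zero => simp
  | cls n x =>
    rw [P.cohMul_cls _ _ (add_zero n).symm]
    congr 1
    ext
    exact P.cup_e _
  | add x y hx hy => rw [map_add, LinearMap.add_apply, hx, hy]

theorem cohMul_assoc (x y z : ⨁ n, P.Coh n) :
    P.cohMul (P.cohMul x y) z = P.cohMul x (P.cohMul y z) := by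
  induction x using P.cls_induction with
  | zero => simp
  | add x x' hx hx' => simp only [map_add, LinearMap.add_apply, hx, hx']
  | cls p x =>
  induction y using P.cls_induction with
  | zero => simp
  | add x x' hx hx' => simp only [map_add, LinearMap.add_apply, hx, hx']
  | cls q y =>
  induction z using P.cls_induction with
  | zero => simp
  | add x x' hx hx' => simp only [map_add, hx, hx']
  | cls r z =>
    rw [P.cohMul_cls x y rfl, P.cohMul_cls y z rfl, P.cohMul_cls (n := p + q + r) _ _ rfl,
      P.cohMul_cls (n := p + q + r) _ _ (by omega)]
    congr 1
    ext
    exact P.cup_assoc _ _ _ rfl rfl rfl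

theorem cohMul_comm {p q : ℕ} (x : P.cocyc p) (y : P.cocyc q) :
    P.cohMul (P.cls x) (P.cls y) = (-1 : k) ^ (p * q) • P.cohMul (P.cls y) (P.cls x) := by
  rw [P.cohMul_cls x y rfl, P.cohMul_cls (n := p + q) y x (by omega), ← map_smul]
  exact P.cls_eq (P.cup_comm_mem_cob (P.d_coe x) (P.d_coe y) rfl)

theorem cohBracket_skew {p q : ℕ} (x : P.cocyc p) (y : P.cocyc q) :
    P.cohBracket (P.cls x) (P.cls y)
      = -((-1 : k) ^ ((p + 1) * (q + 1)) • P.cohBracket (P.cls y) (P.cls x)) := by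
  rcases Nat.eq_zero_or_pos (p + q) with h | h
  · obtain ⟨rfl, rfl⟩ : p = 0 ∧ q = 0 := by omega
    simp [cohBracket_cls_zero]
  · rw [P.cohBracket_cls (n := p + q - 1) x y (by omega),
      P.cohBracket_cls (n := p + q - 1) y x (by omega), ← map_smul, ← map_neg]
    congr 1
    ext
    exact P.gbracket_skew _ _

theorem exists_cohBracket_cls {p q : ℕ} (x : P.cocyc p) (y : P.cocyc q) :
    ∃ z : P.cocyc (p + q - 1), P.cohBracket (P.cls x) (P.cls y) = P.cls z ∧
      (0 < p + q → (z : O (p + q - 1)) = P.gbracket _ (x : O p) (y : O q)) ∧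
      (p + q = 0 → (z : O (p + q - 1)) = 0) := by
  rcases Nat.eq_zero_or_pos (p + q) with h | h
  · obtain ⟨rfl, rfl⟩ : p = 0 ∧ q = 0 := by omega
    exact ⟨0, by rw [cohBracket_cls_zero, map_zero], by omega, fun _ => rfl⟩
  · exact ⟨_, P.cohBracket_cls (n := p + q - 1) x y (by omega), fun _ => rfl, by omega⟩

theorem cohBracket_mul {r q : ℕ} (c : P.cocyc r) (a : P.cocyc q) (y : ⨁ n, P.Coh n) :
    P.cohBracket (P.cls c) (P.cohMul (P.cls a) y)
      = P.cohMul (P.cohBracket (P.cls c) (P.cls a)) y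
        + (-1 : k) ^ ((r + 1) * q) • P.cohMul (P.cls a) (P.cohBracket (P.cls c) y) := by
  induction y using P.cls_induction with
  | zero => simp
  | add x x' hx hx' =>
    simp only [map_add, hx, hx', smul_add]
    abel
  | cls t b =>
    obtain ⟨x, hx, hx₁, hx₂⟩ := P.exists_cohBracket_cls c a
    obtain ⟨y, hy, hy₁, hy₂⟩ := P.exists_cohBracket_cls c b
    rw [hx, hy, P.cohMul_cls a b rfl]
    -- The cases separate the brackets of two classes of degree zero, which are zero but whose
    -- formal degree is a truncated subtraction.
    rcases Nat.eq_zero_or_pos (r + q) with h | h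
    · obtain ⟨rfl, rfl⟩ : r = 0 ∧ q = 0 := by omega
      obtain rfl : x = 0 := Subtype.ext (hx₂ rfl)
      rcases Nat.eq_zero_or_pos t with rfl | h'
      · obtain rfl : y = 0 := Subtype.ext (hy₂ rfl)
        rw [cohBracket_cls_zero]
        simp
      · obtain ⟨t, rfl⟩ : ∃ s, t = s + 1 := ⟨t - 1, by omega⟩
        rw [P.cohBracket_cls (n := t) _ _ (by omega), P.cohMul_cls (n := t) a y (by omega),
          map_zero, map_zero, LinearMap.zero_apply, @zero_add (⨁ n, P.Coh n), ← map_smul]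
        refine P.cls_eq ?_
        have := P.gbracket_cup_mem_cob (m := 0) (m' := 0 + (t + 1) - 1) (N := t)
          (P.d_coe c) (P.d_coe a) (P.d_coe b)
          (by omega) (by omega) (by omega) (x := 0) (by omega) (fun _ => rfl) hy₁ (by omega)
        simpa using this
    · rcases Nat.eq_zero_or_pos (r + t) with h' | h'
      · obtain ⟨rfl, rfl⟩ : r = 0 ∧ t = 0 := by omega
        obtain rfl : y = 0 := Subtype.ext (hy₂ rfl)
        rw [P.cohBracket_cls (n := 0 + q - 1) _ _ (by omega),
          P.cohMul_cls (n := 0 + q - 1) x _ (by omega), map_zero, map_zero, smul_zero,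
          @add_zero (⨁ n, P.Coh n)]
        refine P.cls_eq ?_
        have := P.gbracket_cup_mem_cob (m := 0 + q - 1) (m' := 0) (N := 0 + q - 1)
          (P.d_coe c) (P.d_coe a) (P.d_coe b)
          (by omega) (by omega) (by omega) hx₁ (by omega) (y := 0) (by omega) (fun _ => rfl)
        simpa using this
      · rw [P.cohBracket_cls (n := r + q + t - 1) _ _ (by omega),
          P.cohMul_cls (n := r + q + t - 1) x b (by omega),
          P.cohMul_cls (n := r + q + t - 1) a y (by omega), ← map_smul, ← map_add]
        refine P.cls_eq ?_
        have := P.gbracket_cup_mem_cob (N := r + q + t - 1) (P.d_coe c) (P.d_coe a) (P.d_coe b)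
          (by omega) (by omega) (by omega) hx₁ hx₂ hy₁ hy₂
        convert this using 1
        simp [sub_sub]

theorem exists_normalized {n : ℕ} (x : P.cocyc (n + 1)) :
    ∃ y : P.cocyc (n + 1), P.cls x = P.cls y ∧ P.comp n 0 (y : O (n + 1)) P.e = 0 := by
  refine ⟨P.mkC (x - P.d (P.comp n 0 (x : O (n + 1)) P.e)) ?_, P.cls_eq ?_,
    P.sub_d_comp_e (P.d_coe x)⟩
  · rw [map_sub, d_d, sub_zero, d_coe]
  · rw [coe_mkC, sub_sub_cancel]
    exact P.d_mem_cob _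

/-- The Leibniz rule for `1 · 1 = 1` reads `{x, 1} = {x, 1} + {x, 1}`. -/
theorem cohBracket_unit {n : ℕ} (x : P.cocyc n) :
    P.cohBracket (P.cls x) (P.cls P.unitCls) = 0 := by
  have h := P.cohBracket_mul x P.unitCls (P.cls P.unitCls)
  rw [cohMul_unit_left, cohMul_unit_right, cohMul_unit_left] at h
  simpa only [zero_add, mul_zero, pow_zero, one_smul, left_eq_add] using h

theorem exists_cls_zero (x : P.cocyc 0) : ∃ r : k, P.cls x = r • P.cls P.unitCls := by
  obtain ⟨r, hr⟩ := P.exists_smul_e x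
  refine ⟨r, ?_⟩
  rw [← map_smul]
  congr 1
  ext
  exact hr

/-- A class of degree zero is a multiple of the unit, and then both sides vanish. In positive
degrees normalised representatives are chosen, on which Connes' operator is `normB`. Their product
is normalised as well, because slot `0` of `f ⌣ g` is slot `0` of `g`. -/
theorem cohBracket_eq {p : ℕ} (x : P.cocyc p) (y : ⨁ n, P.Coh n) :
    P.cohBracket (P.cls x) y
      = (-1 : k) ^ p • (P.cohB (P.cohMul (P.cls x) y) - P.cohMul (P.cohB (P.cls x)) y
          - (-1 : k) ^ p • P.cohMul (P.cls x) (P.cohB y)) := by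
  induction y using P.cls_induction with
  | zero => simp
  | add x x' hx hx' =>
    simp only [map_add, hx, hx']
    module
  | cls q y =>
  rcases q with _ | q
  · obtain ⟨r, hr⟩ := P.exists_cls_zero y
    rw [hr]
    simp [cohBracket_unit, cohMul_unit_right, cohB_cls_zero]
  rcases p with _ | p
  · obtain ⟨r, hr⟩ := P.exists_cls_zero x
    rw [hr]
    have h := P.cohBracket_skew P.unitCls y
    rw [cohBracket_unit, smul_zero, neg_zero] at h
    simp [cohMul_unit_left, cohB_cls_zero, h]
  obtain ⟨f, hf, hf'⟩ := P.exists_normalized x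
  obtain ⟨g, hg, hg'⟩ := P.exists_normalized y
  rw [hf, hg, P.cohMul_cls (n := p + q + 1 + 1) f g (by omega), cohB_cls, cohB_cls, cohB_cls,
    P.cohBracket_cls (n := p + q + 1) f g (by omega), P.cohMul_cls (n := p + q + 1) _ g (by omega),
    P.cohMul_cls (n := p + q + 1) f _ (by omega), ← map_sub, ← map_smul, ← map_sub, ← map_smul]
  refine P.cls_eq ?_
  have hfg : P.comp (p + q + 1) 0 (P.cup (p + q + 1 + 1) (f : O (p + 1)) (g : O (q + 1))) P.e
      = 0 := by
    rw [show p + q + 1 + 1 = (p + 1) + (q + 1) by omega,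
      P.cup_comp_left (m := q) _ _ _ (by omega) (by omega) (by omega), hg', map_zero]
  have := P.gbracket_bv_mem_cob (N := p + q + 1) (P.d_coe f) (P.d_coe g) rfl
  rw [← P.connesB_eq_normB hf', ← P.connesB_eq_normB hg', ← P.connesB_eq_normB hfg] at this
  exact this

end CyclicOperad

/-! ### The Jacobi identity and the Batalin–Vilkovisky algebra of a cyclic operad -/

namespace CyclicOperad

variable {k : Type*} [CommRing k] {O : ℕ → Type*} [∀ n, AddCommGroup (O n)] [∀ n, Module k (O n)]
  (P : CyclicOperad k O)

/-- The side conditions of `jacobi_of_bv` concern `B a`, `B b` and `{a, b}`. Each of these is either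
zero or the class of a cocycle whose degree is known, so the identities already proved apply to it.
-/
theorem cohBracket_jacobi {p q : ℕ} (a : P.cocyc p) (b : P.cocyc q) (y : ⨁ n, P.Coh n) :
    P.cohBracket (P.cls a) (P.cohBracket (P.cls b) y)
      = P.cohBracket (P.cohBracket (P.cls a) (P.cls b)) y
        + (-1 : k) ^ ((p + 1) * (q + 1)) •
          P.cohBracket (P.cls b) (P.cohBracket (P.cls a) y) := by
  have hBa : (∃ a' : P.cocyc (p - 1), P.cohB (P.cls a) = P.cls a' ∧ 0 < p) ∨
      P.cohB (P.cls a) = 0 := by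
    rcases p with _ | p
    · exact Or.inr (P.cohB_cls_zero a)
    · exact Or.inl ⟨_, P.cohB_cls a, p.succ_pos⟩
  have hBb : (∃ b' : P.cocyc (q - 1), P.cohB (P.cls b) = P.cls b' ∧ 0 < q) ∨
      P.cohB (P.cls b) = 0 := by
    rcases q with _ | q
    · exact Or.inr (P.cohB_cls_zero b)
    · exact Or.inl ⟨_, P.cohB_cls b, q.succ_pos⟩
  have e : (-1 : k) ^ ((p + 1) * (q + 1)) = -((-1) ^ p * (-1) ^ ((p + 1) * q)) := by ring
  rw [e]
  refine jacobi_of_bv (t := (-1) ^ q) P.cohB_cohB (neg_one_pow_mul_self p) (neg_one_pow_mul_self q)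
    y (P.cohBracket_eq a) (fun y => ?_) (P.cohBracket_eq b) (fun y => ?_)
    (P.cohBracket_mul a b) (fun y => ?_) (fun y => ?_)
  · rcases hBa with ⟨a', h, hp⟩ | h
    · obtain ⟨p, rfl⟩ : ∃ s, p = s + 1 := ⟨p - 1, by omega⟩
      rw [h, pow_succ, mul_neg_one, neg_neg]
      exact P.cohBracket_eq a' y
    · simp [h]
  · obtain ⟨z, hz, -, hz'⟩ := P.exists_cohBracket_cls a b
    rw [hz]
    rcases Nat.eq_zero_or_pos (p + q) with h | h
    · obtain rfl : z = 0 := Subtype.ext (hz' h)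
      simp
    · have := P.cohBracket_eq z y
      rwa [show (-1 : k) ^ (p + q - 1) = -((-1) ^ p * (-1) ^ q) by
        rw [← pow_add]
        obtain ⟨m, hm⟩ : ∃ m, p + q = m + 1 := ⟨p + q - 1, by omega⟩
        rw [hm, Nat.add_sub_cancel, pow_succ]; ring] at this
  · rcases hBb with ⟨b', h, hq⟩ | h
    · obtain ⟨q, rfl⟩ : ∃ s, q = s + 1 := ⟨q - 1, by omega⟩
      rw [h, ← e, P.cohBracket_mul a b' y]
      congr 2
      exact neg_one_pow_congr (p * q + p + q + 1) (by
        rw [Nat.add_sub_cancel]; ring)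
    · simp [h]
  · rcases hBa with ⟨a', h, hp⟩ | h
    · obtain ⟨p, rfl⟩ : ∃ s, p = s + 1 := ⟨p - 1, by omega⟩
      rw [h, P.cohBracket_mul a' b y, ← pow_add]
      congr 2
      exact neg_one_pow_congr (p * q + 2 * q) (by rw [Nat.add_sub_cancel]; ring)
    · simp [h]

/-- The cohomology of a cyclic operad with multiplication is a Batalin–Vilkovisky algebra. -/
def bvAlgebra : BVAlgebra k P.Coh where
  mul := P.cohMul
  one := P.toCoh 0 P.unitCls
  bracket := P.cohBracket
  mul_degree p q a b := by
    obtain ⟨x, hx⟩ := P.exists_cls a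
    obtain ⟨y, hy⟩ := P.exists_cls b
    exact ⟨_, by rw [hx, hy, P.cohMul_cls x y rfl]; rfl⟩
  mul_assoc := P.cohMul_assoc
  one_mul := P.cohMul_unit_left
  mul_one := P.cohMul_unit_right
  mul_comm p q a b := by
    obtain ⟨x, hx⟩ := P.exists_cls a
    obtain ⟨y, hy⟩ := P.exists_cls b
    rw [hx, hy, P.cohMul_comm]
  bracket_degree p q n hn a b := by
    obtain ⟨x, hx⟩ := P.exists_cls a
    obtain ⟨y, hy⟩ := P.exists_cls b
    exact ⟨_, by rw [hx, hy, P.cohBracket_cls x y hn]; rfl⟩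
  bracket_degree_zero a b := by
    obtain ⟨x, hx⟩ := P.exists_cls a
    obtain ⟨y, hy⟩ := P.exists_cls b
    rw [hx, hy, P.cohBracket_cls_zero]
  bracket_skew p q a b := by
    obtain ⟨x, hx⟩ := P.exists_cls a
    obtain ⟨y, hy⟩ := P.exists_cls b
    rw [hx, hy, P.cohBracket_skew]
  jacobi p q a b z := by
    obtain ⟨x, hx⟩ := P.exists_cls a
    obtain ⟨y, hy⟩ := P.exists_cls b
    rw [hx, hy, P.cohBracket_jacobi]
  leibniz r q c a y := by
    obtain ⟨x, hx⟩ := P.exists_cls c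
    obtain ⟨z, hz⟩ := P.exists_cls a
    rw [hx, hz, P.cohBracket_mul]
  B := P.cohB
  B_degree n a := by
    obtain ⟨x, hx⟩ := P.exists_cls a
    exact ⟨_, by rw [hx, P.cohB_cls]; rfl⟩
  B_degree_zero a := by
    obtain ⟨x, hx⟩ := P.exists_cls a
    rw [hx, P.cohB_cls_zero]
  B_B := P.cohB_cohB
  bracket_eq p a y := by
    obtain ⟨x, hx⟩ := P.exists_cls a
    rw [hx, P.cohBracket_eq]

end CyclicOperad

/-! ### The antipode and the coproduct -/

section Antipode

open LinearMap WithConv Coalgebra HopfAlgebra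

variable {k H : Type*} [CommRing k] [Ring H] [HopfAlgebra k H]

/-- `∑ (1 ⊗ b₁) Δ(S b₂) = S b ⊗ 1`. -/
theorem sum_tmul_mul_comul_antipode (b : H) :
    ∑ i ∈ (ℛ k b).index, ((1 : H) ⊗ₜ[k] (ℛ k b).left i) * comul (antipode k ((ℛ k b).right i))
      = antipode k b ⊗ₜ 1 := by
  -- In the convolution algebra `i₁ * α = Δ`, the map `σ` is a left inverse of `i₁`, and `β = Δ ∘ S`
  -- is a right inverse of `Δ`. Hence `α * β = σ * (i₁ * α) * β = σ`.
  let α : WithConv (H →ₗ[k] H ⊗[k] H) := toConv (TensorProduct.mk k H H 1)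
  let β : WithConv (H →ₗ[k] H ⊗[k] H) := toConv (comul ∘ₗ antipode k)
  let σ : WithConv (H →ₗ[k] H ⊗[k] H) := toConv ((TensorProduct.mk k H H).flip 1 ∘ₗ antipode k)
  let i₁ : WithConv (H →ₗ[k] H ⊗[k] H) := toConv ((TensorProduct.mk k H H).flip 1)
  have h₁ : i₁ * α = toConv comul := by
    ext c
    rw [(ℛ k c).convMul_apply]
    simp [i₁, α, (ℛ k c).eq]
  have h₂ : σ * i₁ = 1 := by
    ext c
    rw [(ℛ k c).convMul_apply]
    simp [i₁, σ, ← TensorProduct.sum_tmul, sum_antipode_mul_eq_algebraMap_counit,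
      Algebra.TensorProduct.algebraMap_apply]
  have h₃ : α * β = σ := by
    rw [← one_mul α, ← h₂, mul_assoc σ, h₁, mul_assoc, comul_right_inv, mul_one]
  have h₅ : (α * β) b = σ b := by rw [h₃]
  rw [(ℛ k b).convMul_apply] at h₅
  exact h₅

/-- Multiply the identity `α * β = σ` of the previous lemma by the left convolution inverse `σ'` of
`α`. -/
theorem comul_antipode (b : H) :
    comul (R := k) (antipode k b) = TensorProduct.map (antipode k) (antipode k)
      (TensorProduct.comm k H H (comul b)) := by
  let α : WithConv (H →ₗ[k] H ⊗[k] H) := toConv (TensorProduct.mk k H H 1)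
  let β : WithConv (H →ₗ[k] H ⊗[k] H) := toConv (comul ∘ₗ antipode k)
  let σ : WithConv (H →ₗ[k] H ⊗[k] H) := toConv ((TensorProduct.mk k H H).flip 1 ∘ₗ antipode k)
  let σ' : WithConv (H →ₗ[k] H ⊗[k] H) := toConv (TensorProduct.mk k H H 1 ∘ₗ antipode k)
  have h₂ : σ' * α = 1 := by
    ext c
    rw [(ℛ k c).convMul_apply]
    simpa [α, σ', ← TensorProduct.tmul_sum, sum_antipode_mul_eq_algebraMap_counit] using
      (Algebra.TensorProduct.tmul_one_eq_one_tmul _).symm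
  have h₃ : α * β = σ := by
    ext c
    rw [(ℛ k c).convMul_apply]
    exact sum_tmul_mul_comul_antipode c
  have h₄ : β = σ' * σ := by rw [← h₃, ← mul_assoc, h₂, one_mul]
  have h₅ : β b = (σ' * σ) b := by rw [← h₄]
  rw [(ℛ k b).convMul_apply] at h₅
  refine h₅.trans ?_
  conv_rhs => rw [← (ℛ k b).eq]
  simp [σ, σ']

/-- `∑ (1 ⊗ b₁) Δ(S(a b₂) ς) = ∑ S(a₂ b) ς ⊗ S(a₁) ς`. -/
theorem sum_tmul_mul_comul_antipode_mul {ς : H} (hς : comul (R := k) ς = ς ⊗ₜ ς) (a b : H) :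
    ∑ i ∈ (ℛ k b).index, ((1 : H) ⊗ₜ[k] (ℛ k b).left i) *
        comul (antipode k (a * (ℛ k b).right i) * ς)
      = ∑ j ∈ (ℛ k a).index, (antipode k ((ℛ k a).right j * b) * ς) ⊗ₜ[k]
          (antipode k ((ℛ k a).left j) * ς) := by
  have h : comul (R := k) (antipode k a) = ∑ j ∈ (ℛ k a).index,
      antipode k ((ℛ k a).right j) ⊗ₜ[k] antipode k ((ℛ k a).left j) := by
    rw [comul_antipode, ← (ℛ k a).eq]
    simp only [map_sum, TensorProduct.comm_tmul, TensorProduct.map_tmul]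
  simp only [antipode_mul_antidistrib, Bialgebra.comul_mul, hς, ← mul_assoc]
  rw [← Finset.sum_mul, ← Finset.sum_mul, sum_tmul_mul_comul_antipode, h, Finset.mul_sum,
    Finset.sum_mul]
  simp [mul_assoc]

end Antipode

/-! ### The tensor algebra as a comodule algebra -/

namespace HopfTensor

open Coalgebra HopfAlgebra TensorProduct

variable {k H : Type*} [CommRing k] [Ring H] [HopfAlgebra k H]

variable (k H) in
/-- The homogeneous part of degree `n` of the tensor algebra. -/
abbrev deg (n : ℕ) : Submodule k (TensorAlgebra k H) :=
  LinearMap.range (TensorAlgebra.ι k (M := H)) ^ n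

theorem mul_mem_deg {a b n : ℕ} {x y : TensorAlgebra k H} (hx : x ∈ deg k H a)
    (hy : y ∈ deg k H b) (hn : n = a + b) : x * y ∈ deg k H n := by
  subst hn
  rw [deg, pow_add]
  exact Submodule.mul_mem_mul hx hy

theorem ι_mem_deg (h : H) : TensorAlgebra.ι k h ∈ deg k H 1 := by
  rw [deg, pow_one]
  exact ⟨h, rfl⟩

theorem one_mem_deg : (1 : TensorAlgebra k H) ∈ deg k H 0 := by
  rw [deg, pow_zero]
  exact Submodule.mem_one.2 ⟨1, map_one _⟩

/-- Two linear maps agree in degree `a + b` if they agree on products. -/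
theorem eq_of_mul {W : Type*} [AddCommGroup W] [Module k W] {φ ψ : TensorAlgebra k H →ₗ[k] W}
    {n : ℕ} (a b : ℕ) (hn : n = a + b)
    (h : ∀ x ∈ deg k H a, ∀ y ∈ deg k H b, φ (x * y) = ψ (x * y)) {w : TensorAlgebra k H}
    (hw : w ∈ deg k H n) : φ w = ψ w := by
  subst hn
  rw [deg, pow_add] at hw
  induction hw using Submodule.mul_induction_on' with
  | mem_mul_mem x hx y hy => exact h x hx y hy
  | add x _ y _ hx hy => rw [map_add, map_add, hx, hy]

theorem eq_of_ι_mul {W : Type*} [AddCommGroup W] [Module k W] {φ ψ : TensorAlgebra k H →ₗ[k] W}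
    {n : ℕ} (h : ∀ u : H, ∀ y ∈ deg k H n,
      φ (TensorAlgebra.ι k u * y) = ψ (TensorAlgebra.ι k u * y)) {w : TensorAlgebra k H}
    (hw : w ∈ deg k H (n + 1)) : φ w = ψ w := by
  refine eq_of_mul 1 n (add_comm _ _) (fun x hx y hy => ?_) hw
  rw [deg, pow_one] at hx
  obtain ⟨u, rfl⟩ := hx
  exact h u y hy

theorem eq_of_one {W : Type*} [AddCommGroup W] [Module k W] {φ ψ : TensorAlgebra k H →ₗ[k] W}
    (h : φ 1 = ψ 1) {w : TensorAlgebra k H} (hw : w ∈ deg k H 0) : φ w = ψ w := by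
  rw [deg, pow_zero, Submodule.mem_one] at hw
  obtain ⟨r, rfl⟩ := hw
  rw [Algebra.algebraMap_eq_smul_one, map_smul, map_smul, h]

theorem eq_of_mul₃ {W : Type*} [AddCommGroup W] [Module k W] {φ ψ : TensorAlgebra k H →ₗ[k] W}
    {n : ℕ} (a b c : ℕ) (hn : n = a + b + c)
    (h : ∀ x ∈ deg k H a, ∀ y ∈ deg k H b, ∀ z ∈ deg k H c, φ (x * y * z) = ψ (x * y * z))
    {w : TensorAlgebra k H} (hw : w ∈ deg k H n) : φ w = ψ w := by
  refine eq_of_mul (a + b) c hn (fun x hx z hz => ?_) hw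
  exact eq_of_mul (φ := φ ∘ₗ LinearMap.mulRight k z) (ψ := ψ ∘ₗ LinearMap.mulRight k z) a b rfl
    (fun x hx y hy => h x hx y hy z hz) hx

variable (k H) in
/-- The codiagonal coaction on the tensor algebra. -/
def coaction : TensorAlgebra k H →ₐ[k] TensorAlgebra k H ⊗[k] H :=
  TensorAlgebra.lift k ((TensorAlgebra.ι k).rTensor H ∘ₗ comul)

theorem coaction_ι (h : H) :
    coaction k H (TensorAlgebra.ι k h) = (TensorAlgebra.ι k).rTensor H (comul h) := by
  simp [coaction]

/-- Both sides are algebra homomorphisms, and on generators the claim is coassociativity of the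
coproduct. -/
theorem coaction_coassoc (x : TensorAlgebra k H) :
    TensorProduct.assoc k _ _ _ ((coaction k H).toLinearMap.rTensor H (coaction k H x))
      = (comul (R := k)).lTensor _ (coaction k H x) := by
  let φ : TensorAlgebra k H →ₐ[k] TensorAlgebra k H ⊗[k] (H ⊗[k] H) :=
    (Algebra.TensorProduct.assoc k k k (TensorAlgebra k H) H H).toAlgHom.comp
      ((Algebra.TensorProduct.map (coaction k H) (AlgHom.id k H)).comp (coaction k H))
  let ψ : TensorAlgebra k H →ₐ[k] TensorAlgebra k H ⊗[k] (H ⊗[k] H) :=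
    (Algebra.TensorProduct.map (AlgHom.id k (TensorAlgebra k H)) (Bialgebra.comulAlgHom k H)).comp
      (coaction k H)
  have h : φ = ψ := by
    ext h
    have e₁ : ∀ t : H ⊗[k] H, Algebra.TensorProduct.assoc k k k (TensorAlgebra k H) H H
        (Algebra.TensorProduct.map (coaction k H) (AlgHom.id k H)
          ((TensorAlgebra.ι k).rTensor H t))
        = (TensorAlgebra.ι k).rTensor (H ⊗[k] H)
            (TensorProduct.assoc k H H H ((comul (R := k)).rTensor H t)) := by
      intro t
      induction t with
      | zero => simp
      | add x y hx hy => simp only [map_add, hx, hy]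
      | tmul a b =>
        simp only [LinearMap.rTensor_tmul, Algebra.TensorProduct.map_tmul, coaction_ι]
        induction comul (R := k) a with
        | zero => simp
        | add x y hx hy => simp only [map_add, TensorProduct.add_tmul, hx, hy]
        | tmul c d => rfl
    have e₂ : ∀ t : H ⊗[k] H,
        Algebra.TensorProduct.map (AlgHom.id k (TensorAlgebra k H)) (Bialgebra.comulAlgHom k H)
          ((TensorAlgebra.ι k).rTensor H t)
        = (TensorAlgebra.ι k).rTensor (H ⊗[k] H) ((comul (R := k)).lTensor H t) := by
      intro t
      induction t with
      | zero => simp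
      | add x y hx hy => simp only [map_add, hx, hy]
      | tmul a b => simp
    simp only [φ, ψ, AlgHom.toLinearMap_apply, LinearMap.comp_apply, AlgHom.comp_apply, coaction_ι]
    refine (e₁ _).trans (Eq.trans ?_ (e₂ _).symm)
    rw [Coalgebra.coassoc_apply]
  exact congr($h x)

theorem coaction_counit (x : TensorAlgebra k H) :
    (counit (R := k)).lTensor _ (coaction k H x) = x ⊗ₜ 1 := by
  let φ : TensorAlgebra k H →ₐ[k] TensorAlgebra k H ⊗[k] k :=
    (Algebra.TensorProduct.map (AlgHom.id k (TensorAlgebra k H)) (Bialgebra.counitAlgHom k H)).comp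
      (coaction k H)
  have h : φ = Algebra.TensorProduct.includeLeft := by
    ext h
    have e₂ : ∀ t : H ⊗[k] H,
        Algebra.TensorProduct.map (AlgHom.id k (TensorAlgebra k H)) (Bialgebra.counitAlgHom k H)
          ((TensorAlgebra.ι k).rTensor H t)
        = (TensorAlgebra.ι k).rTensor k ((counit (R := k)).lTensor H t) := by
      intro t
      induction t with
      | zero => simp
      | add x y hx hy => simp only [map_add, hx, hy]
      | tmul a b => simp
    simp only [φ, AlgHom.toLinearMap_apply, LinearMap.comp_apply, AlgHom.comp_apply, coaction_ι]
    refine (e₂ _).trans ?_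
    rw [Coalgebra.lTensor_counit_comul]
    rfl
  exact congr($h x)

variable (k H) in
/-- The tensors whose first factor has degree `n`. -/
def tdeg (n : ℕ) : Submodule k (TensorAlgebra k H ⊗[k] H) :=
  Submodule.span k {t | ∃ x ∈ deg k H n, ∃ h : H, t = x ⊗ₜ h}

theorem tmul_mem_tdeg {n : ℕ} {x : TensorAlgebra k H} (hx : x ∈ deg k H n) (h : H) :
    x ⊗ₜ h ∈ tdeg k H n := Submodule.subset_span ⟨x, hx, h, rfl⟩

theorem tdeg_induction {n : ℕ} {W : Type*} [AddCommGroup W] [Module k W]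
    {φ ψ : TensorAlgebra k H ⊗[k] H →ₗ[k] W}
    (h : ∀ x ∈ deg k H n, ∀ a : H, φ (x ⊗ₜ a) = ψ (x ⊗ₜ a)) {X : TensorAlgebra k H ⊗[k] H}
    (hX : X ∈ tdeg k H n) : φ X = ψ X := by
  have : tdeg k H n ≤ LinearMap.eqLocus φ ψ := by
    rw [tdeg, Submodule.span_le]
    rintro _ ⟨x, hx, a, rfl⟩
    exact h x hx a
  exact this hX

theorem coaction_mem_tdeg {n : ℕ} {x : TensorAlgebra k H} (hx : x ∈ deg k H n) :
    coaction k H x ∈ tdeg k H n := by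
  induction n generalizing x with
  | zero =>
    rw [deg, pow_zero, Submodule.mem_one] at hx
    obtain ⟨r, rfl⟩ := hx
    rw [AlgHom.commutes, Algebra.TensorProduct.algebraMap_apply]
    exact tmul_mem_tdeg (by rw [deg, pow_zero, Submodule.mem_one]; exact ⟨r, rfl⟩) 1
  | succ n ih =>
    rw [deg, pow_succ'] at hx
    induction hx using Submodule.mul_induction_on' with
    | add x _ y _ hx hy => rw [map_add]; exact Submodule.add_mem _ hx hy
    | mem_mul_mem x hx y hy =>
      obtain ⟨u, rfl⟩ := hx
      rw [map_mul, coaction_ι]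
      have h := ih hy
      generalize coaction k H y = Y at h
      rw [tdeg] at h
      induction comul (R := k) u with
      | zero => simp
      | add s t hs ht => rw [map_add, add_mul]; exact Submodule.add_mem _ hs ht
      | tmul a b =>
        induction h using Submodule.span_induction with
        | zero => simp
        | add s t _ _ hs ht => rw [mul_add]; exact Submodule.add_mem _ hs ht
        | smul r s _ hs => rw [mul_smul_comm]; exact Submodule.smul_mem _ _ hs
        | mem t ht =>
          obtain ⟨z, hz, c, rfl⟩ := ht
          rw [LinearMap.rTensor_tmul, Algebra.TensorProduct.tmul_mul_tmul]
          exact tmul_mem_tdeg (mul_mem_deg (ι_mem_deg a) hz (add_comm _ _)) _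

/-- `t ⊗ h ↦ t S(h) ς`, the last factor being in degree one. -/
def absorb (ς : H) : TensorAlgebra k H ⊗[k] H →ₗ[k] TensorAlgebra k H :=
  TensorProduct.lift ((LinearMap.mul k (TensorAlgebra k H)).compl₂
    (TensorAlgebra.ι k ∘ₗ LinearMap.mulRight k ς ∘ₗ antipode k))

theorem absorb_tmul (ς : H) (t : TensorAlgebra k H) (h : H) :
    absorb ς (t ⊗ₜ[k] h) = t * TensorAlgebra.ι k (antipode k h * ς) := rfl

theorem absorb_mul (ς : H) (t : TensorAlgebra k H) (X : TensorAlgebra k H ⊗[k] H) :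
    absorb ς ((t ⊗ₜ[k] 1) * X) = t * absorb ς X := by
  induction X with
  | zero => simp
  | add x y hx hy => simp only [mul_add, map_add, hx, hy]
  | tmul a b => simp [absorb_tmul, mul_assoc]

/-- `u ↦ ∑ x₀ S(u x₁) ς`. -/
def turn (ς : H) (x : TensorAlgebra k H) : H →ₗ[k] TensorAlgebra k H :=
  absorb ς ∘ₗ LinearMap.mulRight k (coaction k H x) ∘ₗ TensorProduct.mk k _ H 1

theorem turn_apply (ς : H) (x : TensorAlgebra k H) (u : H) :
    turn ς x u = absorb ς ((1 ⊗ₜ[k] u) * coaction k H x) := rfl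

/-- Coassociativity replaces the coaction on `x₀` by the coproduct of the coefficient `x₁`. The leg
next to `Δ(S(u ·) ς)` then collapses by `sum_tmul_mul_comul_antipode_mul`, and only the coproduct of
`u` remains, with its legs exchanged. The compatibility of `τ` with itself and with composition uses
this formula. -/
theorem coaction_turn {ς : H} (hς : comul (R := k) ς = ς ⊗ₜ ς) (x : TensorAlgebra k H) (u : H) :
    coaction k H (turn ς x u) = TensorProduct.map (turn ς x) (LinearMap.mulRight k ς ∘ₗ antipode k)
      (TensorProduct.comm k H H (comul u)) := by
  let Ξ : (TensorAlgebra k H ⊗[k] H) ⊗[k] H →ₗ[k] TensorAlgebra k H ⊗[k] H :=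
    TensorProduct.lift ((LinearMap.mul k (TensorAlgebra k H ⊗[k] H)).compl₂
      ((TensorAlgebra.ι k).rTensor H ∘ₗ comul ∘ₗ LinearMap.mulRight k ς ∘ₗ antipode k
        ∘ₗ LinearMap.mulLeft k u))
  have hΞ : ∀ Y h, Ξ (Y ⊗ₜ h)
      = Y * (TensorAlgebra.ι k).rTensor H (comul (antipode k (u * h) * ς)) := fun _ _ => rfl
  have h₁ : ∀ Z : TensorAlgebra k H ⊗[k] H, coaction k H (absorb ς ((1 ⊗ₜ[k] u) * Z))
      = Ξ ((coaction k H).toLinearMap.rTensor H Z) := by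
    intro Z
    induction Z with
    | zero => simp
    | add x y hx hy => simp only [mul_add, map_add, hx, hy]
    | tmul t h =>
      rw [Algebra.TensorProduct.tmul_mul_tmul, absorb_tmul, map_mul, coaction_ι,
        LinearMap.rTensor_tmul, hΞ, one_mul]
      rfl
  have h₂ : ∀ Z : TensorAlgebra k H ⊗[k] H,
      Ξ ((TensorProduct.assoc k _ _ _).symm ((comul (R := k)).lTensor _ Z))
      = TensorProduct.map (absorb ς ∘ₗ LinearMap.mulRight k Z ∘ₗ TensorProduct.mk k _ H 1)
        (LinearMap.mulRight k ς ∘ₗ antipode k) (TensorProduct.comm k H H (comul u)) := by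
    intro Z
    induction Z with
    | zero =>
      have : LinearMap.mulRight k (0 : TensorAlgebra k H ⊗[k] H) = 0 := by ext; simp
      simp [this]
    | add x y hx hy =>
      have : LinearMap.mulRight k (x + y)
          = LinearMap.mulRight k x + LinearMap.mulRight k y := by ext; simp [mul_add]
      simp only [map_add, hx, hy, this, LinearMap.comp_add, LinearMap.add_comp,
        TensorProduct.map_add_left, LinearMap.add_apply]
    | tmul t b =>
      have key := congrArg (fun w => (t ⊗ₜ[k] (1 : H)) * (TensorAlgebra.ι k).rTensor H w)
        (sum_tmul_mul_comul_antipode_mul hς u b)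
      have e : ∀ (c : H) (w : H ⊗[k] H), (t ⊗ₜ[k] (1 : H)) *
          (TensorAlgebra.ι k).rTensor H (((1 : H) ⊗ₜ[k] c) * w)
          = (t ⊗ₜ[k] c) * (TensorAlgebra.ι k).rTensor H w := by
        intro c w
        induction w with
        | zero => simp
        | add x y hx hy => simp only [mul_add, map_add, hx, hy]
        | tmul a b => simp
      rw [LinearMap.lTensor_tmul, ← (ℛ k b).eq]
      conv_rhs => rw [← (ℛ k u).eq]
      simp only [TensorProduct.tmul_sum, map_sum, TensorProduct.assoc_symm_tmul, hΞ,
        Finset.mul_sum, e] at key ⊢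
      rw [key]
      refine Finset.sum_congr rfl fun i _ => ?_
      simp [absorb_tmul]
  rw [turn_apply, h₁]
  have h₃ := coaction_coassoc x
  rw [← LinearEquiv.eq_symm_apply] at h₃
  rw [h₃, h₂]
  rfl

end HopfTensor

/-! ### Cochains as functionals on the tensor algebra -/

namespace HopfTensor

open Coalgebra HopfAlgebra TensorProduct

variable {k H : Type*} [CommRing k] [Ring H] [HopfAlgebra k H]

theorem tprod_succ {n : ℕ} (u : Fin (n + 1) → H) : TensorAlgebra.tprod k H (n + 1) u
    = TensorAlgebra.ι k (u 0) * TensorAlgebra.tprod k H n (Fin.tail u) := by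
  simp [List.ofFn_succ, Fin.tail]

theorem tprod_cons {n : ℕ} (h : H) (u : Fin n → H) :
    TensorAlgebra.tprod k H (n + 1) (Fin.cons h u : Fin (n + 1) → H)
      = TensorAlgebra.ι k h * TensorAlgebra.tprod k H n u := by
  rw [tprod_succ, Fin.cons_zero, Fin.tail_cons]

theorem tprod_snoc {n : ℕ} (u : Fin n → H) (h : H) :
    TensorAlgebra.tprod k H (n + 1) (Fin.snoc u h : Fin (n + 1) → H)
      = TensorAlgebra.tprod k H n u * TensorAlgebra.ι k h := by
  rw [TensorAlgebra.tprod_apply, List.ofFn_succ']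
  simp

theorem tprod_mem_deg {n : ℕ} (u : Fin n → H) : TensorAlgebra.tprod k H n u ∈ deg k H n := by
  induction n with
  | zero =>
    rw [TensorAlgebra.tprod_apply, List.ofFn_zero, List.prod_nil]
    exact one_mem_deg
  | succ n ih =>
    rw [tprod_succ]
    exact mul_mem_deg (ι_mem_deg _) (ih _) (add_comm _ _)

theorem eq_of_tprod {W : Type*} [AddCommGroup W] [Module k W] {φ ψ : TensorAlgebra k H →ₗ[k] W}
    {n : ℕ} (h : ∀ u, φ (TensorAlgebra.tprod k H n u) = ψ (TensorAlgebra.tprod k H n u))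
    {w : TensorAlgebra k H} (hw : w ∈ deg k H n) : φ w = ψ w := by
  induction n generalizing φ ψ w with
  | zero => exact eq_of_one (by simpa using h Fin.elim0) hw
  | succ n ih =>
    refine eq_of_ι_mul (fun u y hy => ?_) hw
    refine ih (φ := φ ∘ₗ LinearMap.mulLeft k (TensorAlgebra.ι k u))
      (ψ := ψ ∘ₗ LinearMap.mulLeft k (TensorAlgebra.ι k u)) (fun v => ?_) hy
    have := h (Fin.cons u v)
    rwa [tprod_cons] at this

section Split

variable {N : Type*} [AddCommGroup N] [Module k N]

theorem sweedlerSplit_succ (δ : H →ₗ[k] H ⊗[k] H) (μ : H →ₗ[k] H →ₗ[k] H) {n : ℕ}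
    (F : Cochain k H N (n + 1)) (u : Fin (n + 1) → H) :
    sweedlerSplit δ μ (n + 1) F u = TensorProduct.lift
      ((actSnd μ n ∘ₗ sweedlerSplit δ μ n) ∘ₗ F.curryLeft) (δ (u 0)) (Fin.tail u) := rfl

/-- The recursion defining `sweedlerSplit` is multiplicativity of the coaction on a product with a
generator. Any linear extension `φ` of `F` is allowed, because the induction replaces `φ` by its
composite with a left multiplication. -/
theorem sweedlerSplit_comul {n : ℕ} (F : Cochain k H N n) (φ : TensorAlgebra k H →ₗ[k] N)
    (h : ∀ v, φ (TensorAlgebra.tprod k H n v) = F v) (u : Fin n → H) :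
    sweedlerSplit comul (LinearMap.mul k H) n F u
      = φ.rTensor H (coaction k H (TensorAlgebra.tprod k H n u)) := by
  induction n generalizing φ with
  | zero =>
    rw [TensorAlgebra.tprod_apply, List.ofFn_zero, List.prod_nil, map_one,
      Algebra.TensorProduct.one_def, LinearMap.rTensor_tmul]
    have := h u
    rw [TensorAlgebra.tprod_apply, List.ofFn_zero, List.prod_nil] at this
    rw [this]
    rfl
  | succ n ih =>
    rw [sweedlerSplit_succ, tprod_succ, map_mul, coaction_ι]
    induction comul (R := k) (u 0) with
    | zero => simp
    | add x y hx hy => simp only [map_add, add_mul, _root_.add_apply, hx, hy]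
    | tmul a b =>
      have e := ih (F.curryLeft a) (φ ∘ₗ LinearMap.mulLeft k (TensorAlgebra.ι k a)) (fun v => by
        rw [LinearMap.comp_apply, LinearMap.mulLeft_apply, ← tprod_cons, h]; rfl) (Fin.tail u)
      have e' : TensorProduct.lift ((actSnd (LinearMap.mul k H) n ∘ₗ
          sweedlerSplit comul (LinearMap.mul k H) n) ∘ₗ F.curryLeft) (a ⊗ₜ[k] b) (Fin.tail u)
          = (LinearMap.mul k H b).lTensor N
            (sweedlerSplit comul (LinearMap.mul k H) n (F.curryLeft a) (Fin.tail u)) := rfl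
      rw [e', e, LinearMap.rTensor_tmul]
      induction coaction k H (TensorAlgebra.tprod k H n (Fin.tail u)) with
      | zero => simp
      | add x y hx hy => simp only [map_add, mul_add, hx, hy]
      | tmul c d => simp

/-- As for the coproduct; the reversed product in the second tensor factor matches the
antimultiplicativity of `S`. -/
theorem sweedlerSplit_translation {n : ℕ} (F : Cochain k H N n) (φ : TensorAlgebra k H →ₗ[k] N)
    (h : ∀ v, φ (TensorAlgebra.tprod k H n v) = F v) (u : Fin n → H) :
    sweedlerSplit (translation k) (LinearMap.mul k H).flip n F u
      = TensorProduct.map φ (antipode k) (coaction k H (TensorAlgebra.tprod k H n u)) := by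
  induction n generalizing φ with
  | zero =>
    rw [TensorAlgebra.tprod_apply, List.ofFn_zero, List.prod_nil, map_one,
      Algebra.TensorProduct.one_def, TensorProduct.map_tmul, antipode_one]
    have := h u
    rw [TensorAlgebra.tprod_apply, List.ofFn_zero, List.prod_nil] at this
    rw [this]
    rfl
  | succ n ih =>
    have ht : translation k (u 0) = (antipode k).lTensor H (comul (u 0)) := rfl
    rw [sweedlerSplit_succ, tprod_succ, map_mul, coaction_ι, ht]
    induction comul (R := k) (u 0) with
    | zero => simp
    | add x y hx hy => simp only [map_add, add_mul, _root_.add_apply, hx, hy]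
    | tmul a b =>
      have e := ih (F.curryLeft a) (φ ∘ₗ LinearMap.mulLeft k (TensorAlgebra.ι k a)) (fun v => by
        rw [LinearMap.comp_apply, LinearMap.mulLeft_apply, ← tprod_cons, h]; rfl) (Fin.tail u)
      have e' : TensorProduct.lift ((actSnd (LinearMap.mul k H).flip n ∘ₗ
          sweedlerSplit (translation k) (LinearMap.mul k H).flip n) ∘ₗ F.curryLeft)
            ((antipode k).lTensor H (a ⊗ₜ[k] b)) (Fin.tail u)
          = ((LinearMap.mul k H).flip (antipode k b)).lTensor N
            (sweedlerSplit (translation k) (LinearMap.mul k H).flip n (F.curryLeft a)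
              (Fin.tail u)) := rfl
      rw [e', e, LinearMap.rTensor_tmul]
      induction coaction k H (TensorAlgebra.tprod k H n (Fin.tail u)) with
      | zero => simp
      | add x y hx hy => simp only [map_add, mul_add, hx, hy]
      | tmul c d => simp [antipode_mul_antidistrib]

/-- The linear map on the tensor algebra that restricts to a given multilinear map in degree
`n`. -/
def hat {n : ℕ} : Cochain k H N n →ₗ[k] TensorAlgebra k H →ₗ[k] N :=
  (LinearMap.lcomp k N (DirectSum.component k ℕ (fun n => ⨂[k]^n H) n
    ∘ₗ (TensorAlgebra.toDirectSum (R := k) (M := H)).toLinearMap))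
    ∘ₗ (PiTensorProduct.lift (R := k) (s := fun _ : Fin n => H) (E := N)).toLinearMap

theorem hat_tprod {n : ℕ} (F : Cochain k H N n) (u : Fin n → H) :
    hat F (TensorAlgebra.tprod k H n u) = F u := by
  have : TensorAlgebra.toDirectSum (TensorAlgebra.tprod k H n u)
      = DirectSum.lof k ℕ (fun n => ⨂[k]^n H) n (PiTensorProduct.tprod k u) :=
    TensorAlgebra.toDirectSum_tensorPower_tprod u
  simp only [hat, LinearMap.comp_apply, LinearMap.lcomp_apply, AlgHom.toLinearMap_apply, this,
    DirectSum.component.lof_self]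
  exact PiTensorProduct.lift.tprod u

end Split

/-- The `k`-valued linear map on the tensor algebra given by a cochain. -/
def ev {n : ℕ} (f : Cochain k H (CounitModule k H) n) : TensorAlgebra k H →ₗ[k] k :=
  (CounitModule.toBase k H).toLinearMap ∘ₗ hat f

theorem ev_tprod {n : ℕ} (f : Cochain k H (CounitModule k H) n) (u : Fin n → H) :
    ev f (TensorAlgebra.tprod k H n u) = CounitModule.toBase k H (f u) := by
  rw [ev, LinearMap.comp_apply, hat_tprod]
  rfl

theorem ev_add {n : ℕ} (f g : Cochain k H (CounitModule k H) n) : ev (f + g) = ev f + ev g := by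
  rw [ev, map_add, LinearMap.comp_add]
  rfl

theorem ev_smul {n : ℕ} (r : k) (f : Cochain k H (CounitModule k H) n) :
    ev (r • f) = r • ev f := by
  rw [ev, map_smul, LinearMap.comp_smul]
  rfl

theorem ev_ext {n : ℕ} {f g : Cochain k H (CounitModule k H) n}
    (h : ∀ x ∈ deg k H n, ev f x = ev g x) : f = g := by
  ext u
  have := h _ (tprod_mem_deg u)
  rw [ev_tprod, ev_tprod] at this
  exact (CounitModule.toBase k H).injective this

theorem ev_eq_of_tprod {n : ℕ} {f : Cochain k H (CounitModule k H) n}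
    {φ : TensorAlgebra k H →ₗ[k] k} (h : ∀ u, CounitModule.toBase k H (f u) = φ (TensorAlgebra.tprod k H n u))
    {x : TensorAlgebra k H} (hx : x ∈ deg k H n) : ev f x = φ x :=
  eq_of_tprod (fun u => by rw [ev_tprod, h]) hx

/-- The linear extension of `coactionMap`: `x ↦ g(x₀) x₁`. -/
def coev {n : ℕ} (g : Cochain k H (CounitModule k H) n) : TensorAlgebra k H →ₗ[k] H :=
  (TensorProduct.lid k H).toLinearMap ∘ₗ (ev g).rTensor H ∘ₗ (coaction k H).toLinearMap

theorem coev_apply {n : ℕ} (g : Cochain k H (CounitModule k H) n) (x : TensorAlgebra k H) :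
    coev g x = TensorProduct.lid k H ((ev g).rTensor H (coaction k H x)) := rfl

theorem coev_tprod {n : ℕ} (g : Cochain k H (CounitModule k H) n) (u : Fin n → H) :
    coev g (TensorAlgebra.tprod k H n u) = coactionMap g u := by
  rw [coactionMap, LinearMap.compMultilinearMap_apply, sweedlerSplit_comul g (hat g) (hat_tprod g),
    coev_apply, LinearMap.comp_apply, ev, LinearMap.rTensor_comp]
  rfl

/-- The map `x ↦ g(x₀) x₁` is colinear. Associativity of nested compositions depends on this. -/
theorem comul_coev {n : ℕ} (g : Cochain k H (CounitModule k H) n) (x : TensorAlgebra k H) :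
    comul (R := k) (coev g x) = (coev g).rTensor H (coaction k H x) := by
  have h₁ : ∀ Z : TensorAlgebra k H ⊗[k] H, comul (R := k)
      (TensorProduct.lid k H ((ev g).rTensor H Z)) = TensorProduct.lid k (H ⊗[k] H)
        ((ev g).rTensor (H ⊗[k] H) ((comul (R := k)).lTensor _ Z)) := by
    intro Z
    induction Z with
    | zero => simp
    | add x y hx hy => simp only [map_add, hx, hy]
    | tmul a b => simp
  have h₂ : ∀ Z : TensorAlgebra k H ⊗[k] H, TensorProduct.lid k (H ⊗[k] H)
        ((ev g).rTensor (H ⊗[k] H) (TensorProduct.assoc k _ _ _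
          ((coaction k H).toLinearMap.rTensor H Z))) = (coev g).rTensor H Z := by
    intro Z
    induction Z with
    | zero => simp
    | add x y hx hy => simp only [map_add, hx, hy]
    | tmul a b =>
      simp only [LinearMap.rTensor_tmul, coev_apply, AlgHom.toLinearMap_apply]
      induction coaction k H a with
      | zero => simp
      | add x y hx hy => simp only [map_add, TensorProduct.add_tmul, hx, hy]
      | tmul c d => simp [TensorProduct.smul_tmul']
  rw [coev_apply, h₁, ← coaction_coassoc, h₂]

theorem counit_coev {n : ℕ} (g : Cochain k H (CounitModule k H) n) (x : TensorAlgebra k H) :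
    counit (R := k) (coev g x) = ev g x := by
  have h₁ : ∀ Z : TensorAlgebra k H ⊗[k] H, counit (R := k)
      (TensorProduct.lid k H ((ev g).rTensor H Z)) = TensorProduct.lid k k
        ((ev g).rTensor k ((counit (R := k)).lTensor _ Z)) := by
    intro Z
    induction Z with
    | zero => simp
    | add x y hx hy => simp only [map_add, hx, hy]
    | tmul a b => simp
  rw [coev_apply, h₁, coaction_counit]
  simp

theorem coaction_ι_coev {n : ℕ} (g : Cochain k H (CounitModule k H) n) (x : TensorAlgebra k H) :
    coaction k H (TensorAlgebra.ι k (coev g x))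
      = (TensorAlgebra.ι k ∘ₗ coev g).rTensor H (coaction k H x) := by
  rw [coaction_ι, comul_coev, LinearMap.rTensor_comp]
  rfl

/-- Concatenating three argument blocks is multiplying their tensors, so inserting a value at a
position becomes replacing the middle factor of a triple product. -/
theorem tprod_insertArgs {p q n s r : ℕ} (hn : n + 1 = p + q) (hs : s + 1 + r = p)
    (G : (Fin q → H) → H) (a : Fin s → H) (b : Fin q → H) (c : Fin r → H) :
    ∃ u : Fin n → H,
      TensorAlgebra.tprod k H n u = TensorAlgebra.tprod k H s a * TensorAlgebra.tprod k H q b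
        * TensorAlgebra.tprod k H r c ∧
      TensorAlgebra.tprod k H p (insertArgs hn ⟨s, by omega⟩ G u)
        = TensorAlgebra.tprod k H s a * TensorAlgebra.ι k (G b) * TensorAlgebra.tprod k H r c := by
  let u : Fin n → H := fun j => if h : j.val < s then a ⟨j, h⟩
    else if h' : j.val < s + q then b ⟨j - s, by omega⟩ else c ⟨j - s - q, by have := j.2; omega⟩
  have e : ∀ (m : ℕ) (v : Fin m → H), TensorAlgebra.tprod k H m v
      = ((List.ofFn v).map (TensorAlgebra.ι k)).prod := fun m v => by
    rw [TensorAlgebra.tprod_apply, List.map_ofFn]; rfl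
  have hb : (fun l : Fin q => u ⟨s + l.val, by have := l.2; omega⟩) = b := by
    funext l
    have := l.2
    simp only [u]
    rw [dif_neg (by omega), dif_pos (by omega)]
    congr 1
    ext
    simp
  have e₁ : List.ofFn u = List.ofFn a ++ List.ofFn b ++ List.ofFn c := by
    refine List.ext_getElem (by simp; omega) fun i h₁ h₂ => ?_
    simp only [List.getElem_ofFn, List.getElem_append, List.length_append, List.length_ofFn, u]
    split_ifs <;> first | rfl | omega | (congr 1; ext; simp; omega)
  have e₂ : List.ofFn (insertArgs hn ⟨s, by omega⟩ G u) = List.ofFn a ++ [G b] ++ List.ofFn c := by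
    refine List.ext_getElem (by simp; omega) fun i h₁ h₂ => ?_
    simp only [List.getElem_ofFn, List.getElem_append, List.length_append, List.length_ofFn,
      List.length_singleton, insertArgs, hb]
    split_ifs <;> first | rfl | omega | skip
    · simp only [u]; rw [dif_pos (by assumption)]
    · simp
    · simp only [u]
      rw [dif_neg (by omega), dif_neg (by omega)]
      congr 1
      ext
      simp
      omega
  refine ⟨u, ?_, ?_⟩
  · simp only [e, e₁, List.map_append, List.prod_append]
  · simp only [e, e₂, List.map_append, List.prod_append, List.map_singleton, List.prod_singleton]

theorem ev_insertAt {p q n s r : ℕ} (hn : n + 1 = p + q) (hs : s + 1 + r = p)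
    (G : MultilinearMap k (fun _ : Fin q => H) H) (φ : TensorAlgebra k H →ₗ[k] H)
    (hφ : ∀ v, φ (TensorAlgebra.tprod k H q v) = G v)
    (f : Cochain k H (CounitModule k H) p) {x y z : TensorAlgebra k H} (hx : x ∈ deg k H s)
    (hy : y ∈ deg k H q) (hz : z ∈ deg k H r) :
    ev (insertAt hn ⟨s, by omega⟩ G f) (x * y * z) = ev f (x * TensorAlgebra.ι k (φ y) * z) := by
  set F := insertAt hn ⟨s, by omega⟩ G f
  refine eq_of_tprod (φ := ev F ∘ₗ LinearMap.mulLeft k (x * y))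
    (ψ := ev f ∘ₗ LinearMap.mulLeft k (x * TensorAlgebra.ι k (φ y))) (fun c => ?_) hz
  refine eq_of_tprod (φ := ev F ∘ₗ LinearMap.mulRight k (TensorAlgebra.tprod k H r c)
      ∘ₗ LinearMap.mulLeft k x)
    (ψ := ev f ∘ₗ LinearMap.mulRight k (TensorAlgebra.tprod k H r c) ∘ₗ LinearMap.mulLeft k x
      ∘ₗ TensorAlgebra.ι k ∘ₗ φ) (fun b => ?_) hy
  refine eq_of_tprod (φ := ev F ∘ₗ LinearMap.mulRight k (TensorAlgebra.tprod k H r c)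
      ∘ₗ LinearMap.mulRight k (TensorAlgebra.tprod k H q b))
    (ψ := ev f ∘ₗ LinearMap.mulRight k (TensorAlgebra.tprod k H r c) ∘ₗ LinearMap.mulRight k
      (TensorAlgebra.ι k (φ (TensorAlgebra.tprod k H q b)))) (fun a => ?_) hx
  simp only [LinearMap.comp_apply, LinearMap.mulRight_apply]
  obtain ⟨u, h₁, h₂⟩ := tprod_insertArgs (k := k) hn hs G a b c
  rw [← h₁, hφ, ← h₂, ev_tprod, ev_tprod]
  rfl

/-- Slots are counted from the last argument, so the index `r` of the slot is the degree of the
factor `z` standing behind the insertion. -/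
theorem ev_operadComp {p q n s r : ℕ} (hn : n + 1 = p + q) (hr : r < p) (hs : s + 1 + r = p)
    (f : Cochain k H (CounitModule k H) p) (g : Cochain k H (CounitModule k H) q)
    {x y z : TensorAlgebra k H} (hx : x ∈ deg k H s) (hy : y ∈ deg k H q) (hz : z ∈ deg k H r) :
    ev (operadComp hn ⟨r, hr⟩ f g) (x * y * z)
      = ev f (x * TensorAlgebra.ι k (coev g y) * z) := by
  have : (⟨r, hr⟩ : Fin p).rev = ⟨s, by omega⟩ := by
    ext
    rw [Fin.val_rev]
    simp only
    omega
  rw [operadComp, this]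
  exact ev_insertAt hn hs _ (coev g) (coev_tprod g) f hx hy hz

end HopfTensor

/-! ### The operad axioms for cochains -/

namespace HopfTensor

open Coalgebra HopfAlgebra TensorProduct

variable {k H : Type*} [CommRing k] [Ring H] [HopfAlgebra k H]

theorem coev_add {n : ℕ} (f g : Cochain k H (CounitModule k H) n) :
    coev (f + g) = coev f + coev g := by
  rw [coev, ev_add, LinearMap.rTensor_add, LinearMap.add_comp, LinearMap.comp_add]
  rfl

theorem coev_smul {n : ℕ} (r : k) (f : Cochain k H (CounitModule k H) n) :
    coev (r • f) = r • coev f := by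
  rw [coev, ev_smul, LinearMap.rTensor_smul, LinearMap.smul_comp, LinearMap.comp_smul]
  rfl

/-- Cochains agree if they agree on triple products. -/
theorem ev_ext₃ {n : ℕ} {f g : Cochain k H (CounitModule k H) n} (a b c : ℕ) (hn : n = a + b + c)
    (h : ∀ x ∈ deg k H a, ∀ y ∈ deg k H b, ∀ z ∈ deg k H c,
      ev f (x * y * z) = ev g (x * y * z)) : f = g :=
  ev_ext fun _ hw => eq_of_mul₃ a b c hn h hw

/-- Cochains agree if they agree on fivefold products. -/
theorem ev_ext₅ {n : ℕ} {f g : Cochain k H (CounitModule k H) n} (a b c d e : ℕ)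
    (hn : n = a + b + c + d + e)
    (h : ∀ x ∈ deg k H a, ∀ y ∈ deg k H b, ∀ z ∈ deg k H c, ∀ v ∈ deg k H d, ∀ w ∈ deg k H e,
      ev f (x * y * z * v * w) = ev g (x * y * z * v * w)) : f = g :=
  ev_ext₃ (a + b + c) d e hn fun _ hx v hv w hw =>
    eq_of_mul₃ (φ := ev f ∘ₗ LinearMap.mulRight k w ∘ₗ LinearMap.mulRight k v)
      (ψ := ev g ∘ₗ LinearMap.mulRight k w ∘ₗ LinearMap.mulRight k v) a b c rfl
      (fun x hx y hy z hz => h x hx y hy z hz v hv w hw) hx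

/-- Partial composition, linear in both arguments and extended by zero. -/
def comp {p q : ℕ} (n i : ℕ) : Cochain k H (CounitModule k H) p →ₗ[k]
    Cochain k H (CounitModule k H) q →ₗ[k] Cochain k H (CounitModule k H) n :=
  if h : n + 1 = p + q ∧ i < p then
    LinearMap.mk₂ k (fun f g => operadComp h.1 ⟨i, h.2⟩ f g)
      (fun f f' g => map_add _ f f')
      (fun r f g => map_smul _ r f)
      (fun f g g' => ev_ext₃ (p - 1 - i) q i (by omega) fun x hx y hy z hz => by
        rw [ev_add, LinearMap.add_apply, ev_operadComp _ _ (by omega) _ _ hx hy hz,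
          ev_operadComp _ _ (by omega) _ _ hx hy hz, ev_operadComp _ _ (by omega) _ _ hx hy hz,
          coev_add, LinearMap.add_apply, map_add, mul_add, add_mul, map_add])
      (fun r f g => ev_ext₃ (p - 1 - i) q i (by omega) fun x hx y hy z hz => by
        rw [ev_smul, LinearMap.smul_apply, ev_operadComp _ _ (by omega) _ _ hx hy hz,
          ev_operadComp _ _ (by omega) _ _ hx hy hz,
          coev_smul, LinearMap.smul_apply, map_smul, mul_smul_comm, smul_mul_assoc, map_smul])
  else 0

theorem comp_eq {p q n i : ℕ} (hn : n + 1 = p + q) (hi : i < p)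
    (f : Cochain k H (CounitModule k H) p) (g : Cochain k H (CounitModule k H) q) :
    comp n i f g = operadComp hn ⟨i, hi⟩ f g := by
  rw [comp, dif_pos ⟨hn, hi⟩]
  rfl

theorem ev_comp {p q n s r : ℕ} (hn : n + 1 = p + q) (hs : s + 1 + r = p)
    (f : Cochain k H (CounitModule k H) p) (g : Cochain k H (CounitModule k H) q)
    {x y z : TensorAlgebra k H} (hx : x ∈ deg k H s) (hy : y ∈ deg k H q) (hz : z ∈ deg k H r) :
    ev (comp n r f g) (x * y * z) = ev f (x * TensorAlgebra.ι k (coev g y) * z) := by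
  rw [comp_eq hn (by omega), ev_operadComp hn _ hs f g hx hy hz]

/-- The composition formula on tensors with coefficients. -/
theorem ev_comp_rTensor {p q n s r : ℕ} (hn : n + 1 = p + q) (hs : s + 1 + r = p)
    (f : Cochain k H (CounitModule k H) p) (g : Cochain k H (CounitModule k H) q)
    {X Y Z : TensorAlgebra k H ⊗[k] H} (hX : X ∈ tdeg k H s) (hY : Y ∈ tdeg k H q)
    (hZ : Z ∈ tdeg k H r) :
    (ev (comp n r f g)).rTensor H (X * Y * Z)
      = (ev f).rTensor H (X * (TensorAlgebra.ι k ∘ₗ coev g).rTensor H Y * Z) := by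
  refine tdeg_induction (φ := (ev (comp n r f g)).rTensor H ∘ₗ LinearMap.mulLeft k (X * Y))
    (ψ := (ev f).rTensor H ∘ₗ LinearMap.mulLeft k
      (X * (TensorAlgebra.ι k ∘ₗ coev g).rTensor H Y)) (fun z hz c => ?_) hZ
  simp only [LinearMap.comp_apply, LinearMap.mulLeft_apply]
  refine tdeg_induction (φ := (ev (comp n r f g)).rTensor H ∘ₗ LinearMap.mulRight k (z ⊗ₜ c)
      ∘ₗ LinearMap.mulLeft k X)
    (ψ := (ev f).rTensor H ∘ₗ LinearMap.mulRight k (z ⊗ₜ c) ∘ₗ LinearMap.mulLeft k X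
      ∘ₗ (TensorAlgebra.ι k ∘ₗ coev g).rTensor H) (fun y hy b => ?_) hY
  simp only [LinearMap.comp_apply, LinearMap.mulLeft_apply, LinearMap.mulRight_apply,
    LinearMap.rTensor_tmul]
  refine tdeg_induction (φ := (ev (comp n r f g)).rTensor H ∘ₗ LinearMap.mulRight k (z ⊗ₜ c)
      ∘ₗ LinearMap.mulRight k (y ⊗ₜ b))
    (ψ := (ev f).rTensor H ∘ₗ LinearMap.mulRight k (z ⊗ₜ c) ∘ₗ LinearMap.mulRight k
      (TensorAlgebra.ι k (coev g y) ⊗ₜ b)) (fun x hx a => ?_) hX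
  simp only [LinearMap.comp_apply, LinearMap.mulRight_apply,
    Algebra.TensorProduct.tmul_mul_tmul, LinearMap.rTensor_tmul]
  rw [ev_comp hn hs f g hx hy hz]

/-- The composition formula survives in its `H`-valued form because the coaction is multiplicative
and passes through the inserted element by colinearity. -/
theorem coev_comp {p q n s r : ℕ} (hn : n + 1 = p + q) (hs : s + 1 + r = p)
    (f : Cochain k H (CounitModule k H) p) (g : Cochain k H (CounitModule k H) q)
    {x y z : TensorAlgebra k H} (hx : x ∈ deg k H s) (hy : y ∈ deg k H q) (hz : z ∈ deg k H r) :
    coev (comp n r f g) (x * y * z) = coev f (x * TensorAlgebra.ι k (coev g y) * z) := by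
  simp only [coev_apply (comp n r f g), coev_apply f, map_mul (coaction k H), coaction_ι_coev]
  rw [ev_comp_rTensor hn hs f g (coaction_mem_tdeg hx) (coaction_mem_tdeg hy)
      (coaction_mem_tdeg hz)]

/-- On a fivefold product `x y z v w` both sides evaluate `f` with `y z v` replaced by the value of
`g`, in which `z` has first been replaced by the value of `h`. `coev_comp` identifies the value of
the nested composite. -/
theorem comp_seq {p q r m l n i j : ℕ} (f : Cochain k H (CounitModule k H) p)
    (g : Cochain k H (CounitModule k H) q) (h : Cochain k H (CounitModule k H) r) (hi : i < p)
    (hj : j < q) (hm : m + 1 = q + r) (hl : l + 1 = p + q) (hn : n + 1 = p + m) :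
    comp n i f (comp m j g h) = comp n (i + j) (comp l i f g) h := by
  refine ev_ext₅ (p - 1 - i) (q - 1 - j) r j i (by omega) fun x hx y hy z hz v hv w hw => ?_
  have e₁ := ev_comp (n := n) (by omega) (by omega : p - 1 - i + 1 + i = p) f (comp m j g h) hx
    (mul_mem_deg (mul_mem_deg hy hz rfl) hv (by omega)) hw
  have e₂ := ev_comp (n := n) (by omega) (by omega : (p - 1 - i) + (q - 1 - j) + 1 + (i + j) = l)
    (comp l i f g) h (mul_mem_deg hx hy rfl) hz (mul_mem_deg hv hw (add_comm _ _))
  have e₃ := ev_comp (n := l) (by omega) (by omega : p - 1 - i + 1 + i = p) f g hx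
    (mul_mem_deg (mul_mem_deg hy (ι_mem_deg (coev h z)) rfl) hv (by omega)) hw
  rw [coev_comp hm (by omega) g h hy hz hv] at e₁
  simp only [mul_assoc] at e₁ e₂ e₃ ⊢
  rw [e₁, e₂, e₃]

theorem comp_par {p q r l l' n i j j' : ℕ} (f : Cochain k H (CounitModule k H) p)
    (g : Cochain k H (CounitModule k H) q) (h : Cochain k H (CounitModule k H) r) (hij : i < j)
    (hj : j < p) (hl : l + 1 = p + r) (hl' : l' + 1 = p + q) (hn : n + 1 = l + q)
    (hj' : j' + 1 = j + q) :
    comp n i (comp l j f h) g = comp n j' (comp l' i f g) h := by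
  refine ev_ext₅ (p - 1 - j) r (j - i - 1) q i (by omega) fun x hx y hy z hz v hv w hw => ?_
  have e₁ := ev_comp (n := n) (s := p - 1 - j + r + (j - i - 1)) (by omega) (by omega)
    (comp l j f h) g (mul_mem_deg (mul_mem_deg hx hy rfl) hz rfl) hv hw
  have e₂ := ev_comp (n := n) (r := j') (by omega) (by omega) (comp l' i f g) h hx hy
    (mul_mem_deg (mul_mem_deg hz hv rfl) hw (by omega))
  have e₃ := ev_comp (n := l) (r := j) (by omega) (by omega) f h hx hy
    (mul_mem_deg (mul_mem_deg hz (ι_mem_deg (coev g v)) rfl) hw (by omega))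
  have e₄ := ev_comp (n := l') (s := p - 1 - j + 1 + (j - i - 1)) (by omega) (by omega) f g
    (mul_mem_deg (mul_mem_deg hx (ι_mem_deg (coev h y)) rfl) hz rfl) hv hw
  simp only [mul_assoc] at e₁ e₂ e₃ e₄ ⊢
  rw [e₁, e₂, e₃, e₄]

variable (k H) in
/-- The augmentation of the tensor algebra induced by the counit. -/
def aug : TensorAlgebra k H →ₐ[k] k := TensorAlgebra.lift k (counit (R := k) (A := H))

theorem aug_ι (h : H) : aug k H (TensorAlgebra.ι k h) = counit h := by simp [aug]

variable (k H) in
/-- The product of the entries. -/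
def total : TensorAlgebra k H →ₐ[k] H := TensorAlgebra.lift k LinearMap.id

theorem total_ι (h : H) : total k H (TensorAlgebra.ι k h) = h := by simp [total]

theorem lid_aug_coaction (x : TensorAlgebra k H) :
    TensorProduct.lid k H ((aug k H).toLinearMap.rTensor H (coaction k H x)) = total k H x := by
  let φ : TensorAlgebra k H →ₐ[k] H := (Algebra.TensorProduct.lid k H).toAlgHom.comp
    ((Algebra.TensorProduct.map (aug k H) (AlgHom.id k H)).comp (coaction k H))
  have h : φ = total k H := by
    ext h
    have e : ∀ t : H ⊗[k] H, Algebra.TensorProduct.lid k H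
        (Algebra.TensorProduct.map (aug k H) (AlgHom.id k H) ((TensorAlgebra.ι k).rTensor H t))
        = TensorProduct.lid k H ((counit (R := k)).rTensor H t) := by
      intro t
      induction t with
      | zero => simp
      | add x y hx hy => simp only [map_add, hx, hy]
      | tmul a b => simp [aug_ι]
    simp only [φ, AlgHom.toLinearMap_apply, LinearMap.comp_apply, AlgHom.comp_apply, coaction_ι,
      total_ι]
    refine (e _).trans ?_
    rw [Coalgebra.rTensor_counit_comul]
    simp
  exact congr($h x)

theorem counit_total (x : TensorAlgebra k H) : counit (R := k) (total k H x) = aug k H x := by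
  have : (Bialgebra.counitAlgHom k H).comp (total k H) = aug k H := by
    ext h
    simp [aug_ι, total_ι]
  exact congr($this x)

/-- Cochains that are restrictions of the augmentation. -/
def IsAug {n : ℕ} (f : Cochain k H (CounitModule k H) n) : Prop :=
  ∀ x ∈ deg k H n, ev f x = aug k H x

theorem IsAug.coev {n : ℕ} {f : Cochain k H (CounitModule k H) n} (hf : IsAug f)
    {x : TensorAlgebra k H} (hx : x ∈ deg k H n) : coev f x = total k H x := by
  rw [coev_apply, ← lid_aug_coaction]
  congr 1
  exact tdeg_induction (φ := (ev f).rTensor H) (ψ := (aug k H).toLinearMap.rTensor H)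
    (fun x hx a => by simp [hf x hx]) (coaction_mem_tdeg hx)

theorem IsAug.eq {n : ℕ} {f g : Cochain k H (CounitModule k H) n} (hf : IsAug f) (hg : IsAug g) :
    f = g := ev_ext fun x hx => by rw [hf x hx, hg x hx]

/-- The `H`-valued form of an augmentation is the total product, so augmentations are closed under
composition. Since there is only one in each degree, every axiom relating `μ`, `e` and the operadic
identity follows. -/
theorem IsAug.comp {p q n i : ℕ} {f : Cochain k H (CounitModule k H) p}
    {g : Cochain k H (CounitModule k H) q} (hf : IsAug f) (hg : IsAug g) (hn : n + 1 = p + q)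
    (hi : i < p) : IsAug (comp n i f g) := by
  intro w hw
  refine eq_of_mul₃ (φ := ev (HopfTensor.comp n i f g)) (ψ := (aug k H).toLinearMap) (p - 1 - i) q i
    (by omega) (fun x hx y hy z hz => ?_) hw
  rw [ev_comp hn (by omega) f g hx hy hz, hf _ (mul_mem_deg (mul_mem_deg hx (ι_mem_deg _) rfl) hz
    (by omega)), hg.coev hy]
  simp [aug_ι, counit_total]

theorem isAug_operadUnit : IsAug (operadUnit k H) := fun x hx =>
  ev_eq_of_tprod (φ := (aug k H).toLinearMap) (fun u => by simp; rfl) hx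

theorem isAug_operadMul : IsAug (operadMul k H) := fun x hx =>
  ev_eq_of_tprod (φ := (aug k H).toLinearMap)
    (fun u => by simp [operadMul, aug_ι, List.ofFn_succ]) hx

variable (k H) in
/-- The operadic identity. -/
def operadOne : Cochain k H (CounitModule k H) 1 :=
  ((CounitModule.toBase k H).symm.toLinearMap ∘ₗ
    Coalgebra.counit (R := k) (A := H)).compMultilinearMap (MultilinearMap.mkPiAlgebraFin k 1 H)

theorem isAug_operadOne : IsAug (operadOne k H) := fun x hx =>
  ev_eq_of_tprod (φ := (aug k H).toLinearMap)
    (fun u => by simp [operadOne, aug_ι, List.ofFn_succ]) hx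

theorem comp_operadOne {p i : ℕ} (f : Cochain k H (CounitModule k H) p) (hi : i < p) :
    comp p i f (operadOne k H) = f := by
  refine ev_ext₃ (p - 1 - i) 1 i (by omega) fun x hx y hy z hz => ?_
  rw [ev_comp rfl (by omega) f _ hx hy hz, isAug_operadOne.coev hy]
  rw [deg, pow_one] at hy
  obtain ⟨h, rfl⟩ := hy
  rw [total_ι]

theorem operadOne_comp {p : ℕ} (f : Cochain k H (CounitModule k H) p) :
    comp p 0 (operadOne k H) f = f := by
  refine ev_ext fun x hx => ?_
  have := ev_comp (add_comm p 1) (by omega : 0 + 1 + 0 = 1) (operadOne k H) f one_mem_deg hx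
    one_mem_deg
  rw [one_mul, mul_one, one_mul, mul_one, isAug_operadOne _ (ι_mem_deg _), aug_ι,
    counit_coev] at this
  exact this

theorem exists_smul_operadUnit (f : Cochain k H (CounitModule k H) 0) :
    ∃ r : k, f = r • operadUnit k H := by
  refine ⟨CounitModule.toBase k H (f Fin.elim0), ?_⟩
  ext u
  rw [Subsingleton.elim u Fin.elim0]
  exact (mul_one (f Fin.elim0)).symm

end HopfTensor

/-! ### The cyclic operator on cochains -/

namespace HopfTensor

open Coalgebra HopfAlgebra TensorProduct

variable {k H : Type*} [CommRing k] [Ring H] [HopfAlgebra k H]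

theorem absorb_mem_deg (ς : H) {n : ℕ} {X : TensorAlgebra k H ⊗[k] H} (hX : X ∈ tdeg k H n) :
    absorb ς X ∈ deg k H (n + 1) := by
  rw [tdeg] at hX
  induction hX using Submodule.span_induction with
  | zero => simp
  | add s t _ _ hs ht => rw [map_add]; exact Submodule.add_mem _ hs ht
  | smul r s _ hs => rw [map_smul]; exact Submodule.smul_mem _ _ hs
  | mem t ht =>
    obtain ⟨z, hz, c, rfl⟩ := ht
    rw [absorb_tmul]
    exact mul_mem_deg hz (ι_mem_deg _) rfl

theorem tmul_mul_mem_tdeg (u : H) {n : ℕ} {X : TensorAlgebra k H ⊗[k] H} (hX : X ∈ tdeg k H n) :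
    (1 ⊗ₜ u) * X ∈ tdeg k H n := by
  rw [tdeg] at hX
  induction hX using Submodule.span_induction with
  | zero => simp
  | add s t _ _ hs ht => rw [mul_add]; exact Submodule.add_mem _ hs ht
  | smul r s _ hs => rw [mul_smul_comm]; exact Submodule.smul_mem _ _ hs
  | mem t ht =>
    obtain ⟨z, hz, c, rfl⟩ := ht
    rw [Algebra.TensorProduct.tmul_mul_tmul, one_mul]
    exact tmul_mem_tdeg hz _

theorem turn_mem_deg (ς : H) {n : ℕ} {x : TensorAlgebra k H} (hx : x ∈ deg k H n) (u : H) :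
    turn ς x u ∈ deg k H (n + 1) :=
  absorb_mem_deg ς (tmul_mul_mem_tdeg u (coaction_mem_tdeg hx))

theorem ev_cofaceLast {n : ℕ} (f : Cochain k H (CounitModule k H) n) (u : H)
    {x : TensorAlgebra k H} (hx : x ∈ deg k H n) :
    ev (cofaceLast k H (CounitModule k H) n f) (TensorAlgebra.ι k u * x) = counit u * ev f x := by
  refine eq_of_tprod (φ := ev (cofaceLast k H (CounitModule k H) n f)
    ∘ₗ LinearMap.mulLeft k (TensorAlgebra.ι k u)) (ψ := counit (R := k) u • ev f) (fun v => ?_) hx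
  rw [LinearMap.comp_apply, LinearMap.mulLeft_apply, ← tprod_cons, ev_tprod, LinearMap.smul_apply,
    ev_tprod]
  simp [cofaceLast, CounitModule.smul_def]

theorem ev_cofaceZero {n : ℕ} (f : Cochain k H (CounitModule k H) n) (u : H)
    {x : TensorAlgebra k H} (hx : x ∈ deg k H n) :
    ev (cofaceZero k H (CounitModule k H) n f) (x * TensorAlgebra.ι k u) = counit u * ev f x := by
  refine eq_of_tprod (φ := ev (cofaceZero k H (CounitModule k H) n f)
    ∘ₗ LinearMap.mulRight k (TensorAlgebra.ι k u)) (ψ := counit (R := k) u • ev f) (fun v => ?_) hx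
  rw [LinearMap.comp_apply, LinearMap.mulRight_apply, ← tprod_snoc, ev_tprod, LinearMap.smul_apply,
    ev_tprod]
  simp [cofaceZero]

/-- The cochain `x ↦ G(x₀, S(x₁) ς)`. -/
def pull (ς : H) {n : ℕ} (G : Cochain k H (CounitModule k H) (n + 1)) :
    Cochain k H (CounitModule k H) n :=
  (hat G ∘ₗ absorb ς ∘ₗ (coaction k H).toLinearMap).compMultilinearMap (TensorAlgebra.tprod k H n)

theorem ev_pull (ς : H) {n : ℕ} (G : Cochain k H (CounitModule k H) (n + 1))
    {x : TensorAlgebra k H} (hx : x ∈ deg k H n) :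
    ev (pull ς G) x = ev G (absorb ς (coaction k H x)) :=
  ev_eq_of_tprod (φ := ev G ∘ₗ absorb ς ∘ₗ (coaction k H).toLinearMap) (fun _ => rfl) hx

theorem cyclicOp_eq (ς : GroupLike k H) {n : ℕ} (f : Cochain k H (CounitModule k H) n) :
    cyclicOp (baseContramodule k H ς) n f
      = pull (ς : H) (cofaceLast k H (CounitModule k H) n f) := by
  let φ : TensorAlgebra k H →ₗ[k] H →ₗ[k] CounitModule k H :=
    ((LinearMap.mul k (TensorAlgebra k H)).compl₂ (TensorAlgebra.ι k)).compr₂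
      (hat (cofaceLast k H (CounitModule k H) n f))
  ext u
  have h : ∀ v, φ (TensorAlgebra.tprod k H n v)
      = (cofaceLast k H (CounitModule k H) n f).curryRight v := by
    intro v
    ext y
    refine Eq.trans ?_ (hat_tprod (cofaceLast k H (CounitModule k H) n f)
      (Fin.snoc v y : Fin (n + 1) → H))
    rw [tprod_snoc]
    rfl
  rw [cyclicOp, LinearMap.compMultilinearMap_apply, sweedlerSplit_translation _ φ h, pull,
    LinearMap.compMultilinearMap_apply, LinearMap.comp_apply, LinearMap.comp_apply,
    LinearMap.comp_apply, AlgHom.toLinearMap_apply]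
  induction coaction k H (TensorAlgebra.tprod k H n u) with
  | zero => simp
  | add x y hx hy => simp only [map_add, hx, hy]
  | tmul a b => rfl

/-- The first argument acts through the counit, which removes one leg of its coproduct; only `S(u)`
inside the new last argument is left. -/
theorem ev_cyclicOp (ς : GroupLike k H) {n : ℕ} (f : Cochain k H (CounitModule k H) (n + 1))
    {x : TensorAlgebra k H} (hx : x ∈ deg k H n) (u : H) :
    ev (cyclicOp (baseContramodule k H ς) (n + 1) f) (TensorAlgebra.ι k u * x)
      = ev f (turn (ς : H) x u) := by
  rw [cyclicOp_eq, ev_pull _ _ (mul_mem_deg (ι_mem_deg u) hx (add_comm _ _)), map_mul, coaction_ι,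
    turn_apply]
  have h : ∀ t : H ⊗[k] H, ev (cofaceLast k H (CounitModule k H) (n + 1) f)
      (absorb (ς : H) ((TensorAlgebra.ι k).rTensor H t * coaction k H x))
      = ev f (absorb (ς : H) ((1 ⊗ₜ TensorProduct.lid k H ((counit (R := k)).rTensor H t))
        * coaction k H x)) := by
    intro t
    induction t with
    | zero => simp
    | add x y hx hy => simp only [map_add, hx, hy, TensorProduct.tmul_add, add_mul]
    | tmul a b =>
      have e : (TensorAlgebra.ι k a ⊗ₜ[k] b) * coaction k H x
          = (TensorAlgebra.ι k a ⊗ₜ 1) * ((1 ⊗ₜ b) * coaction k H x) := by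
        rw [← mul_assoc, Algebra.TensorProduct.tmul_mul_tmul, one_mul, mul_one]
      rw [LinearMap.rTensor_tmul, LinearMap.rTensor_tmul, TensorProduct.lid_tmul, e, absorb_mul,
        ← turn_apply, ev_cofaceLast _ _ (turn_mem_deg (ς : H) hx b), turn_apply,
        TensorProduct.tmul_smul,
        smul_mul_assoc, map_smul, map_smul, smul_eq_mul]
  rw [h, Coalgebra.rTensor_counit_comul]
  simp

/-- Cyclic rotation of the arguments. -/
def rotate {n : ℕ} (G : Cochain k H (CounitModule k H) (n + 1)) :
    Cochain k H (CounitModule k H) (n + 1) := G.domDomCongr (finRotate (n + 1))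

theorem ev_rotate {n : ℕ} (G : Cochain k H (CounitModule k H) (n + 1)) (u : H)
    {x : TensorAlgebra k H} (hx : x ∈ deg k H n) :
    ev (rotate G) (TensorAlgebra.ι k u * x) = ev G (x * TensorAlgebra.ι k u) := by
  refine eq_of_tprod (φ := ev (rotate G) ∘ₗ LinearMap.mulLeft k (TensorAlgebra.ι k u))
    (ψ := ev G ∘ₗ LinearMap.mulRight k (TensorAlgebra.ι k u)) (fun v => ?_) hx
  rw [LinearMap.comp_apply, LinearMap.mulLeft_apply, ← tprod_cons, ev_tprod, LinearMap.comp_apply,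
    LinearMap.mulRight_apply, ← tprod_snoc, ev_tprod, rotate, MultilinearMap.domDomCongr_apply]
  congr 2
  funext i
  induction i using Fin.lastCases with
  | last => simp
  | cast i => simp

theorem ev_rotate_iterate {n : ℕ} (G : Cochain k H (CounitModule k H) (n + 1)) (a b : ℕ)
    (hab : n + 1 = a + b) {x y : TensorAlgebra k H} (hx : x ∈ deg k H a) (hy : y ∈ deg k H b) :
    ev (rotate^[a] G) (x * y) = ev G (y * x) := by
  induction a generalizing b x y with
  | zero =>
    refine eq_of_one (φ := ev G ∘ₗ LinearMap.mulRight k y) (ψ := ev G ∘ₗ LinearMap.mulLeft k y) ?_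
      hx
    simp
  | succ a ih =>
    refine eq_of_ι_mul (φ := ev (rotate^[a + 1] G) ∘ₗ LinearMap.mulRight k y)
      (ψ := ev G ∘ₗ LinearMap.mulLeft k y) (fun u x hx => ?_) hx
    rw [Function.iterate_succ_apply', LinearMap.comp_apply, LinearMap.mulRight_apply,
      mul_assoc, ev_rotate _ _ (mul_mem_deg hx hy (by omega)), mul_assoc,
      ih (b + 1) (by omega) hx (mul_mem_deg hy (ι_mem_deg u) rfl), LinearMap.comp_apply,
      LinearMap.mulLeft_apply, mul_assoc]

theorem rotate_iterate {n : ℕ} (G : Cochain k H (CounitModule k H) (n + 1)) :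
    rotate^[n + 1] G = G := by
  refine ev_ext fun x hx => ?_
  have := ev_rotate_iterate G (n + 1) 0 rfl hx one_mem_deg
  rwa [mul_one, one_mul] at this

theorem rotate_cofaceZero {n : ℕ} (f : Cochain k H (CounitModule k H) n) :
    rotate (cofaceZero k H (CounitModule k H) n f) = cofaceLast k H (CounitModule k H) n f :=
  ev_ext fun _ hw => eq_of_ι_mul (fun u x hx => by
    rw [ev_rotate _ _ hx, ev_cofaceZero _ _ hx, ev_cofaceLast _ _ hx]) hw

theorem counit_absorb (ς : GroupLike k H) {n : ℕ} (f : Cochain k H (CounitModule k H) n)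
    {X : TensorAlgebra k H ⊗[k] H} (hX : X ∈ tdeg k H n) :
    ev (cofaceZero k H (CounitModule k H) n f) (absorb (ς : H) X)
      = ev f (TensorProduct.rid k _ ((counit (R := k)).lTensor _ X)) := by
  refine tdeg_induction (φ := ev (cofaceZero k H (CounitModule k H) n f) ∘ₗ absorb (ς : H))
    (ψ := ev f ∘ₗ (TensorProduct.rid k _).toLinearMap ∘ₗ (counit (R := k)).lTensor _)
    (fun x hx a => ?_) hX
  simp only [LinearMap.comp_apply, absorb_tmul]
  rw [ev_cofaceZero _ _ hx]
  simp [ς.isGroupLikeElem_val.counit_eq_one]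

/-- Thus `pull` retracts cochains with one more argument onto the given ones, and the operator `τ`
can be studied upstairs. -/
theorem pull_cofaceZero (ς : GroupLike k H) {n : ℕ} (f : Cochain k H (CounitModule k H) n) :
    pull (ς : H) (cofaceZero k H (CounitModule k H) n f) = f := by
  refine ev_ext fun x hx => ?_
  rw [ev_pull _ _ hx, counit_absorb ς f (coaction_mem_tdeg hx), coaction_counit]
  simp

section SquareAntipode

variable (ς : GroupLike k H)

theorem antipode_groupLike :
    antipode k (ς : H) = ((ς⁻¹ : GroupLike k H) : H) := rfl

theorem groupLike_inv_mul : ((ς⁻¹ : GroupLike k H) : H) * (ς : H) = 1 := by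
  rw [← GroupLike.val_mul, inv_mul_cancel, GroupLike.val_one]

/-- The twisted antipode `S(-) ς` is an involution. The condition on `S²` enters the cyclic
structure through this identity. -/
theorem antipode_antipode_mul
    (hς : ∀ h : H, antipode k (antipode k h) = (ς : H) * h * ((ς⁻¹ : GroupLike k H) : H))
    (u : H) :
    antipode k (antipode k u * (ς : H)) * (ς : H) = u := by
  rw [antipode_mul_antidistrib, hς, antipode_groupLike, mul_assoc, mul_assoc, mul_assoc,
    groupLike_inv_mul, mul_one, ← mul_assoc, groupLike_inv_mul, one_mul]

/-- Under `pull` the cyclic operator becomes the plain rotation. By `coaction_turn` the argument `u`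
passes twice through `S(-) ς`, and so it reappears unchanged as an ordinary last argument. -/
theorem cyclicOp_pull
    (hς : ∀ h : H, antipode k (antipode k h) = (ς : H) * h * ((ς⁻¹ : GroupLike k H) : H))
    {n : ℕ} (G : Cochain k H (CounitModule k H) (n + 2)) :
    cyclicOp (baseContramodule k H ς) (n + 1) (pull (ς : H) G) = pull (ς : H) (rotate G) := by
  refine ev_ext fun w hw => eq_of_ι_mul (fun u x hx => ?_) hw
  rw [ev_cyclicOp ς _ hx, ev_pull _ _ (turn_mem_deg _ hx u),
    ev_pull _ _ (mul_mem_deg (ι_mem_deg u) hx (add_comm _ _)), map_mul, coaction_ι,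
    coaction_turn ς.isGroupLikeElem_val.comul_eq_tmul_self]
  induction comul (R := k) u with
  | zero => simp
  | add s t hs ht => simp only [map_add, add_mul, hs, ht]
  | tmul a b =>
    have e : (TensorAlgebra.ι k a ⊗ₜ[k] b) * coaction k H x
        = (TensorAlgebra.ι k a ⊗ₜ 1) * ((1 ⊗ₜ b) * coaction k H x) := by
      rw [← mul_assoc, Algebra.TensorProduct.tmul_mul_tmul, one_mul, mul_one]
    rw [LinearMap.rTensor_tmul, e, absorb_mul, ← turn_apply, ev_rotate _ _ (turn_mem_deg _ hx b),
      TensorProduct.comm_tmul, TensorProduct.map_tmul, absorb_tmul, LinearMap.comp_apply,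
      LinearMap.mulRight_apply, antipode_antipode_mul ς hς]

theorem cyclicOp_zero (f : Cochain k H (CounitModule k H) 0) :
    cyclicOp (baseContramodule k H ς) 0 f = f := by
  rw [cyclicOp_eq, ← rotate_cofaceZero]
  have : ∀ G : Cochain k H (CounitModule k H) 1, rotate G = G := fun G => rotate_iterate G
  rw [this, pull_cofaceZero]

/-- Writing `f` as the `pull` of its zeroth coface turns powers of `τ` into rotations of a cochain
with one more argument, and these have the required order. Degree zero is separate because
`cyclicOp_pull` needs an argument to rotate. -/
theorem cyclicOp_iterate
    (hς : ∀ h : H, antipode k (antipode k h) = (ς : H) * h * ((ς⁻¹ : GroupLike k H) : H))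
    (n : ℕ) (f : Cochain k H (CounitModule k H) n) :
    (cyclicOp (baseContramodule k H ς) n)^[n + 1] f = f := by
  rcases n with _ | n
  · exact cyclicOp_zero ς f
  · have h : ∀ j : ℕ, (cyclicOp (baseContramodule k H ς) (n + 1))^[j] f
        = pull (ς : H) (rotate^[j] (cofaceZero k H (CounitModule k H) (n + 1) f)) := by
      intro j
      induction j with
      | zero => exact (pull_cofaceZero ς f).symm
      | succ j ih => rw [Function.iterate_succ_apply', Function.iterate_succ_apply', ih,
          cyclicOp_pull ς hς]
    rw [h, rotate_iterate, pull_cofaceZero]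

end SquareAntipode

/-- The cyclic operator as a linear map. -/
def tau (ς : GroupLike k H) (n : ℕ) :
    Cochain k H (CounitModule k H) n →ₗ[k] Cochain k H (CounitModule k H) n where
  toFun := cyclicOp (baseContramodule k H ς) n
  map_add' f g := by
    simp only [cyclicOp_eq, pull, map_add, LinearMap.add_comp]
    rfl
  map_smul' r f := by
    simp only [cyclicOp_eq, pull, map_smul, LinearMap.smul_comp]
    rfl

theorem ev_tau (ς : GroupLike k H) {n m : ℕ} (hm : m = n + 1)
    (f : Cochain k H (CounitModule k H) m)
    {x : TensorAlgebra k H} (hx : x ∈ deg k H n) (u : H) :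
    ev (tau ς m f) (TensorAlgebra.ι k u * x) = ev f (turn (ς : H) x u) := by
  subst hm
  exact ev_cyclicOp ς f hx u

theorem ev_absorb_comp (ς : H) {p q n s r : ℕ} (hn : n + 1 = p + q) (hs : s + 1 + (r + 1) = p)
    (f : Cochain k H (CounitModule k H) p) (g : Cochain k H (CounitModule k H) q)
    {X Y Z : TensorAlgebra k H ⊗[k] H} (hX : X ∈ tdeg k H s) (hY : Y ∈ tdeg k H q)
    (hZ : Z ∈ tdeg k H r) :
    ev (comp n (r + 1) f g) (absorb ς (X * Y * Z))
      = ev f (absorb ς (X * (TensorAlgebra.ι k ∘ₗ coev g).rTensor H Y * Z)) := by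
  refine tdeg_induction (φ := ev (comp n (r + 1) f g) ∘ₗ absorb ς ∘ₗ LinearMap.mulLeft k (X * Y))
    (ψ := ev f ∘ₗ absorb ς ∘ₗ LinearMap.mulLeft k
      (X * (TensorAlgebra.ι k ∘ₗ coev g).rTensor H Y)) (fun z hz c => ?_) hZ
  simp only [LinearMap.comp_apply, LinearMap.mulLeft_apply]
  refine tdeg_induction (φ := ev (comp n (r + 1) f g) ∘ₗ absorb ς ∘ₗ LinearMap.mulRight k (z ⊗ₜ c)
      ∘ₗ LinearMap.mulLeft k X)
    (ψ := ev f ∘ₗ absorb ς ∘ₗ LinearMap.mulRight k (z ⊗ₜ c) ∘ₗ LinearMap.mulLeft k X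
      ∘ₗ (TensorAlgebra.ι k ∘ₗ coev g).rTensor H) (fun y hy b => ?_) hY
  simp only [LinearMap.comp_apply, LinearMap.mulLeft_apply, LinearMap.mulRight_apply,
    LinearMap.rTensor_tmul]
  refine tdeg_induction (φ := ev (comp n (r + 1) f g) ∘ₗ absorb ς ∘ₗ LinearMap.mulRight k (z ⊗ₜ c)
      ∘ₗ LinearMap.mulRight k (y ⊗ₜ b))
    (ψ := ev f ∘ₗ absorb ς ∘ₗ LinearMap.mulRight k (z ⊗ₜ c) ∘ₗ LinearMap.mulRight k
      (TensorAlgebra.ι k (coev g y) ⊗ₜ b)) (fun x hx a => ?_) hX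
  simp only [LinearMap.comp_apply, LinearMap.mulRight_apply,
    Algebra.TensorProduct.tmul_mul_tmul, absorb_tmul]
  rw [mul_assoc, ev_comp hn hs f g hx hy (mul_mem_deg hz (ι_mem_deg _) rfl), mul_assoc _ z]

/-- A slot of positive index is not the last argument, so the insertion takes place before the
argument created by the rotation and is unaffected by it; the coefficients agree by colinearity. -/
theorem tau_comp_succ (ς : GroupLike k H) {p q n i : ℕ} (f : Cochain k H (CounitModule k H) p)
    (g : Cochain k H (CounitModule k H) q) (hi : i + 1 < p) (hn : n + 1 = p + q) :
    tau ς n (comp n (i + 1) f g) = comp n i (tau ς p f) g := by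
  obtain ⟨s, rfl⟩ : ∃ s, p = s + i + 2 := ⟨p - i - 2, by omega⟩
  obtain ⟨m, rfl⟩ : ∃ m, n = m + 1 := ⟨n - 1, by omega⟩
  refine ev_ext fun w hw => eq_of_ι_mul (fun u w hw => ?_) hw
  refine eq_of_mul₃ (φ := ev (tau ς (m + 1) (comp (m + 1) (i + 1) f g))
      ∘ₗ LinearMap.mulLeft k (TensorAlgebra.ι k u))
    (ψ := ev (comp (m + 1) i (tau ς (s + i + 2) f) g) ∘ₗ LinearMap.mulLeft k (TensorAlgebra.ι k u))
    s q i (by omega) (fun x hx y hy z hz => ?_) hw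
  have e := ev_comp (n := m + 1) (s := s + 1) (by omega) (by omega) (tau ς (s + i + 2) f) g
    (mul_mem_deg (ι_mem_deg u) hx (add_comm _ _)) hy hz
  simp only [LinearMap.comp_apply, LinearMap.mulLeft_apply, mul_assoc] at e ⊢
  rw [e, ev_tau ς rfl _ (mul_mem_deg hx (mul_mem_deg hy hz rfl) (by omega)),
    ev_tau ς (n := s + i + 1) rfl _ (mul_mem_deg hx (mul_mem_deg (ι_mem_deg _) hz rfl) (by omega)),
    turn_apply, turn_apply]
  have e' := ev_absorb_comp (ς : H) (n := m + 1) (by omega) (by omega : s + 1 + (i + 1) = s + i + 2)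
    f g (tmul_mul_mem_tdeg u (coaction_mem_tdeg hx)) (coaction_mem_tdeg hy) (coaction_mem_tdeg hz)
  rw [← coaction_ι_coev] at e'
  simp only [map_mul (coaction k H), mul_assoc] at e' ⊢
  rw [e']

theorem coev_turn (ς : GroupLike k H) {n : ℕ} (g : Cochain k H (CounitModule k H) n)
    (x : TensorAlgebra k H) (w : H) :
    coev g (turn (ς : H) x w) = TensorProduct.lid k H
      (TensorProduct.map (ev g ∘ₗ turn (ς : H) x) (LinearMap.mulRight k (ς : H) ∘ₗ antipode k)
        (TensorProduct.comm k H H (comul w))) := by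
  rw [coev_apply, coaction_turn ς.isGroupLikeElem_val.comul_eq_tmul_self, ← LinearMap.comp_apply,
    LinearMap.rTensor_comp_map]

/-- In slot `0` the element `g` consumes the trailing arguments together with the one created by the
rotation. `coev_turn` splits its value into the rotated `g` and the new last argument of `f`. The
two sides are then one functional applied to the two sides of coassociativity. -/
theorem tau_comp_zero (ς : GroupLike k H) {p q n j : ℕ} (f : Cochain k H (CounitModule k H) p)
    (g : Cochain k H (CounitModule k H) q) (hp : 0 < p) (hq : q = j + 1) (hn : n + 1 = p + q) :
    tau ς n (comp n 0 f g) = comp n j (tau ς q g) (tau ς p f) := by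
  obtain ⟨s, rfl⟩ : ∃ s, p = s + 1 := ⟨p - 1, by omega⟩
  obtain ⟨m, rfl⟩ : ∃ m, n = m + 1 := ⟨n - 1, by omega⟩
  refine ev_ext fun w hw => eq_of_ι_mul (fun u w hw => ?_) hw
  refine eq_of_mul (φ := ev (tau ς (m + 1) (comp (m + 1) 0 f g))
      ∘ₗ LinearMap.mulLeft k (TensorAlgebra.ι k u))
    (ψ := ev (comp (m + 1) j (tau ς q g) (tau ς (s + 1) f))
      ∘ₗ LinearMap.mulLeft k (TensorAlgebra.ι k u))
    s j (by omega) (fun y hy z hz => ?_) hw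
  have e := ev_comp (n := m + 1) (by omega) (by omega : 0 + 1 + j = q) (tau ς q g) (tau ς (s + 1) f)
    one_mem_deg (mul_mem_deg (ι_mem_deg u) hy (add_comm _ _)) hz
  simp only [LinearMap.comp_apply, LinearMap.mulLeft_apply, mul_assoc, one_mul] at e ⊢
  rw [e, ev_tau ς rfl _ (mul_mem_deg hy hz (by omega)), ev_tau ς hq _ hz]
  set N := ev g ∘ₗ turn (ς : H) z with hN
  -- On `(x ⊗ b) ⊗ b'` the functional `Θ` has the value `f(x S(u₁ b) ς) · g(turn z (u₂ b'))`, where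
  -- `u₁ ⊗ u₂` is the coproduct of `u`.
  let θ : H → H → (TensorAlgebra k H ⊗[k] H) ⊗[k] H →ₗ[k] k := fun a c =>
    LinearMap.mul' k k ∘ₗ TensorProduct.map
      (ev f ∘ₗ absorb (ς : H) ∘ₗ LinearMap.mulLeft k (1 ⊗ₜ a)) (N ∘ₗ LinearMap.mulLeft k c)
  let Θ : (TensorAlgebra k H ⊗[k] H) ⊗[k] H →ₗ[k] k :=
    ∑ i ∈ (ℛ k u).index, θ ((ℛ k u).left i) ((ℛ k u).right i)
  have h₁ : ev (comp (m + 1) 0 f g) (turn (ς : H) (y * z) u)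
      = Θ ((TensorProduct.assoc k _ _ _).symm ((comul (R := k)).lTensor _ (coaction k H y))) := by
    rw [turn_apply, map_mul (coaction k H), ← mul_assoc]
    refine tdeg_induction (φ := ev (comp (m + 1) 0 f g) ∘ₗ absorb (ς : H)
        ∘ₗ LinearMap.mulRight k (coaction k H z) ∘ₗ LinearMap.mulLeft k (1 ⊗ₜ u))
      (ψ := Θ ∘ₗ (TensorProduct.assoc k _ _ _).symm.toLinearMap ∘ₗ (comul (R := k)).lTensor _)
      (fun x hx b => ?_) (coaction_mem_tdeg hy)
    have e₁ : (1 ⊗ₜ[k] u) * (x ⊗ₜ[k] b) * coaction k H z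
        = (x ⊗ₜ[k] 1) * ((1 ⊗ₜ (u * b)) * coaction k H z) := by
      rw [← mul_assoc, Algebra.TensorProduct.tmul_mul_tmul, Algebra.TensorProduct.tmul_mul_tmul,
        one_mul, one_mul, mul_one]
    have e₂ := ev_comp hn (by omega : s + 1 + 0 = s + 1) f g hx
      (hq ▸ turn_mem_deg (ς : H) hz (u * b)) one_mem_deg
    rw [mul_one, mul_one, coev_turn, Bialgebra.comul_mul] at e₂
    simp only [LinearMap.comp_apply, LinearMap.mulLeft_apply, LinearMap.mulRight_apply]
    rw [e₁, absorb_mul, ← turn_apply, e₂, ← hN, LinearMap.lTensor_tmul, ← (ℛ k b).eq]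
    conv_lhs => rw [← (ℛ k u).eq]
    simp only [Finset.sum_mul, Finset.mul_sum, Algebra.TensorProduct.tmul_mul_tmul, map_sum,
      TensorProduct.comm_tmul, TensorProduct.map_tmul, TensorProduct.lid_tmul, map_smul,
      mul_smul_comm, TensorProduct.tmul_sum, LinearEquiv.coe_coe, TensorProduct.assoc_symm_tmul,
      Θ, θ, LinearMap.sum_apply, LinearMap.comp_apply, LinearMap.mulLeft_apply,
      LinearMap.mulRight_apply, one_mul, absorb_tmul, LinearMap.mul'_apply]
    exact Finset.sum_congr rfl fun _ _ => Finset.sum_congr rfl fun _ _ => mul_comm _ _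
  have h₂ : N (coev (tau ς (s + 1) f) (TensorAlgebra.ι k u * y))
      = Θ ((coaction k H).toLinearMap.rTensor H (coaction k H y)) := by
    rw [coev_apply, map_mul (coaction k H), coaction_ι]
    refine tdeg_induction (φ := N ∘ₗ (TensorProduct.lid k H).toLinearMap
        ∘ₗ (ev (tau ς (s + 1) f)).rTensor H
        ∘ₗ LinearMap.mulLeft k ((TensorAlgebra.ι k).rTensor H (comul u)))
      (ψ := Θ ∘ₗ (coaction k H).toLinearMap.rTensor H)
      (fun x hx b => ?_) (coaction_mem_tdeg hy)
    simp only [LinearMap.comp_apply, LinearMap.mulLeft_apply]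
    conv_lhs => rw [← (ℛ k u).eq]
    simp only [Finset.sum_mul, Algebra.TensorProduct.tmul_mul_tmul, map_sum,
      LinearMap.rTensor_tmul, ev_tau ς rfl f hx,
      Θ, θ, LinearMap.sum_apply, LinearMap.comp_apply, LinearMap.mulLeft_apply,
      LinearMap.mul'_apply, TensorProduct.map_tmul, LinearEquiv.coe_coe, TensorProduct.lid_tmul,
      map_smul, smul_eq_mul, turn_apply, AlgHom.toLinearMap_apply]
  refine h₁.trans (Eq.trans ?_ h₂.symm)
  rw [← coaction_coassoc, LinearEquiv.symm_apply_apply]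

theorem tau_operadMul (ς : GroupLike k H) : tau ς 2 (operadMul k H) = operadMul k H := by
  refine ev_ext fun w hw => eq_of_ι_mul (fun u x hx => ?_) hw
  rw [ev_tau ς rfl _ hx, isAug_operadMul _ (turn_mem_deg _ hx u),
    isAug_operadMul _ (mul_mem_deg (ι_mem_deg u) hx rfl), turn_apply]
  have h : ∀ X : TensorAlgebra k H ⊗[k] H, aug k H (absorb (ς : H) ((1 ⊗ₜ u) * X))
      = counit (R := k) u * aug k H (TensorProduct.rid k _ ((counit (R := k)).lTensor _ X)) := by
    intro X
    induction X with
    | zero => simp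
    | add x y hx hy => simp only [mul_add, map_add, hx, hy]
    | tmul a b =>
      simp [absorb_tmul, aug_ι, ς.isGroupLikeElem_val.counit_eq_one]
      ring
  rw [h, coaction_counit, map_mul, aug_ι]
  simp

/-- The cyclic operad with multiplication `C^•(H, k_ς)`. -/
def cyclicOperad (ς : GroupLike k H) (hς : ∀ h : H, antipode k (antipode k h)
      = (ς : H) * h * ((ς⁻¹ : GroupLike k H) : H)) :
    CyclicOperad k (Cochain k H (CounitModule k H)) where
  comp := comp
  mu := operadMul k H
  e := operadUnit k H
  one := operadOne k H
  tau := tau ς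
  seq := comp_seq
  par := comp_par
  mu_mu := (isAug_operadMul.comp isAug_operadMul rfl (by omega)).eq
    (isAug_operadMul.comp isAug_operadMul rfl (by omega))
  mu_zero_e := (isAug_operadMul.comp isAug_operadUnit rfl (by omega)).eq isAug_operadOne
  mu_one_e := (isAug_operadMul.comp isAug_operadUnit rfl (by omega)).eq isAug_operadOne
  comp_one := comp_operadOne
  one_comp := operadOne_comp
  exists_smul_e := exists_smul_operadUnit
  tau_pow := cyclicOp_iterate ς hς
  tau_comp_succ := tau_comp_succ ς
  tau_comp_zero := tau_comp_zero ς
  tau_mu := tau_operadMul ς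

end HopfTensor

/-! ### Stability, the anti Yetter–Drinfel'd condition and comparison with the given operations -/

namespace HopfTensor

open Coalgebra HopfAlgebra TensorProduct

variable {k H : Type*} [CommRing k] [Ring H] [HopfAlgebra k H] (ς : GroupLike k H)
  (hς : ∀ h : H, antipode k (antipode k h) = (ς : H) * h * ((ς⁻¹ : GroupLike k H) : H))

theorem isStable : (baseContramodule k H ς).IsStable := by
  intro m
  have h : (ς : H) • m = Coalgebra.counit (R := k) (ς : H) • m := CounitModule.smul_def k H _ _
  rw [ς.isGroupLikeElem_val.counit_eq_one, one_smul] at h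
  exact h

/-- The middle leg acts through the counit, so the right-hand side is `f(S(h₂) ς h₁)`. Moving `ς`
across turns `h₁` into `S²(h₁)`, and `S(h₂) S²(h₁) = S(S(h₁) h₂) = ε(h)`. -/
theorem isAntiYetterDrinfeld
    (hς : ∀ h : H, antipode k (antipode k h) = (ς : H) * h * ((ς⁻¹ : GroupLike k H) : H)) :
    (baseContramodule k H ς).IsAntiYetterDrinfeld := by
  intro h f
  have hmul : ∀ b : H, antipode k (antipode k b) * (ς : H) = (ς : H) * b := fun b => by
    rw [hς, mul_assoc, groupLike_inv_mul, mul_one]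
  -- `S(h₂) ς h₁ = ε(h) ς`
  have key : ∑ i ∈ (ℛ k h).index, antipode k ((ℛ k h).right i) * ((ς : H) * (ℛ k h).left i)
      = counit (R := k) h • (ς : H) := by
    simp only [← hmul, ← mul_assoc, ← antipode_mul_antidistrib]
    rw [← Finset.sum_mul, ← map_sum, sum_antipode_mul_eq_algebraMap_counit,
      Algebra.algebraMap_eq_smul_one, map_smul, antipode_one, smul_mul_assoc, one_mul]
  have h₁ : ∀ t : (H ⊗[k] H) ⊗[k] H, (baseContramodule k H ς).contraaction (adjointTerm f
      ((antipode k).lTensor _ t)) = f (LinearMap.mul' k H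
        (TensorProduct.map (antipode k) (LinearMap.mulLeft k (ς : H))
          (TensorProduct.comm k H H
            ((TensorProduct.rid k H).toLinearMap.rTensor H
              (((counit (R := k)).lTensor H).rTensor H t))))) := by
    intro t
    induction t with
    | zero => simp
    | add x y hx hy => simp only [map_add, hx, hy]
    | tmul x c =>
      induction x with
      | zero => simp
      | add x y hx hy => simp only [TensorProduct.add_tmul, map_add, hx, hy]
      | tmul a b =>
        simp only [LinearMap.lTensor_tmul, LinearMap.rTensor_tmul, TensorProduct.rid_tmul,
          TensorProduct.comm_tmul, TensorProduct.map_tmul, LinearMap.mul'_apply,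
          LinearEquiv.coe_coe, map_smul, LinearMap.mulLeft_apply, mul_smul_comm]
        exact CounitModule.smul_def k H b (f (antipode k c * ((ς : H) * a)))
  have h₂ : (comul (R := k) (A := H)).rTensor H (translation k h)
      = (antipode k).lTensor _ ((comul (R := k) (A := H)).rTensor H (comul h)) := by
    have : ∀ t : H ⊗[k] H, (comul (R := k) (A := H)).rTensor H ((antipode k).lTensor H t)
        = (antipode k).lTensor _ ((comul (R := k) (A := H)).rTensor H t) := by
      intro t
      induction t with
      | zero => simp
      | add x y hx hy => simp only [map_add, hx, hy]
      | tmul a b => simp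
    exact this _
  have h₃ : ∀ t : H ⊗[k] H, (TensorProduct.rid k H).toLinearMap.rTensor H
      (((counit (R := k)).lTensor H).rTensor H ((comul (R := k) (A := H)).rTensor H t)) = t := by
    intro t
    induction t with
    | zero => simp
    | add x y hx hy => simp only [map_add, hx, hy]
    | tmul a b => simp
  rw [h₂, h₁, h₃, ← (ℛ k h).eq]
  simp only [map_sum, TensorProduct.comm_tmul, TensorProduct.map_tmul, LinearMap.mul'_apply,
    LinearMap.mulLeft_apply]
  rw [← map_sum, key, map_smul]
  exact CounitModule.smul_def k H _ _

/-- Consequently multiplying neighbouring arguments is composition with `μ`, and inserting `1` is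
composition with `e`. -/
theorem coactionMap_eq_of_isAug {n : ℕ} {f : Cochain k H (CounitModule k H) n} (hf : IsAug f) :
    coactionMap f = MultilinearMap.mkPiAlgebraFin k n H := by
  ext u
  rw [← coev_tprod, hf.coev (tprod_mem_deg u), TensorAlgebra.tprod_apply, map_list_prod,
    List.map_ofFn, MultilinearMap.mkPiAlgebraFin_apply]
  congr 2
  funext i
  exact total_ι _

theorem coface_mid {n i : ℕ} (hi : i < n) (f : Cochain k H (CounitModule k H) n) :
    coface k H (CounitModule k H) n ⟨i + 1, by omega⟩ f = comp (n + 1) i f (operadMul k H) := by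
  simp only [coface, Nat.add_eq_zero_iff, one_ne_zero, and_false, dite_false,
    Nat.add_right_cancel_iff, hi.ne]
  refine Eq.trans ?_ (comp_eq (by omega) hi f (operadMul k H)).symm
  have : (⟨i, hi⟩ : Fin n).rev = ⟨n - (i + 1), by omega⟩ := by ext; simp [Fin.val_rev]
  rw [operadComp, this, coactionMap_eq_of_isAug isAug_operadMul]

theorem coface_eq (n : ℕ) (i : Fin (n + 2)) :
    coface k H (CounitModule k H) n i = (cyclicOperad ς hς).δ i.val := by
  ext1 f
  obtain ⟨i, hi⟩ := i
  by_cases h₀ : i = 0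
  · subst h₀
    simp only [coface, dif_pos]
    rw [CyclicOperad.δ_zero]
    refine ev_ext fun w hw => eq_of_mul n 1 rfl (fun x hx y hy => ?_) hw
    rw [deg, pow_one] at hy
    obtain ⟨u, rfl⟩ := hy
    have := ev_comp (n := n + 1) (by omega) (by omega : 0 + 1 + 1 = 2) (operadMul k H) f one_mem_deg
      hx (ι_mem_deg u)
    rw [one_mul, one_mul, isAug_operadMul _ (mul_mem_deg (ι_mem_deg _) (ι_mem_deg _) rfl),
      map_mul (aug k H), aug_ι, aug_ι, counit_coev] at this
    rw [ev_cofaceZero _ _ hx, mul_comm]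
    exact this.symm
  by_cases h₁ : i = n + 1
  · subst h₁
    simp only [coface, dif_pos, Nat.add_eq_zero_iff, one_ne_zero, and_false, dite_false]
    rw [CyclicOperad.δ_last _ rfl]
    refine ev_ext fun w hw => eq_of_ι_mul (fun u x hx => ?_) hw
    have := ev_comp (n := n + 1) (by omega) (by omega : 1 + 1 + 0 = 2) (operadMul k H) f
      (ι_mem_deg u) hx one_mem_deg
    rw [mul_one, mul_one, isAug_operadMul _ (mul_mem_deg (ι_mem_deg _) (ι_mem_deg _) rfl),
      map_mul (aug k H), aug_ι, aug_ι, counit_coev] at this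
    rw [ev_cofaceLast _ _ hx]
    exact this.symm
  obtain ⟨i, rfl⟩ : ∃ j, i = j + 1 := ⟨i - 1, by omega⟩
  rw [CyclicOperad.δ_mid _ (by omega)]
  exact coface_mid (by omega) f

theorem differential_eq (n : ℕ) :
    differential k H (CounitModule k H) n = (cyclicOperad ς hς).d := by
  rw [differential, CyclicOperad.d, Finset.sum_range]
  exact Finset.sum_congr rfl fun i _ => by rw [coface_eq ς hς]

theorem cocycles_eq : cocycles k H (CounitModule k H) = (cyclicOperad ς hς).cocyc := by
  funext n
  rw [cocycles, differential_eq ς hς]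

theorem coboundaries_eq : coboundaries k H (CounitModule k H) = (cyclicOperad ς hς).cob := by
  funext n
  rcases n with _ | n
  · rfl
  · rw [coboundaries, differential_eq ς hς]
    rfl

theorem cupProduct_eq {p q : ℕ} (f : Cochain k H (CounitModule k H) p)
    (g : Cochain k H (CounitModule k H) q) :
    cupProduct f g = (cyclicOperad ς hς).cup (p + q) f g := by
  rw [CyclicOperad.cup_apply, cupProduct]
  refine Eq.trans ?_ (comp_eq (by omega) (by omega : 0 < p + 1) _ g).symm
  congr 1
  exact (comp_eq (by omega) (by omega : 1 < 2) (operadMul k H) f).symm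

theorem brace_eq {p q n : ℕ} (hn : n + 1 = p + q) (f : Cochain k H (CounitModule k H) p)
    (g : Cochain k H (CounitModule k H) q) :
    brace hn f g = (cyclicOperad ς hς).brace n f g := by
  rw [CyclicOperad.brace_apply, brace, Finset.sum_range]
  exact Finset.sum_congr rfl fun i _ => congrArg _ (comp_eq hn i.2 f g).symm

theorem gerstenhaberBracket_eq {p q n : ℕ} (hn : n + 1 = p + q)
    (f : Cochain k H (CounitModule k H) p) (g : Cochain k H (CounitModule k H) q) :
    gerstenhaberBracket hn f g = (cyclicOperad ς hς).gbracket n f g := by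
  rw [CyclicOperad.gbracket_apply, gerstenhaberBracket, brace_eq ς hς, brace_eq ς hς]

theorem connesOp_eq {n : ℕ} (f : Cochain k H (CounitModule k H) (n + 1)) :
    connesOp (baseContramodule k H ς) n f = (cyclicOperad ς hς).connesB f := by
  rw [CyclicOperad.connesB_apply, connesOp]
  congr 1
  refine Finset.sum_congr rfl fun i _ => ?_
  rw [CyclicOperad.lam_pow_apply]
  congr 1
  refine congrArg ((cyclicOp (baseContramodule k H ς) n)^[i]) ?_
  refine Eq.trans ?_ (comp_eq (by omega) (by omega : n < n + 1) _ (operadUnit k H)).symm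
  rw [operadComp, coactionMap_eq_of_isAug isAug_operadUnit]
  rfl

end HopfTensor

/-- The families `Z` and `B` are variables so that the equalities with cocycles and coboundaries can
be substituted; otherwise the quotient modules would have to be transported by hand. -/
theorem CyclicOperad.exists_bvAlgebra {k : Type*} [CommRing k] {O : ℕ → Type*}
    [∀ n, AddCommGroup (O n)] [∀ n, Module k (O n)] (P : CyclicOperad k O)
    {Z B : ∀ n, Submodule k (O n)} (hZ : Z = P.cocyc) (hB : B = P.cob) :
    ∃ V : BVAlgebra k fun n => Z n ⧸ (B n).submoduleOf (Z n),
      (∃ h₁ : P.e ∈ Z 0, V.one = Submodule.Quotient.mk ⟨P.e, h₁⟩) ∧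
      (∀ (p q : ℕ) (x : O p) (y : O q) (hx : x ∈ Z p) (hy : y ∈ Z q),
        ∃ h : P.cup (p + q) x y ∈ Z (p + q),
          V.mul (DirectSum.lof k ℕ _ p (Submodule.Quotient.mk ⟨x, hx⟩))
              (DirectSum.lof k ℕ _ q (Submodule.Quotient.mk ⟨y, hy⟩))
            = DirectSum.lof k ℕ _ (p + q) (Submodule.Quotient.mk ⟨P.cup (p + q) x y, h⟩)) ∧
      (∀ (p q n : ℕ) (_ : n + 1 = p + q) (x : O p) (y : O q) (hx : x ∈ Z p) (hy : y ∈ Z q),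
        ∃ h : P.gbracket n x y ∈ Z n,
          V.bracket (DirectSum.lof k ℕ _ p (Submodule.Quotient.mk ⟨x, hx⟩))
              (DirectSum.lof k ℕ _ q (Submodule.Quotient.mk ⟨y, hy⟩))
            = DirectSum.lof k ℕ _ n (Submodule.Quotient.mk ⟨P.gbracket n x y, h⟩)) ∧
      (∀ (n : ℕ) (x : O (n + 1)) (hx : x ∈ Z (n + 1)), ∃ h : P.connesB x ∈ Z n,
          V.B (DirectSum.lof k ℕ _ (n + 1) (Submodule.Quotient.mk ⟨x, hx⟩))
            = DirectSum.lof k ℕ _ n (Submodule.Quotient.mk ⟨P.connesB x, h⟩)) := by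
  subst hZ hB
  refine ⟨P.bvAlgebra, ⟨_, rfl⟩, fun p q x y hx hy => ⟨_, P.cohMul_cls ⟨x, hx⟩ ⟨y, hy⟩ rfl⟩,
    fun p q n hn x y hx hy => ⟨_, P.cohBracket_cls ⟨x, hx⟩ ⟨y, hy⟩ hn⟩,
    fun n x hx => ⟨_, P.cohB_cls ⟨x, hx⟩⟩⟩

theorem exists_bvAlgebra_hopfCohomology {k H : Type*} [CommRing k] [Ring H] [HopfAlgebra k H]
    (ς : GroupLike k H) (hς : ∀ h : H, HopfAlgebra.antipode k (HopfAlgebra.antipode k h)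
      = (ς : H) * h * ((ς⁻¹ : GroupLike k H) : H)) :
    ∃ V : BVAlgebra k (HopfCohomology k H (CounitModule k H)),
      (∃ h₁ : operadUnit k H ∈ cocycles k H (CounitModule k H) 0,
        DirectSum.lof k ℕ (HopfCohomology k H (CounitModule k H)) 0 V.one
          = cohomologyClass (operadUnit k H) h₁) ∧
      (∀ (p q : ℕ) (φ : Cochain k H (CounitModule k H) p) (ψ : Cochain k H (CounitModule k H) q)
        (hφ : φ ∈ cocycles k H (CounitModule k H) p) (hψ : ψ ∈ cocycles k H (CounitModule k H) q),
        ∃ h : cupProduct φ ψ ∈ cocycles k H (CounitModule k H) (p + q),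
          V.mul (cohomologyClass φ hφ) (cohomologyClass ψ hψ)
            = cohomologyClass (cupProduct φ ψ) h) ∧
      (∀ (p q n : ℕ) (hn : n + 1 = p + q)
        (φ : Cochain k H (CounitModule k H) p) (ψ : Cochain k H (CounitModule k H) q)
        (hφ : φ ∈ cocycles k H (CounitModule k H) p) (hψ : ψ ∈ cocycles k H (CounitModule k H) q),
        ∃ h : gerstenhaberBracket hn φ ψ ∈ cocycles k H (CounitModule k H) n,
          V.bracket (cohomologyClass φ hφ) (cohomologyClass ψ hψ)
            = cohomologyClass (gerstenhaberBracket hn φ ψ) h) ∧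
      (∀ (n : ℕ) (φ : Cochain k H (CounitModule k H) (n + 1))
        (hφ : φ ∈ cocycles k H (CounitModule k H) (n + 1)),
        ∃ h : connesOp (baseContramodule k H ς) n φ ∈ cocycles k H (CounitModule k H) n,
          V.B (cohomologyClass φ hφ)
            = cohomologyClass (connesOp (baseContramodule k H ς) n φ) h) := by
  obtain ⟨V, ⟨h₁, hV₁⟩, hV₂, hV₃, hV₄⟩ := (HopfTensor.cyclicOperad ς hς).exists_bvAlgebra
    (HopfTensor.cocycles_eq ς hς) (HopfTensor.coboundaries_eq ς hς)
  refine ⟨V, ⟨h₁, ?_⟩, fun p q x y hx hy => ?_, fun p q n hn x y hx hy => ?_, fun n x hx => ?_⟩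
  · exact congrArg (DirectSum.lof k ℕ (HopfCohomology k H (CounitModule k H)) 0) hV₁
  · rw [HopfTensor.cupProduct_eq ς hς]
    exact hV₂ p q x y hx hy
  · rw [HopfTensor.gerstenhaberBracket_eq ς hς]
    exact hV₃ p q n hn x y hx hy
  · rw [HopfTensor.connesOp_eq ς hς]
    exact hV₄ n x hx

/-! ### `Ext` by dimension shifting -/

namespace ShiftedExt

open CategoryTheory CategoryTheory.Abelian

universe w v v'

variable {C : Type v'} [Category.{v} C] [Abelian C] [HasExt.{w} C]

/-- A sequence of short exact sequences `0 → K (n + 1) → P n → K n → 0`. -/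
structure Tower (C : Type v') [Category.{v} C] [Abelian C] where
  /-- the syzygies -/
  K : ℕ → C
  /-- the middle terms -/
  P : ℕ → C
  /-- the inclusions -/
  inc : ∀ n, K (n + 1) ⟶ P n
  /-- the projections -/
  proj : ∀ n, P n ⟶ K n
  inc_proj : ∀ n, inc n ≫ proj n = 0
  shortExact : ∀ n, (ShortComplex.mk (inc n) (proj n) (inc_proj n)).ShortExact

namespace Tower

variable (T : Tower C)

/-- The class in `Ext¹ (K n) (K (n + 1))`. -/
def ext₁ (n : ℕ) : Ext.{w} (T.K n) (T.K (n + 1)) 1 := (T.shortExact n).extClass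

/-- The iterated extension class. -/
def iter : ∀ n : ℕ, Ext.{w} (T.K 0) (T.K n) n
  | 0 => Ext.mk₀ (𝟙 _)
  | n + 1 => (iter n).comp (T.ext₁ n) rfl

variable {Y : C}

theorem iter_succ_comp (n : ℕ) {j m : ℕ} (y : Ext.{w} (T.K (n + 1)) Y j) (hm : n + 1 + j = m) :
    (T.iter (n + 1)).comp y hm
      = (T.iter n).comp ((T.ext₁ n).comp y (add_comm 1 j)) (by omega) := by
  rw [iter, Ext.comp_assoc (a₂₃ := j + 1) _ _ _ _ (by omega) (by omega)]

section Linear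

variable (R : Type*) [CommRing R] [Linear R C]

/-- The map `Hom(K n, Y) → Extⁿ(K 0, Y)`. -/
def toExt (Y : C) (n : ℕ) : (T.K n ⟶ Y) →ₗ[R] Ext.{w} (T.K 0) Y n where
  toFun g := (T.iter n).comp (Ext.mk₀ g) (add_zero n)
  map_add' g g' := by rw [Ext.mk₀_add, Ext.comp_add]
  map_smul' r g := by rw [Ext.mk₀_smul, Ext.comp_smul, RingHom.id_apply]

theorem toExt_add (n : ℕ) (g g' : T.K n ⟶ Y) :
    T.toExt R Y n (g + g') = T.toExt R Y n g + T.toExt R Y n g' := map_add _ _ _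

theorem toExt_smul (n : ℕ) (r : R) (g : T.K n ⟶ Y) :
    T.toExt R Y n (r • g) = r • T.toExt R Y n g := map_smul _ _ _

/-- A chain map of degree `-p` is a family of morphisms between the short exact sequences, and
naturality of the extension class moves it past one sequence at a time. -/
theorem iter_comp_iter {p : ℕ} (F : ∀ i, T.K (p + i) ⟶ T.K i) (G : ∀ i, T.P (p + i) ⟶ T.P i)
    (h₁ : ∀ i, T.inc (p + i) ≫ G i = F (i + 1) ≫ T.inc i)
    (h₂ : ∀ i, G i ≫ T.proj i = T.proj (p + i) ≫ F i) (q : ℕ) :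
    (T.toExt R (T.K 0) p (F 0)).comp (T.iter q) rfl
      = (T.iter (p + q)).comp (Ext.mk₀.{w} (F q)) (add_zero _) := by
  induction q with
  | zero => exact Ext.comp_mk₀_id _
  | succ q ih =>
    have nat : (T.ext₁ (p + q)).comp (Ext.mk₀.{w} (F (q + 1))) (add_zero 1)
        = (Ext.mk₀.{w} (F q)).comp (T.ext₁ q) (zero_add 1) :=
      ShortComplex.ShortExact.extClass_naturality (T.shortExact (p + q)) (T.shortExact q)
        { τ₁ := F (q + 1), τ₂ := G q, τ₃ := F q, comm₁₂ := (h₁ q).symm, comm₂₃ := h₂ q }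
    rw [iter, ← Ext.comp_assoc (a₁₂ := p + q) _ _ _ rfl rfl rfl, ih,
      Ext.comp_assoc_of_second_deg_zero, ← nat]
    exact (T.iter_succ_comp (p + q) _ _).symm

theorem toExt_comp_toExt {p : ℕ} (F : ∀ i, T.K (p + i) ⟶ T.K i) (G : ∀ i, T.P (p + i) ⟶ T.P i)
    (h₁ : ∀ i, T.inc (p + i) ≫ G i = F (i + 1) ≫ T.inc i)
    (h₂ : ∀ i, G i ≫ T.proj i = T.proj (p + i) ≫ F i) {q : ℕ} (g : T.K q ⟶ Y) :
    (T.toExt R (T.K 0) p (F 0)).comp (T.toExt R Y q g) rfl = T.toExt R Y (p + q) (F q ≫ g) := by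
  have := T.iter_comp_iter R F G h₁ h₂ q
  refine (Ext.comp_assoc_of_third_deg_zero _ _ _ rfl).symm.trans ?_
  rw [this, Ext.comp_assoc_of_third_deg_zero, Ext.mk₀_comp_mk₀]
  rfl

theorem toExt_zero_eq_zero_iff (g : T.K 0 ⟶ Y) : T.toExt R Y 0 g = 0 ↔ g = 0 :=
  (Eq.congr_left (Ext.mk₀_id_comp (Ext.mk₀ g))).trans (Ext.mk₀_eq_zero_iff g)

end Linear

variable [∀ n, Projective (T.P n)]

/-- Positive `Ext` groups out of a projective middle term vanish, so each class of positive degree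
factors through the connecting class. -/
theorem exists_iter_comp {n : ℕ} (x : Ext.{w} (T.K 0) Y n) (i : ℕ) {j : ℕ} (h : i + j = n) :
    ∃ y : Ext.{w} (T.K i) Y j, (T.iter i).comp y h = x := by
  induction i generalizing j with
  | zero =>
    obtain rfl : j = n := by omega
    exact ⟨x, Ext.mk₀_id_comp x⟩
  | succ i ih =>
    obtain ⟨y, rfl⟩ := ih (j := j + 1) (by omega)
    obtain ⟨z, rfl⟩ := Ext.contravariant_sequence_exact₃ (T.shortExact i) Y y
      (Ext.eq_zero_of_projective _) (add_comm 1 j)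
    exact ⟨z, T.iter_succ_comp i z h⟩

/-- Positivity of the remaining degree `j + 1` is essential: it makes the obstruction, a class on
the projective middle term, vanish. -/
theorem eq_zero_of_iter_comp {i j n : ℕ} (y : Ext.{w} (T.K i) Y (j + 1)) (h : i + (j + 1) = n)
    (hy : (T.iter i).comp y h = 0) : y = 0 := by
  induction i generalizing j with
  | zero =>
    obtain rfl : j + 1 = n := by omega
    exact (Ext.mk₀_id_comp y).symm.trans hy
  | succ i ih =>
    rw [iter_succ_comp] at hy
    obtain ⟨z, rfl⟩ := Ext.contravariant_sequence_exact₁ (T.shortExact i) Y y (add_comm 1 (j + 1))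
      (ih _ _ hy)
    rw [Ext.eq_zero_of_projective z, Ext.comp_zero]

variable (R : Type*) [CommRing R] [Linear R C]

theorem toExt_surjective (n : ℕ) : Function.Surjective (T.toExt R Y n) := by
  intro x
  obtain ⟨y, rfl⟩ := T.exists_iter_comp x n (add_zero n)
  obtain ⟨g, rfl⟩ := (Ext.mk₀_bijective _ _).2 y
  exact ⟨g, rfl⟩

/-- All connecting maps but the last one are injective. At the last one the degree is zero, and the
kernel consists of the morphisms that extend over the middle term. -/
theorem toExt_succ_eq_zero_iff (n : ℕ) (g : T.K (n + 1) ⟶ Y) :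
    T.toExt R Y (n + 1) g = 0 ↔ ∃ f : T.P n ⟶ Y, g = T.inc n ≫ f := by
  have e : T.toExt R Y (n + 1) g
      = (T.iter n).comp ((T.ext₁ n).comp (Ext.mk₀ g) (add_zero 1)) rfl :=
    T.iter_succ_comp n _ (add_zero _)
  rw [e]
  constructor
  · intro h
    obtain ⟨z, hz⟩ := Ext.contravariant_sequence_exact₁ (T.shortExact n) Y (Ext.mk₀ g) (add_zero 1)
      (T.eq_zero_of_iter_comp (j := 0) _ _ h)
    obtain ⟨f, rfl⟩ := (Ext.mk₀_bijective _ _).2 z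
    rw [Ext.mk₀_comp_mk₀] at hz
    exact ⟨f, ((Ext.mk₀_bijective _ _).1 hz).symm⟩
  · rintro ⟨f, rfl⟩
    have := (T.shortExact n).extClass_comp_assoc (Ext.mk₀ f) (h := add_zero 1)
    rw [← Ext.mk₀_comp_mk₀]
    exact (congrArg (fun z => (T.iter n).comp z rfl) this).trans (Ext.comp_zero _ _ _ _ _)

end Tower

end ShiftedExt

/-! ### The bar resolution and its syzygies -/

namespace BarComplex

open CategoryTheory

section Modules

/-- A module over the `k`-algebra `H`, with compatible `k`-module structure. -/
structure Obj (k H : Type u) [CommRing k] [Ring H] [Algebra k H] where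
  /-- the underlying type -/
  carrier : Type u
  [addCommGroup : AddCommGroup carrier]
  [baseModule : Module k carrier]
  [module : Module H carrier]
  [isScalarTower : IsScalarTower k H carrier]

attribute [instance] Obj.addCommGroup Obj.baseModule Obj.module Obj.isScalarTower

variable (k H : Type u) [CommRing k] [Ring H] [HopfAlgebra k H]

/-- The induced modules `H ⊗ ⋯ ⊗ H ⊗ k`. -/
def obj : ℕ → Obj k H
  | 0 => ⟨CounitModule k H⟩
  | n + 1 => ⟨H ⊗[k] (obj n).carrier⟩

/-- `H ⊗ ⋯ ⊗ H ⊗ k` with `n` factors `H`; the algebra acts on the first factor. -/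
def Bar (n : ℕ) : Type u := (obj k H n).carrier

instance (n : ℕ) : AddCommGroup (Bar k H n) := (obj k H n).addCommGroup
instance (n : ℕ) : Module k (Bar k H n) := (obj k H n).baseModule
instance (n : ℕ) : Module H (Bar k H n) := (obj k H n).module
instance (n : ℕ) : IsScalarTower k H (Bar k H n) := (obj k H n).isScalarTower

/-- The recursive description of `Bar`. -/
def succEquiv (n : ℕ) : Bar k H (n + 1) ≃ₗ[H] H ⊗[k] Bar k H n := LinearEquiv.refl _ _

instance projective_base [Module.Projective k H] : ∀ n, Module.Projective k (Bar k H n)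
  | 0 => inferInstanceAs (Module.Projective k k)
  | n + 1 =>
    have := projective_base n
    inferInstanceAs (Module.Projective k (H ⊗[k] Bar k H n))

instance projective_succ [Module.Projective k H] (n : ℕ) :
    Module.Projective H (Bar k H (n + 1)) :=
  inferInstanceAs (Module.Projective H (H ⊗[k] Bar k H n))

variable {k H} {n : ℕ} {N : Type*} [AddCommGroup N] [Module k N] [Module H N] [IsScalarTower k H N]

/-- The contraction `a ↦ 1 ⊗ a`. -/
def s : Bar k H n →ₗ[k] Bar k H (n + 1) := TensorProduct.mk k H (Bar k H n) 1

/-- The universal property of the induced module. -/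
def lift (φ : Bar k H n →ₗ[k] N) : Bar k H (n + 1) →ₗ[H] N :=
  TensorProduct.AlgebraTensorModule.lift
    (LinearMap.toSpanSingleton H (Bar k H n →ₗ[k] N) φ) ∘ₗ (succEquiv k H n).toLinearMap

@[simp]
theorem lift_s (φ : Bar k H n →ₗ[k] N) (a : Bar k H n) : lift φ (s a) = φ a := by
  change (1 : H) • φ a = φ a
  rw [one_smul]

theorem hom_ext {F G : Bar k H (n + 1) →ₗ[H] N} (h : ∀ a, F (s a) = G (s a)) : F = G := by
  refine TensorProduct.AlgebraTensorModule.curry_injective (R := k) (A := H) (M := H)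
    (N := Bar k H n) ?_
  ext a
  exact h a

theorem lift_comp_s (F : Bar k H (n + 1) →ₗ[H] N) : lift (F.restrictScalars k ∘ₗ s) = F :=
  hom_ext fun a => lift_s _ a

variable (k H) in
/-- The differential `d (h ⊗ a) = h a - h ⊗ d a`. -/
def d : ∀ n, Bar k H (n + 1) →ₗ[H] Bar k H n
  | 0 => lift LinearMap.id
  | n + 1 => lift (LinearMap.id - s ∘ₗ (d n).restrictScalars k)

theorem d_s_zero (a : Bar k H 0) : d k H 0 (s a) = a := lift_s _ _

theorem d_s (a : Bar k H (n + 1)) : d k H (n + 1) (s a) = a - s (d k H n a) := lift_s _ _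

/-- This is proved together with `d² = 0`. The identity in degree `m` gives `d² = 0` there, which
need only be checked on elements `s a`; then `d s = 1 - s d` gives the identity in degree `m + 1`.
-/
theorem d_s_d (x : Bar k H (n + 1)) : d k H n (s (d k H n x)) = d k H n x := by
  suffices h : ∀ m (x : Bar k H (m + 1)), d k H m (s (d k H m x)) = d k H m x from h n x
  intro m
  induction m with
  | zero => exact fun x => d_s_zero _
  | succ m ih =>
    suffices h : d k H m ∘ₗ d k H (m + 1) = 0 by
      intro x
      rw [d_s, show d k H m (d k H (m + 1) x) = 0 from congr($h x), map_zero, sub_zero]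
    refine hom_ext fun a => ?_
    rw [LinearMap.comp_apply, d_s, map_sub, ih, sub_self, LinearMap.zero_apply]

theorem d_d (x : Bar k H (n + 2)) : d k H n (d k H (n + 1) x) = 0 := by
  have h : d k H n ∘ₗ d k H (n + 1) = 0 := hom_ext fun a => by
    rw [LinearMap.comp_apply, d_s, map_sub, d_s_d, sub_self, LinearMap.zero_apply]
  exact congr($h x)

end Modules

section Syzygies

variable (k H : Type u) [CommRing k] [Ring H] [HopfAlgebra k H]

/-- The syzygies of the trivial module. -/
def syz : ℕ → ModuleCat.{u} H
  | 0 => ModuleCat.of H (CounitModule k H)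
  | n + 1 => ModuleCat.of H (LinearMap.range (d k H (n + 1)))

/-- The inclusion of the syzygies. -/
def inj : ∀ n, syz k H n →ₗ[H] Bar k H n
  | 0 => (LinearMap.id : CounitModule k H →ₗ[H] CounitModule k H)
  | n + 1 => (LinearMap.range (d k H (n + 1))).subtype

theorem inj_injective : ∀ n, Function.Injective (inj k H n)
  | 0 => fun _ _ h => h
  | n + 1 => (LinearMap.range (d k H (n + 1))).injective_subtype

theorem range_inj : ∀ n, LinearMap.range (inj k H n) = LinearMap.range (d k H n)
  | 0 => LinearMap.range_id.trans
      (LinearMap.range_eq_top.2 fun a => ⟨s a, d_s_zero a⟩).symm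
  | _ + 1 => Submodule.range_subtype _

variable {k H} {n : ℕ} {N : Type*} [AddCommGroup N] [Module H N]

theorem exists_d_eq_inj (x : syz k H n) : ∃ y, d k H n y = inj k H n x := by
  have : inj k H n x ∈ LinearMap.range (d k H n) := range_inj k H n ▸ LinearMap.mem_range_self _ x
  exact this

/-- Restriction of the codomain to the syzygies. -/
def corestrict (F : N →ₗ[H] Bar k H n) (h : ∀ x, F x ∈ LinearMap.range (d k H n)) :
    N →ₗ[H] syz k H n :=
  (LinearEquiv.ofInjective (inj k H n) (inj_injective k H n)).symm.toLinearMap ∘ₗ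
    F.codRestrict (LinearMap.range (inj k H n)) fun x => range_inj k H n ▸ h x

theorem inj_corestrict (F : N →ₗ[H] Bar k H n) (h : ∀ x, F x ∈ LinearMap.range (d k H n)) (x : N) :
    inj k H n (corestrict F h x) = F x :=
  congrArg Subtype.val ((LinearEquiv.ofInjective (inj k H n) (inj_injective k H n)).apply_symm_apply
    ⟨F x, range_inj k H n ▸ h x⟩)

variable (k H n) in
/-- The projection onto the syzygies. -/
def proj : Bar k H (n + 1) →ₗ[H] syz k H n := corestrict (d k H n) fun x => ⟨x, rfl⟩

theorem inj_proj (x : Bar k H (n + 1)) : inj k H n (proj k H n x) = d k H n x :=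
  inj_corestrict _ _ x

theorem proj_surjective : Function.Surjective (proj k H n) := fun x => by
  obtain ⟨y, hy⟩ := exists_d_eq_inj x
  exact ⟨y, inj_injective k H n ((inj_proj y).trans hy)⟩

theorem d_inj (x : syz k H (n + 1)) : d k H n (inj k H (n + 1) x) = 0 := by
  obtain ⟨y, hy⟩ := exists_d_eq_inj x
  rw [← hy, d_d]

theorem proj_inj (x : syz k H (n + 1)) : proj k H n (inj k H (n + 1) x) = 0 :=
  inj_injective k H n (by rw [inj_proj, d_inj, map_zero])

/-- Exactness: a cycle `x` equals `d (s x)`. -/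
theorem exists_inj_eq {x : Bar k H (n + 1)} (hx : d k H n x = 0) :
    ∃ y, inj k H (n + 1) y = x := by
  have : x ∈ LinearMap.range (d k H (n + 1)) := ⟨s x, by rw [d_s, hx, map_zero, sub_zero]⟩
  rwa [← range_inj] at this

variable (k H) in
/-- The bar resolution of the trivial module, cut into short exact sequences. -/
def tower : ShiftedExt.Tower (ModuleCat.{u} H) where
  K := syz k H
  P n := ModuleCat.of H (Bar k H (n + 1))
  inc n := ModuleCat.ofHom (inj k H (n + 1))
  proj n := ModuleCat.ofHom (proj k H n)
  inc_proj n := by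
    ext x
    exact proj_inj x
  shortExact n := by
    refine { exact := (ShortComplex.moduleCat_exact_iff _).2 fun x hx => ?_,
             mono_f := (ModuleCat.mono_iff_injective _).2 (inj_injective k H (n + 1)),
             epi_g := (ModuleCat.epi_iff_surjective _).2 proj_surjective }
    refine exists_inj_eq (k := k) (H := H) (n := n) ?_
    rw [← inj_proj]
    exact (congrArg (inj k H n) hx).trans (map_zero _)

instance [Module.Projective k H] (n : ℕ) : Projective ((tower k H).P n) :=
  (IsProjective.iff_projective _).1 (projective_succ k H n)

end Syzygies

end BarComplex

/-! ### From cocycles to `Ext` classes -/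

namespace BarComplex

open CategoryTheory CategoryTheory.Abelian

variable {k H : Type u} [CommRing k] [Ring H] [HopfAlgebra k H] {n : ℕ}

variable (k H) in
/-- The codifferential on functionals, `(δ φ)(h ⊗ a) = ε(h) φ(a) - φ(d (h ⊗ a))`. -/
def codiff (n : ℕ) : (Bar k H n →ₗ[k] CounitModule k H) →ₗ[k]
    (Bar k H (n + 1) →ₗ[k] CounitModule k H) where
  toFun φ := (lift φ).restrictScalars k - φ ∘ₗ (d k H n).restrictScalars k
  map_add' φ ψ := by
    have h : lift (φ + ψ) = lift φ + lift ψ := hom_ext fun a => by simp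
    ext x
    simp [h]
    abel
  map_smul' r φ := by
    have h : lift (r • φ) = r • lift φ := hom_ext fun a => by simp
    ext x
    simp [h, smul_sub]

theorem codiff_apply (φ : Bar k H n →ₗ[k] CounitModule k H) (x : Bar k H (n + 1)) :
    codiff k H n φ x = lift φ x - φ (d k H n x) := rfl

theorem apply_d {φ : Bar k H n →ₗ[k] CounitModule k H} (hφ : codiff k H n φ = 0)
    (x : Bar k H (n + 1)) : φ (d k H n x) = lift φ x :=
  (sub_eq_zero.1 congr($hφ x)).symm

/-- A cocycle restricts to an `H`-linear form on the syzygies. -/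
def restrictHom {φ : Bar k H n →ₗ[k] CounitModule k H} (hφ : codiff k H n φ = 0) :
    syz k H n →ₗ[H] CounitModule k H where
  toFun x := φ (inj k H n x)
  map_add' x y := by rw [map_add, map_add]
  map_smul' h x := by
    obtain ⟨y, hy⟩ := exists_d_eq_inj x
    rw [map_smul, ← hy, ← map_smul, apply_d hφ, apply_d hφ, map_smul, RingHom.id_apply]

/-- The restriction of cocycles to the syzygies. -/
def restrict (φ : LinearMap.ker (codiff k H n)) :
    syz k H n ⟶ ModuleCat.of H (CounitModule k H) :=
  ModuleCat.ofHom (restrictHom φ.2)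

theorem restrict_apply (φ : LinearMap.ker (codiff k H n)) (x : syz k H n) :
    (restrict φ).hom x = φ.1 (inj k H n x) := rfl

/-- A form `g` on the syzygy is pulled back to an `H`-linear `G` on `Bar (n + 1)` and then
restricted along `s`. The cocycle condition becomes `G s d = G`, which follows from `d s d = d`. -/
theorem restrict_surjective : Function.Surjective (restrict (k := k) (H := H) (n := n)) := by
  intro g
  let G : Bar k H (n + 1) →ₗ[H] CounitModule k H := g.hom ∘ₗ proj k H n
  have h : ∀ x, G (s (d k H n x)) = G x := fun x => by
    refine congrArg g.hom (inj_injective k H n ?_)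
    rw [inj_proj, inj_proj, d_s_d]
  have hG : lift (G.restrictScalars k ∘ₗ s) = G := lift_comp_s G
  refine ⟨⟨G.restrictScalars k ∘ₗ s, ?_⟩, ?_⟩
  · ext x
    rw [codiff_apply, hG]
    exact sub_eq_zero.2 (h x).symm
  · ext x
    obtain ⟨y, hy⟩ := exists_d_eq_inj x
    change G (s (inj k H n x)) = _
    rw [← hy, h]
    refine congrArg g.hom (inj_injective k H n ?_)
    rw [inj_proj, hy]

theorem restrict_zero_eq_zero_iff (φ : LinearMap.ker (codiff k H 0)) :
    restrict φ = 0 ↔ φ = 0 := by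
  refine ⟨fun h => ?_, fun h => by rw [h]; rfl⟩
  exact Subtype.ext (LinearMap.ext fun x => congr(($h).hom x))

/-- If `F` extends the restriction of `φ`, then `F ∘ s` is a functional with codifferential `φ`.
Conversely, if `φ` is the codifferential of `e`, then `lift e` is an extension, because `d` vanishes
on the syzygy. -/
theorem restrict_succ_factors_iff (φ : LinearMap.ker (codiff k H (n + 1))) :
    (∃ F : ModuleCat.of H (Bar k H (n + 1)) ⟶ ModuleCat.of H (CounitModule k H),
      restrict φ = ModuleCat.ofHom (inj k H (n + 1)) ≫ F) ↔
      φ.1 ∈ LinearMap.range (codiff k H n) := by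
  constructor
  · rintro ⟨F, hF⟩
    have h : ∀ x : Bar k H (n + 1), φ.1 (d k H (n + 1) (s x)) = F.hom (d k H (n + 1) (s x)) :=
      fun x => by
        have := congr(($hF).hom (proj k H (n + 1) (s x)))
        rw [restrict_apply, inj_proj] at this
        exact this.trans (congrArg F.hom (inj_proj _))
    refine ⟨F.hom.restrictScalars k ∘ₗ s, ?_⟩
    ext x
    rw [codiff_apply, lift_comp_s]
    change F.hom x - F.hom (s (d k H n x)) = φ.1 x
    have := h x
    rw [apply_d φ.2, lift_s, d_s, map_sub] at this
    exact this.symm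
  · rintro ⟨e, he⟩
    refine ⟨ModuleCat.ofHom (lift e), ?_⟩
    ext x
    rw [restrict_apply, ← he, codiff_apply, d_inj, map_zero, sub_zero]
    rfl

/-- The lift of a functional to a chain map of degree `-p`. -/
def chain {p : ℕ} (φ : Bar k H p →ₗ[k] CounitModule k H) :
    ∀ i, Bar k H (p + i) →ₗ[k] Bar k H i
  | 0 => φ
  | i + 1 => (lift (s ∘ₗ chain φ i)).restrictScalars k

/-- The chain map keeps the first `i` tensor factors and applies `φ` to the rest. For `i = 0` the
claim is the cocycle condition. The induction compares `H`-linear maps on elements `s a`, where `d s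
= 1 - s d` lowers the index. -/
theorem chain_d {p : ℕ} {φ : Bar k H p →ₗ[k] CounitModule k H} (hφ : codiff k H p φ = 0) (i : ℕ)
    (x : Bar k H (p + i + 1)) :
    chain φ i (d k H (p + i) x) = d k H i (lift (s ∘ₗ chain φ i) x) := by
  induction i with
  | zero =>
    have h : d k H 0 ∘ₗ lift (s ∘ₗ chain φ 0) = lift φ := hom_ext fun a =>
      (congrArg (d k H 0) (lift_s _ a)).trans ((d_s_zero _).trans (lift_s φ a).symm)
    exact (apply_d hφ x).trans congr($h x).symm
  | succ i ih =>
    suffices h : lift (s ∘ₗ chain φ i) ∘ₗ d k H (p + (i + 1))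
        = d k H (i + 1) ∘ₗ lift (s ∘ₗ chain φ (i + 1)) from congr($h x)
    refine hom_ext fun a => ?_
    rw [LinearMap.comp_apply, LinearMap.comp_apply, lift_s, LinearMap.comp_apply, d_s]
    refine (congrArg (lift (s ∘ₗ chain φ i)) (d_s (n := p + i) a)).trans ?_
    rw [map_sub, lift_s, LinearMap.comp_apply, ih]
    rfl

/-- The chain map induces maps of syzygies. -/
def chainSyz {p : ℕ} {φ : Bar k H p →ₗ[k] CounitModule k H} (hφ : codiff k H p φ = 0) (i : ℕ) :
    syz k H (p + i) →ₗ[H] syz k H i :=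
  corestrict
    { toFun := fun x => chain φ i (inj k H (p + i) x)
      map_add' := fun x y => by rw [map_add, map_add]
      map_smul' := fun h x => by
        obtain ⟨y, hy⟩ := exists_d_eq_inj x
        rw [map_smul, ← hy, ← map_smul, chain_d hφ, chain_d hφ, map_smul, map_smul,
          RingHom.id_apply] }
    fun x => by
      obtain ⟨y, hy⟩ := exists_d_eq_inj x
      exact ⟨_, (chain_d hφ i y).symm.trans (congrArg _ hy)⟩

theorem inj_chainSyz {p : ℕ} {φ : Bar k H p →ₗ[k] CounitModule k H} (hφ : codiff k H p φ = 0)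
    (i : ℕ) (x : syz k H (p + i)) :
    inj k H i (chainSyz hφ i x) = chain φ i (inj k H (p + i) x) :=
  inj_corestrict _ _ x

theorem proj_chain {p : ℕ} {φ : Bar k H p →ₗ[k] CounitModule k H} (hφ : codiff k H p φ = 0)
    (i : ℕ) (x : Bar k H (p + i + 1)) :
    proj k H i (lift (s ∘ₗ chain φ i) x) = chainSyz hφ i (proj k H (p + i) x) :=
  inj_injective k H i (by rw [inj_proj, inj_chainSyz, inj_proj, chain_d hφ])

variable (k H) in
/-- The class in `Ext` of a cocycle. -/
def extCls (n : ℕ) : LinearMap.ker (codiff k H n) →ₗ[k] ExtBase k H n where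
  toFun φ := (tower k H).toExt k (ModuleCat.of H (CounitModule k H)) n (restrict φ)
  map_add' φ ψ := (tower k H).toExt_add k n (restrict φ) (restrict ψ)
  map_smul' r φ := by
    refine (congrArg ((tower k H).toExt k (ModuleCat.of H (CounitModule k H)) n) ?_).trans
      ((tower k H).toExt_smul k n r (restrict φ))
    exact ModuleCat.hom_ext (LinearMap.ext fun x =>
      (algebraMap_smul H r (φ.1 (inj k H n x))).symm)

/-- The chain map of `φ` lifts the form that `φ` induces on the syzygy, so composing it with `ψ`
computes the Yoneda product. -/
theorem extCls_comp {p q : ℕ} (φ : LinearMap.ker (codiff k H p)) (ψ : LinearMap.ker (codiff k H q))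
    (χ : LinearMap.ker (codiff k H (p + q))) (h : χ.1 = ψ.1 ∘ₗ chain φ.1 q) :
    (extCls k H p φ).comp (extCls k H q ψ) rfl = extCls k H (p + q) χ := by
  have h₀ : restrict φ = ModuleCat.ofHom (chainSyz φ.2 0) :=
    ModuleCat.hom_ext (LinearMap.ext fun x => (inj_chainSyz φ.2 0 x).symm)
  refine (congrArg (fun g => ((tower k H).toExt k (ModuleCat.of H (CounitModule k H)) p g).comp
    (extCls k H q ψ) rfl) h₀).trans ?_
  refine ((tower k H).toExt_comp_toExt (Y := ModuleCat.of H (CounitModule k H)) k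
    (fun i => ModuleCat.ofHom (chainSyz φ.2 i))
    (fun i => ModuleCat.ofHom (lift (s ∘ₗ chain φ.1 i))) (fun i => ?_) (fun i => ?_)
    (restrict ψ) :).trans ?_
  · ext x
    exact (inj_chainSyz φ.2 (i + 1) x).symm
  · exact ModuleCat.hom_ext (LinearMap.ext fun x => proj_chain φ.2 i x)
  · refine congrArg ((tower k H).toExt k (ModuleCat.of H (CounitModule k H)) (p + q))
      (ModuleCat.hom_ext (LinearMap.ext fun x => ?_))
    exact (congrArg ψ.1 (inj_chainSyz φ.2 q x)).trans
      congr($h (inj k H (p + q) x)).symm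

theorem extCls_zero_eq_zero_iff (φ : LinearMap.ker (codiff k H 0)) :
    extCls k H 0 φ = 0 ↔ φ = 0 :=
  ((tower k H).toExt_zero_eq_zero_iff k _).trans (restrict_zero_eq_zero_iff φ)

variable [Module.Projective k H]

theorem extCls_surjective : Function.Surjective (extCls k H n) :=
  ((tower k H).toExt_surjective k n).comp (restrict_surjective (k := k) (H := H))

theorem extCls_succ_eq_zero_iff (φ : LinearMap.ker (codiff k H (n + 1))) :
    extCls k H (n + 1) φ = 0 ↔ φ.1 ∈ LinearMap.range (codiff k H n) :=
  ((tower k H).toExt_succ_eq_zero_iff k n _).trans (restrict_succ_factors_iff φ)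

end BarComplex

/-! ### The differential in terms of the leading arguments -/

namespace HopfTensor

variable {k H : Type*} [CommRing k] [Ring H] [HopfAlgebra k H]

/-- Evaluation of a cochain in its first argument. -/
def slice {n : ℕ} (u : H) :
    Cochain k H (CounitModule k H) (n + 1) →ₗ[k] Cochain k H (CounitModule k H) n :=
  LinearMap.applyₗ u ∘ₗ
    (multilinearCurryLeftEquiv k (fun _ : Fin (n + 1) => H) (CounitModule k H)).toLinearMap

theorem ev_slice {n : ℕ} (u : H) (f : Cochain k H (CounitModule k H) (n + 1))
    {x : TensorAlgebra k H} (hx : x ∈ deg k H n) :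
    ev (slice u f) x = ev f (TensorAlgebra.ι k u * x) := by
  refine ev_eq_of_tprod (φ := ev f ∘ₗ LinearMap.mulLeft k (TensorAlgebra.ι k u)) (fun v => ?_) hx
  rw [LinearMap.comp_apply, LinearMap.mulLeft_apply, ← tprod_cons, ev_tprod]
  rfl

theorem ev_coface_mid {n s i : ℕ} (hn : s + 1 + i = n) (f : Cochain k H (CounitModule k H) n)
    {x y z : TensorAlgebra k H} (hx : x ∈ deg k H s) (hy : y ∈ deg k H 2) (hz : z ∈ deg k H i) :
    ev (coface k H (CounitModule k H) n ⟨i + 1, by omega⟩ f) (x * y * z)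
      = ev f (x * TensorAlgebra.ι k (total k H y) * z) := by
  rw [coface_mid (by omega)]
  refine (ev_comp (p := n) (q := 2) rfl hn f (operadMul k H) hx hy hz).trans ?_
  rw [isAug_operadMul.coev hy]

theorem slice_coface {n i : ℕ} (hi : i < n + 1) (u : H)
    (f : Cochain k H (CounitModule k H) (n + 1)) :
    slice u (coface k H (CounitModule k H) (n + 1) ⟨i, by omega⟩ f)
      = coface k H (CounitModule k H) n ⟨i, by omega⟩ (slice u f) := by
  rcases i with _ | i
  · refine ev_ext fun w hw => eq_of_mul n 1 rfl (fun x hx y hy => ?_) hw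
    rw [deg, pow_one] at hy
    obtain ⟨v, rfl⟩ := hy
    rw [ev_slice u _ (mul_mem_deg hx (ι_mem_deg v) rfl), ← mul_assoc]
    exact (ev_cofaceZero f v (mul_mem_deg (ι_mem_deg u) hx (add_comm _ _))).trans
      ((ev_cofaceZero (slice u f) v hx).trans (by rw [ev_slice u f hx])).symm
  · refine ev_ext₃ (n - 1 - i) 2 i (by omega) fun x hx y hy z hz => ?_
    rw [ev_slice u _ (mul_mem_deg (mul_mem_deg hx hy rfl) hz (by omega)),
      ev_coface_mid (by omega) (slice u f) hx hy hz,
      ev_slice u f (mul_mem_deg (mul_mem_deg hx (ι_mem_deg _) rfl) hz (by omega)),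
      ← mul_assoc, ← mul_assoc,
      ev_coface_mid (by omega) f (mul_mem_deg (ι_mem_deg u) hx rfl) hy hz, ← mul_assoc,
      ← mul_assoc]

theorem slice_slice_coface {n : ℕ} (u v : H) (f : Cochain k H (CounitModule k H) (n + 1)) :
    slice v (slice u (coface k H (CounitModule k H) (n + 1) ⟨n + 1, by omega⟩ f))
      = slice (u * v) f := by
  refine ev_ext fun x hx => ?_
  have := ev_coface_mid (by omega : 0 + 1 + n = n + 1) f one_mem_deg
    (mul_mem_deg (ι_mem_deg u) (ι_mem_deg v) rfl) hx
  rw [one_mul, one_mul, map_mul (total k H), total_ι, total_ι, mul_assoc] at this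
  rw [ev_slice v _ hx, ev_slice u _ (mul_mem_deg (ι_mem_deg v) hx (add_comm _ _)), this,
    ev_slice _ _ hx]

theorem slice_cofaceLast {n : ℕ} (u : H) (f : Cochain k H (CounitModule k H) n) :
    slice u (coface k H (CounitModule k H) n (Fin.last _) f)
      = Coalgebra.counit (R := k) u • f := by
  have : coface k H (CounitModule k H) n (Fin.last _) = cofaceLast k H (CounitModule k H) n := by
    simp [coface]
  rw [this]
  refine ev_ext fun x hx => ?_
  rw [ev_slice u _ hx, ev_cofaceLast f u hx, ev_smul]
  rfl

theorem differential_zero (f : Cochain k H (CounitModule k H) 0) :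
    differential k H (CounitModule k H) 0 f = 0 := by
  refine ev_ext fun x hx => ?_
  rw [deg, zero_add, pow_one] at hx
  obtain ⟨u, rfl⟩ := hx
  have h₀ := ev_cofaceZero f u one_mem_deg
  have h₁ := ev_cofaceLast f u one_mem_deg
  rw [one_mul] at h₀
  rw [mul_one] at h₁
  have : differential k H (CounitModule k H) 0 f
      = cofaceZero k H (CounitModule k H) 0 f
        + (-1 : k) • cofaceLast k H (CounitModule k H) 0 f := by
    simp [differential, coface]
    module
  rw [this, ev_add, ev_smul, LinearMap.add_apply, LinearMap.smul_apply, h₀, h₁]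
  simp [ev, hat]

/-- All but the last two cofaces leave the first argument alone. The last two multiply the first two
arguments and apply the counit to the first one. This mirrors the recursion `d (h ⊗ a) = h a - h ⊗ d
a` of the bar complex. -/
theorem slice_slice_differential {n : ℕ} (u v : H) (f : Cochain k H (CounitModule k H) (n + 1)) :
    slice v (slice u (differential k H (CounitModule k H) (n + 1) f))
      = slice v (differential k H (CounitModule k H) n (slice u f))
        - (-1 : k) ^ (n + 1) • (Coalgebra.counit (R := k) v • slice u f - slice (u * v) f
          + Coalgebra.counit (R := k) u • slice v f) := by
  have h₁ : slice u (differential k H (CounitModule k H) (n + 1) f)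
      = ∑ i : Fin (n + 1), (-1 : k) ^ i.val •
          coface k H (CounitModule k H) n i.castSucc (slice u f)
        + (-1 : k) ^ (n + 1) •
          slice u (coface k H (CounitModule k H) (n + 1) ⟨n + 1, by omega⟩ f)
        + (-1 : k) ^ (n + 2) • Coalgebra.counit (R := k) u • f := by
    rw [differential, Fin.sum_univ_castSucc, Fin.sum_univ_castSucc]
    simp only [LinearMap.add_apply, LinearMap.smul_apply, LinearMap.sum_apply, map_add, map_smul,
      map_sum, slice_cofaceLast]
    congr 2
    exact Finset.sum_congr rfl fun i _ => congrArg _ (slice_coface i.2 u f)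
  have h₂ : differential k H (CounitModule k H) n (slice u f)
      = ∑ i : Fin (n + 1), (-1 : k) ^ i.val •
          coface k H (CounitModule k H) n i.castSucc (slice u f)
        + (-1 : k) ^ (n + 1) • coface k H (CounitModule k H) n (Fin.last _) (slice u f) := by
    rw [differential, Fin.sum_univ_castSucc]
    simp only [LinearMap.add_apply, LinearMap.smul_apply, LinearMap.sum_apply]
    rfl
  rw [h₁, h₂]
  simp only [map_add, map_smul, slice_slice_coface, slice_cofaceLast]
  module

end HopfTensor

/-! ### Cochains as functionals on the bar resolution -/

namespace BarComplex

open HopfTensor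

variable {k H : Type u} [CommRing k] [Ring H] [HopfAlgebra k H] {n : ℕ}

variable (k H) in
/-- Cochains as functionals on the modules of the bar resolution. -/
def dual : ∀ n, Cochain k H (CounitModule k H) n ≃ₗ[k] (Bar k H n →ₗ[k] CounitModule k H)
  | 0 => (MultilinearMap.constLinearEquivOfIsEmpty (R := k) (S := k) (M₁ := fun _ : Fin 0 => H)
      (M₂ := CounitModule k H)).symm.trans (LinearMap.ringLmapEquivSelf k k (CounitModule k H)).symm
  | n + 1 => (multilinearCurryLeftEquiv k (fun _ : Fin (n + 1) => H) (CounitModule k H)).trans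
      ((LinearEquiv.congrRight (dual n)).trans
        (TensorProduct.lift.equiv (RingHom.id k) H (Bar k H n) (CounitModule k H)))

theorem linearMap_ext {N : Type*} [AddCommGroup N] [Module k N] {φ ψ : Bar k H (n + 1) →ₗ[k] N}
    (h : ∀ (u : H) (a : Bar k H n), φ (u • s a) = ψ (u • s a)) : φ = ψ := by
  have key : ∀ (u : H) (a : Bar k H n), u • s (k := k) a = (succEquiv k H n).symm (u ⊗ₜ a) :=
    fun u a => congrArg (fun x : H => (succEquiv k H n).symm (x ⊗ₜ a)) (mul_one u)
  refine TensorProduct.ext' (M := H) (N := Bar k H n) fun u a => ?_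
  have := h u a
  rw [key] at this
  exact this

theorem dual_smul_s (f : Cochain k H (CounitModule k H) (n + 1)) (u : H) (a : Bar k H n) :
    dual k H (n + 1) f (u • s a) = dual k H n (slice u f) a :=
  congrArg (fun x => dual k H n (slice x f) a) (mul_one u)

theorem codiff_dual_zero (f : Cochain k H (CounitModule k H) 0) :
    codiff k H 0 (dual k H 0 f) = 0 := by
  refine linearMap_ext fun u a => ?_
  rw [codiff_apply, map_smul, map_smul, lift_s, d_s_zero, LinearMap.zero_apply]
  have : u • a = Coalgebra.counit (R := k) u • a := CounitModule.smul_def k H u a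
  rw [this, map_smul]
  exact sub_eq_zero.2 (CounitModule.smul_def k H u _)

theorem codiff_smul_s_smul_s (φ : Bar k H (n + 1) →ₗ[k] CounitModule k H) (u v : H)
    (a : Bar k H n) :
    codiff k H (n + 1) φ (u • s (v • s a))
      = u • φ (v • s a) - φ ((u * v) • s a) + φ (u • s (d k H n (v • s a))) := by
  rw [codiff_apply, map_smul (lift φ), map_smul (d k H (n + 1)), lift_s, d_s, smul_sub, map_sub,
    mul_smul]
  abel

/-- The cofaces of the cochain complex are numbered from the last argument, while the bar
differential starts with the first; hence the sign. -/
theorem codiff_dual (f : Cochain k H (CounitModule k H) n) :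
    codiff k H n (dual k H n f)
      = (-1 : k) ^ (n + 1) • dual k H (n + 1) (differential k H (CounitModule k H) n f) := by
  induction n with
  | zero => rw [codiff_dual_zero, differential_zero, map_zero, smul_zero]
  | succ n ih =>
    refine linearMap_ext fun u b => ?_
    -- A second reduction to elements `v • s a`, since the recursion for the differential involves
    -- the first two arguments.
    refine congr($(linearMap_ext (φ := codiff k H (n + 1) (dual k H (n + 1) f) ∘ₗ
        Algebra.lsmul k k _ u ∘ₗ s)
      (ψ := ((-1 : k) ^ (n + 2) • dual k H (n + 2) (differential k H (CounitModule k H) (n + 1) f))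
        ∘ₗ Algebra.lsmul k k _ u ∘ₗ s) fun v a => ?_) b)
    simp only [LinearMap.comp_apply, Algebra.lsmul_coe, LinearMap.smul_apply]
    rw [codiff_smul_s_smul_s, dual_smul_s, dual_smul_s, dual_smul_s, dual_smul_s, dual_smul_s,
      slice_slice_differential]
    have h := congr($(ih (slice u f)) (v • s a))
    rw [codiff_apply, LinearMap.smul_apply, dual_smul_s, map_smul, lift_s,
      CounitModule.smul_def, sub_eq_iff_eq_add, ← sub_eq_iff_eq_add'] at h
    rw [← h, CounitModule.smul_def]
    simp only [map_sub, map_add, map_smul, LinearMap.sub_apply, LinearMap.add_apply,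
      LinearMap.smul_apply, pow_succ]
    have e : ((-1 : k) ^ n) * (-1) ^ n = 1 := by rw [← mul_pow]; simp
    generalize (-1 : k) ^ n = σ at e ⊢
    match_scalars <;> grind

theorem dual_zero_apply (f : Cochain k H (CounitModule k H) 0) (a : CounitModule k H) :
    dual k H 0 f a = ev f 1 • a := by
  have h := ev_tprod f Fin.elim0
  rw [show TensorAlgebra.tprod k H 0 Fin.elim0 = 1 by simp] at h
  rw [h]
  refine (mul_comm _ _).trans (congrArg
    (fun x => CounitModule.toBase k H (f x) * CounitModule.toBase k H a) ?_)
  exact Subsingleton.elim _ _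

/-- The chain map of `f` evaluates `f` on the last factors, so composing with `g` gives the product
in which `g` reads the first arguments, that is `g ⌣ f`. -/
theorem dual_eq_comp_chain {p q : ℕ} (f : Cochain k H (CounitModule k H) p)
    (g : Cochain k H (CounitModule k H) q) (χ : Cochain k H (CounitModule k H) (p + q))
    (h : ∀ y ∈ deg k H q, ∀ x ∈ deg k H p, ev χ (y * x) = ev g y * ev f x) :
    dual k H (p + q) χ = dual k H q g ∘ₗ chain (dual k H p f) q := by
  induction q with
  | zero =>
    have e : χ = ev g 1 • f := ev_ext fun x hx => by
      have := h 1 one_mem_deg x hx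
      rw [one_mul] at this
      exact this.trans congr($(ev_smul (ev g 1) f) x).symm
    refine LinearMap.ext fun a => ?_
    rw [e]
    refine (congr($((dual k H p).map_smul (ev g 1) f) a)).trans ?_
    exact (dual_zero_apply g _).symm
  | succ q ih =>
    refine linearMap_ext (n := p + q) fun u a => ?_
    refine (dual_smul_s (n := p + q) χ u a).trans ?_
    rw [ih (slice u g) (slice u χ) fun y hy x hx => ?_]
    · have e : u • s (chain (dual k H p f) q a)
          = lift (s ∘ₗ chain (dual k H p f) q) (u • s a) := by
        rw [map_smul, lift_s]
        rfl
      exact (dual_smul_s g u _).symm.trans (congrArg (dual k H (q + 1) g) e)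
    · rw [ev_slice u g hy, ev_slice u χ (mul_mem_deg hy hx (add_comm _ _)), ← mul_assoc]
      exact h _ (mul_mem_deg (ι_mem_deg u) hy (add_comm _ _)) x hx

end BarComplex

/-! ### Transport of Batalin–Vilkovisky structures -/

section Transport

variable {k : Type*} [CommRing k] {A A' : ℕ → Type*} [∀ n, AddCommGroup (A n)]
  [∀ n, Module k (A n)] [∀ n, AddCommGroup (A' n)] [∀ n, Module k (A' n)]

theorem DirectSum.congrLinearEquiv_lof (θ : ∀ n, A n ≃ₗ[k] A' n) (n : ℕ) (a : A n) :
    DirectSum.congrLinearEquiv θ (DirectSum.lof k ℕ A n a) = DirectSum.lof k ℕ A' n (θ n a) := by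
  rw [DirectSum.coe_congrLinearEquiv]
  exact DirectSum.lmap_lof _ _ _

theorem DirectSum.congrLinearEquiv_symm_lof (θ : ∀ n, A n ≃ₗ[k] A' n) (n : ℕ) (a : A' n) :
    (DirectSum.congrLinearEquiv θ).symm (DirectSum.lof k ℕ A' n a)
      = DirectSum.lof k ℕ A n ((θ n).symm a) := by
  rw [LinearEquiv.symm_apply_eq, congrLinearEquiv_lof, LinearEquiv.apply_symm_apply]

/-- Transport of a Batalin–Vilkovisky structure along degreewise linear equivalences. -/
def BVAlgebra.transport (V : BVAlgebra k A) (θ : ∀ n, A n ≃ₗ[k] A' n) : BVAlgebra k A' where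
  mul := (V.mul.compl₁₂ (DirectSum.congrLinearEquiv θ).symm.toLinearMap
    (DirectSum.congrLinearEquiv θ).symm.toLinearMap).compr₂
      (DirectSum.congrLinearEquiv θ).toLinearMap
  one := θ 0 V.one
  bracket := (V.bracket.compl₁₂ (DirectSum.congrLinearEquiv θ).symm.toLinearMap
    (DirectSum.congrLinearEquiv θ).symm.toLinearMap).compr₂
      (DirectSum.congrLinearEquiv θ).toLinearMap
  B := (DirectSum.congrLinearEquiv θ).toLinearMap ∘ₗ V.B ∘ₗ
    (DirectSum.congrLinearEquiv θ).symm.toLinearMap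
  mul_degree p q a b := by
    obtain ⟨c, hc⟩ := V.mul_degree p q ((θ p).symm a) ((θ q).symm b)
    exact ⟨θ _ c, by simp [DirectSum.congrLinearEquiv_symm_lof, hc, DirectSum.congrLinearEquiv_lof]⟩
  mul_assoc x y z := by simp [V.mul_assoc]
  one_mul x := by simp [DirectSum.congrLinearEquiv_symm_lof, V.one_mul]
  mul_one x := by simp [DirectSum.congrLinearEquiv_symm_lof, V.mul_one]
  mul_comm p q a b := by
    simp only [LinearMap.compr₂_apply, LinearMap.compl₁₂_apply, LinearEquiv.coe_coe,
      DirectSum.congrLinearEquiv_symm_lof]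
    rw [V.mul_comm, map_smul]
  bracket_degree p q n hn a b := by
    obtain ⟨c, hc⟩ := V.bracket_degree p q n hn ((θ p).symm a) ((θ q).symm b)
    exact ⟨θ _ c, by simp [DirectSum.congrLinearEquiv_symm_lof, hc, DirectSum.congrLinearEquiv_lof]⟩
  bracket_degree_zero a b := by
    simp [DirectSum.congrLinearEquiv_symm_lof, V.bracket_degree_zero]
  bracket_skew p q a b := by
    simp only [LinearMap.compr₂_apply, LinearMap.compl₁₂_apply, LinearEquiv.coe_coe,
      DirectSum.congrLinearEquiv_symm_lof]
    rw [V.bracket_skew, map_neg, map_smul]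
  jacobi p q a b z := by
    simp only [LinearMap.compr₂_apply, LinearMap.compl₁₂_apply, LinearEquiv.coe_coe,
      DirectSum.congrLinearEquiv_symm_lof, LinearEquiv.symm_apply_apply]
    rw [V.jacobi, map_add, map_smul]
  leibniz r q c a y := by
    simp only [LinearMap.compr₂_apply, LinearMap.compl₁₂_apply, LinearEquiv.coe_coe,
      DirectSum.congrLinearEquiv_symm_lof, LinearEquiv.symm_apply_apply]
    rw [V.leibniz, map_add, map_smul]
  B_degree n a := by
    obtain ⟨c, hc⟩ := V.B_degree n ((θ (n + 1)).symm a)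
    exact ⟨θ _ c, by simp [DirectSum.congrLinearEquiv_symm_lof, hc, DirectSum.congrLinearEquiv_lof]⟩
  B_degree_zero a := by simp [DirectSum.congrLinearEquiv_symm_lof, V.B_degree_zero]
  B_B x := by simp [V.B_B]
  bracket_eq p a y := by
    simp only [LinearMap.compr₂_apply, LinearMap.compl₁₂_apply, LinearEquiv.coe_coe,
      DirectSum.congrLinearEquiv_symm_lof, LinearEquiv.symm_apply_apply, LinearMap.comp_apply]
    rw [V.bracket_eq, map_smul, map_sub, map_sub, map_smul]

theorem BVAlgebra.transport_mul_lmap (V : BVAlgebra k A) (θ : ∀ n, A n ≃ₗ[k] A' n)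
    (a b : ⨁ n, A n) : DirectSum.lmap (fun n => (θ n).toLinearMap) (V.mul a b)
      = (V.transport θ).mul (DirectSum.lmap (fun n => (θ n).toLinearMap) a)
        (DirectSum.lmap (fun n => (θ n).toLinearMap) b) := by
  simp [← DirectSum.coe_congrLinearEquiv, BVAlgebra.transport]

theorem BVAlgebra.transport_bracket_lmap (V : BVAlgebra k A) (θ : ∀ n, A n ≃ₗ[k] A' n)
    (a b : ⨁ n, A n) : DirectSum.lmap (fun n => (θ n).toLinearMap) (V.bracket a b)
      = (V.transport θ).bracket (DirectSum.lmap (fun n => (θ n).toLinearMap) a)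
        (DirectSum.lmap (fun n => (θ n).toLinearMap) b) := by
  simp [← DirectSum.coe_congrLinearEquiv, BVAlgebra.transport]

theorem BVAlgebra.transport_B_lmap (V : BVAlgebra k A) (θ : ∀ n, A n ≃ₗ[k] A' n)
    (a : ⨁ n, A n) : DirectSum.lmap (fun n => (θ n).toLinearMap) (V.B a)
      = (V.transport θ).B (DirectSum.lmap (fun n => (θ n).toLinearMap) a) := by
  simp [← DirectSum.coe_congrLinearEquiv, BVAlgebra.transport]

theorem BVAlgebra.transport_mul_lof (V : BVAlgebra k A) (θ : ∀ n, A n ≃ₗ[k] A' n) {p q n : ℕ}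
    {a : A p} {b : A q} {c : A n} {r : k}
    (h : V.mul (DirectSum.lof k ℕ A p a) (DirectSum.lof k ℕ A q b) = r • DirectSum.lof k ℕ A n c) :
    (V.transport θ).mul (DirectSum.lof k ℕ A' p (θ p a)) (DirectSum.lof k ℕ A' q (θ q b))
      = DirectSum.lof k ℕ A' n (r • θ n c) := by
  rw [← DirectSum.congrLinearEquiv_lof, ← DirectSum.congrLinearEquiv_lof,
    DirectSum.coe_congrLinearEquiv, ← transport_mul_lmap, h, map_smul, DirectSum.lmap_lof, map_smul]
  rfl

end Transport

/-! ### Cohomology as `Ext` and the Yoneda product -/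

namespace BarComplex

open HopfTensor CategoryTheory CategoryTheory.Abelian

variable (k H : Type u) [CommRing k] [Ring H] [HopfAlgebra k H]

/-- Cocycles as functionals on the bar resolution. -/
def dualCocycle (n : ℕ) :
    cocycles k H (CounitModule k H) n →ₗ[k] LinearMap.ker (codiff k H n) :=
  ((dual k H n).toLinearMap.domRestrict _).codRestrict _ fun f => by
    rw [LinearMap.mem_ker]
    refine (codiff_dual f.1).trans ?_
    rw [LinearMap.mem_ker.1 f.2, map_zero, smul_zero]

theorem dualCocycle_coe (n : ℕ) (f : cocycles k H (CounitModule k H) n) :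
    (dualCocycle k H n f : Bar k H n →ₗ[k] CounitModule k H) = dual k H n f := rfl

theorem neg_one_pow_smul_eq_iff {M : Type*} [AddCommGroup M] [Module k M] (n : ℕ) {x y : M} :
    (-1 : k) ^ n • x = y ↔ x = (-1 : k) ^ n • y := by
  have h : (-1 : k) ^ n * (-1) ^ n = 1 := by rw [← mul_pow]; simp
  constructor
  · rintro rfl
    rw [smul_smul, h, one_smul]
  · rintro rfl
    rw [smul_smul, h, one_smul]

theorem dualCocycle_surjective (n : ℕ) : Function.Surjective (dualCocycle k H n) := fun φ => by
  have h := codiff_dual ((dual k H n).symm φ)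
  rw [LinearEquiv.apply_symm_apply, LinearMap.mem_ker.1 φ.2, eq_comm] at h
  have h' := (neg_one_pow_smul_eq_iff k (M := Bar k H (n + 1) →ₗ[k] CounitModule k H)
    (n + 1)).1 h
  rw [smul_zero, LinearEquiv.map_eq_zero_iff] at h'
  exact ⟨⟨_, h'⟩, Subtype.ext ((dual k H n).apply_symm_apply _)⟩

variable {k H} in
/-- The class of the product of cocycles, in a degree that is only propositionally the sum. -/
theorem exists_cup {p q n : ℕ} (hn : n = p + q)
    (V : BVAlgebra k (HopfCohomology k H (CounitModule k H)))
    (hV : ∀ (p q : ℕ) (φ : Cochain k H (CounitModule k H) p) (ψ : Cochain k H (CounitModule k H) q)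
      (hφ : φ ∈ cocycles k H (CounitModule k H) p) (hψ : ψ ∈ cocycles k H (CounitModule k H) q),
      ∃ h : cupProduct φ ψ ∈ cocycles k H (CounitModule k H) (p + q),
        V.mul (cohomologyClass φ hφ) (cohomologyClass ψ hψ)
          = cohomologyClass (cupProduct φ ψ) h)
    (f : cocycles k H (CounitModule k H) p) (g : cocycles k H (CounitModule k H) q) :
    ∃ χ : cocycles k H (CounitModule k H) n,
      V.mul (cohomologyClass f.1 f.2) (cohomologyClass g.1 g.2) = cohomologyClass χ.1 χ.2 ∧
      ∀ x ∈ deg k H p, ∀ y ∈ deg k H q, ev χ.1 (x * y) = ev f.1 x * ev g.1 y := by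
  subst hn
  obtain ⟨h, e⟩ := hV p q f.1 g.1 f.2 g.2
  refine ⟨⟨_, h⟩, e, fun x hx y hy => ?_⟩
  have h₁ := ev_operadComp (n := p + q) (by omega) (by omega) (by omega : p + 1 + 0 = p + 1)
    (operadComp (n := p + 1) (by omega) 1 (operadMul k H) f.1) g.1 hx hy one_mem_deg
  have h₂ := ev_operadComp (n := p + 1) (by omega) (by omega) (by omega : 0 + 1 + 1 = 2)
    (operadMul k H) f.1 one_mem_deg hx (ι_mem_deg (coev g.1 y))
  rw [one_mul, one_mul, isAug_operadMul _ (mul_mem_deg (ι_mem_deg _) (ι_mem_deg _) rfl),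
    map_mul (aug k H), aug_ι, aug_ι, counit_coev, counit_coev] at h₂
  rw [mul_one, mul_one] at h₁
  exact h₁.trans h₂

variable [Module.Projective k H]

theorem extCls_dualCocycle_eq_zero_iff (n : ℕ) (f : cocycles k H (CounitModule k H) n) :
    extCls k H n (dualCocycle k H n f) = 0 ↔ f.1 ∈ coboundaries k H (CounitModule k H) n := by
  rcases n with _ | n
  · rw [extCls_zero_eq_zero_iff, coboundaries, Submodule.mem_bot, Subtype.ext_iff, dualCocycle_coe]
    exact LinearEquiv.map_eq_zero_iff _
  · rw [extCls_succ_eq_zero_iff, dualCocycle_coe, coboundaries]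
    constructor
    · rintro ⟨φ, hφ⟩
      refine ⟨(-1 : k) ^ (n + 1) • (dual k H n).symm φ, (dual k H (n + 1)).injective ?_⟩
      rw [← hφ, map_smul, map_smul, ← codiff_dual, LinearEquiv.apply_symm_apply]
    · rintro ⟨e, he⟩
      refine ⟨(-1 : k) ^ (n + 1) • dual k H n e, ?_⟩
      rw [map_smul, codiff_dual, he]
      exact (neg_one_pow_smul_eq_iff k (M := Bar k H (n + 1) →ₗ[k] CounitModule k H)
    (n + 1)).2 rfl

/-- `Hⁿ(H, k) ≅ Extⁿ_H(k, k)`. -/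
def cohEquiv (n : ℕ) : HopfCohomology k H (CounitModule k H) n ≃ₗ[k] ExtBase k H n :=
  (Submodule.quotEquivOfEq _ _ (by
    ext f
    exact (extCls_dualCocycle_eq_zero_iff k H n f).symm)).trans
    ((extCls k H n ∘ₗ dualCocycle k H n).quotKerEquivOfSurjective
      ((extCls_surjective (k := k) (H := H) (n := n)).comp (dualCocycle_surjective k H n)))

variable {k H}

/-- The exponent of the sign that turns the cup product into the Yoneda product. -/
def yonedaExp (n : ℕ) : ℕ := ∑ i ∈ Finset.range n, i

/-- The exponent is `n(n-1)/2`, whose failure to be additive is exactly the exponent of the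
commutation sign. -/
theorem yonedaExp_add (p q : ℕ) : yonedaExp (p + q) = yonedaExp p + yonedaExp q + p * q := by
  induction q with
  | zero => simp [yonedaExp]
  | succ q ih =>
    simp only [yonedaExp, ← add_assoc, Finset.sum_range_succ] at ih ⊢
    rw [ih]
    ring

variable (k H) in
/-- The isomorphism `Hⁿ(H, k) ≅ Extⁿ_H(k, k)` with the sign that makes it multiplicative. -/
def yonedaEquiv (n : ℕ) : HopfCohomology k H (CounitModule k H) n ≃ₗ[k] ExtBase k H n :=
  (cohEquiv k H n).trans (LinearEquiv.smulOfUnit ((-1 : kˣ) ^ yonedaExp n))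

theorem yonedaEquiv_mk (n : ℕ) (f : cocycles k H (CounitModule k H) n) :
    yonedaEquiv k H n (Submodule.Quotient.mk f)
      = (-1 : k) ^ yonedaExp n • extCls k H n (dualCocycle k H n f) := by
  refine (congrArg (fun r : k => r • extCls k H n (dualCocycle k H n f)) ?_ :
    (((-1 : kˣ) ^ yonedaExp n : kˣ) : k) • extCls k H n (dualCocycle k H n f) = _)
  simp

/-- The composite of the classes of `f` and `g` is the class of `g ⌣ f`, which in cohomology is
`(-1)^{pq} f ⌣ g`; the signs in `yonedaEquiv` absorb the factor `(-1)^{pq}`. -/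
theorem transport_mul (V : BVAlgebra k (HopfCohomology k H (CounitModule k H)))
    (hV : ∀ (p q : ℕ) (φ : Cochain k H (CounitModule k H) p) (ψ : Cochain k H (CounitModule k H) q)
      (hφ : φ ∈ cocycles k H (CounitModule k H) p) (hψ : ψ ∈ cocycles k H (CounitModule k H) q),
      ∃ h : cupProduct φ ψ ∈ cocycles k H (CounitModule k H) (p + q),
        V.mul (cohomologyClass φ hφ) (cohomologyClass ψ hψ)
          = cohomologyClass (cupProduct φ ψ) h)
    (p q : ℕ) (x : ExtBase k H p) (y : ExtBase k H q) :
    (V.transport (yonedaEquiv k H)).mul (DirectSum.lof k ℕ (ExtBase k H) p x)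
        (DirectSum.lof k ℕ (ExtBase k H) q y)
      = DirectSum.lof k ℕ (ExtBase k H) (p + q) (x.comp y rfl) := by
  obtain ⟨x, rfl⟩ := (yonedaEquiv k H p).surjective x
  obtain ⟨y, rfl⟩ := (yonedaEquiv k H q).surjective y
  obtain ⟨f, rfl⟩ := Submodule.Quotient.mk_surjective _ x
  obtain ⟨g, rfl⟩ := Submodule.Quotient.mk_surjective _ y
  obtain ⟨χ, hχ, hχ'⟩ := exists_cup (add_comm p q) V hV g f
  have hcomp := extCls_comp (dualCocycle k H p f) (dualCocycle k H q g)
    (dualCocycle k H (p + q) χ) (dual_eq_comp_chain f.1 g.1 χ.1 hχ')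
  have h₁ : V.mul (cohomologyClass f.1 f.2) (cohomologyClass g.1 g.2)
      = (-1 : k) ^ (p * q) • cohomologyClass χ.1 χ.2 := by
    rw [← hχ]
    exact V.mul_comm p q _ _
  refine (V.transport_mul_lof (yonedaEquiv k H) h₁).trans
    (congrArg (DirectSum.lof k ℕ (ExtBase k H) (p + q)) ?_)
  rw [yonedaEquiv_mk, yonedaEquiv_mk, yonedaEquiv_mk, CategoryTheory.Abelian.Ext.smul_comp,
    CategoryTheory.Abelian.Ext.comp_smul, hcomp, smul_smul, smul_smul, yonedaExp_add]
  congr 1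
  simp only [pow_add]
  have e : ((-1 : k) ^ (p * q)) * (-1) ^ (p * q) = 1 := by rw [← mul_pow]; simp
  linear_combination (-1 : k) ^ yonedaExp p * (-1) ^ yonedaExp q * e

end BarComplex

/-- Let `H` be a Hopf algebra over `k` and `ς` a grouplike element with `S²(h) = ς h ς⁻¹`. Then
`k_ς` is a stable anti Yetter–Drinfel'd contramodule, and `H^•(H, k_ς)`, with the cup product, the
Gerstenhaber bracket and Connes' coboundary, is a Batalin–Vilkovisky algebra. If `H` is
`k`-projective, then this is `Ext_H(k, k_ς)` with the Yoneda product. -/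
theorem corollary6p4 {k H : Type u} [CommRing k] [Ring H] [HopfAlgebra k H] (ς : GroupLike k H)
    (hς : ∀ h : H, HopfAlgebra.antipode k (HopfAlgebra.antipode k h)
      = (ς : H) * h * ((ς⁻¹ : GroupLike k H) : H)) :
    (baseContramodule k H ς).IsAntiYetterDrinfeld ∧
    (baseContramodule k H ς).IsStable ∧
    ∃ V : BVAlgebra k (HopfCohomology k H (CounitModule k H)),
      (∃ h₁ : operadUnit k H ∈ cocycles k H (CounitModule k H) 0,
        DirectSum.lof k ℕ (HopfCohomology k H (CounitModule k H)) 0 V.one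
          = cohomologyClass (operadUnit k H) h₁) ∧
      (∀ (p q : ℕ) (φ : Cochain k H (CounitModule k H) p) (ψ : Cochain k H (CounitModule k H) q)
        (hφ : φ ∈ cocycles k H (CounitModule k H) p) (hψ : ψ ∈ cocycles k H (CounitModule k H) q),
        ∃ h : cupProduct φ ψ ∈ cocycles k H (CounitModule k H) (p + q),
          V.mul (cohomologyClass φ hφ) (cohomologyClass ψ hψ)
            = cohomologyClass (cupProduct φ ψ) h) ∧
      (∀ (p q n : ℕ) (hn : n + 1 = p + q)
        (φ : Cochain k H (CounitModule k H) p) (ψ : Cochain k H (CounitModule k H) q)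
        (hφ : φ ∈ cocycles k H (CounitModule k H) p) (hψ : ψ ∈ cocycles k H (CounitModule k H) q),
        ∃ h : gerstenhaberBracket hn φ ψ ∈ cocycles k H (CounitModule k H) n,
          V.bracket (cohomologyClass φ hφ) (cohomologyClass ψ hψ)
            = cohomologyClass (gerstenhaberBracket hn φ ψ) h) ∧
      (∀ (n : ℕ) (φ : Cochain k H (CounitModule k H) (n + 1))
        (hφ : φ ∈ cocycles k H (CounitModule k H) (n + 1)),
        ∃ h : connesOp (baseContramodule k H ς) n φ ∈ cocycles k H (CounitModule k H) n,
          V.B (cohomologyClass φ hφ)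
            = cohomologyClass (connesOp (baseContramodule k H ς) n φ) h) ∧
      (Module.Projective k H →
        ∃ (E : BVAlgebra k (ExtBase k H))
          (θ : ∀ n, HopfCohomology k H (CounitModule k H) n ≃ₗ[k] ExtBase k H n),
          (∀ (p q : ℕ) (x : ExtBase k H p) (y : ExtBase k H q),
            E.mul (DirectSum.lof k ℕ (ExtBase k H) p x) (DirectSum.lof k ℕ (ExtBase k H) q y)
              = DirectSum.lof k ℕ (ExtBase k H) (p + q) (x.comp y rfl)) ∧
          (∀ a b, DirectSum.lmap (fun n => (θ n).toLinearMap) (V.mul a b)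
            = E.mul (DirectSum.lmap (fun n => (θ n).toLinearMap) a)
                (DirectSum.lmap (fun n => (θ n).toLinearMap) b)) ∧
          (∀ a b, DirectSum.lmap (fun n => (θ n).toLinearMap) (V.bracket a b)
            = E.bracket (DirectSum.lmap (fun n => (θ n).toLinearMap) a)
                (DirectSum.lmap (fun n => (θ n).toLinearMap) b)) ∧
          (∀ a, DirectSum.lmap (fun n => (θ n).toLinearMap) (V.B a)
            = E.B (DirectSum.lmap (fun n => (θ n).toLinearMap) a))) := by
  obtain ⟨V, h₁, h₂, h₃, h₄⟩ := exists_bvAlgebra_hopfCohomology ς hς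
  refine ⟨HopfTensor.isAntiYetterDrinfeld ς hς, HopfTensor.isStable ς, V, h₁, h₂, h₃, h₄,
    fun _ => ⟨V.transport (BarComplex.yonedaEquiv k H), BarComplex.yonedaEquiv k H,
      BarComplex.transport_mul V h₂, V.transport_mul_lmap _, V.transport_bracket_lmap _,
      V.transport_B_lmap _⟩⟩



end
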